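/- **Setting.** Let $(\mathsf X,\mathcal X)$ and $(\mathsf Y,\mathcal Y)$ be measurable spaces, $\mathcal X$ countably generated. Let $Q$ be a Markov kernel on $\mathsf X$ and $G(x,dy)=g(x,y)\,\nu(dy)$ a Markov kernel from $\mathsf X$ to $\mathsf Y$, where $\nu$ is $\sigma$-finite and $g\ge 0$ is jointly measurable. For $y_{k:m}=(y_k,\dots,y_m)\in\mathsf Y^{m-k+1}$ put $$L\langle y_{k:m}\rangle(x_k,A)=\int\!\cdots\!\int \mathbf 1_A(x_{m+1})\prod_{\ell=k}^m g(x_\ell,y_\ell)\,Q(x_\ell,dx_{\ell+1}),\qquad L\langle y_{k:m}\rangle(x,\cdot)=\delta_x\ \text{ if } k>m,$$ and, for a probability measure $\chi$ on $\mathsf X$, let $\phi_\chi\langle y_{k:m}\rangle(A)=\chi L\langle y_{k:m}\rangle\mathbf 1_A/\chi L\langle y_{k:m}\rangle\mathbf 1_{\mathsf X}$ be the predictor (so that $\phi_\chi\langle y_{k:m}\rangle=\chi$ if $k>m$). The asymptotic variance of the bootstrap particle filter approximation of the predictor $\phi_\chi\langle y_{0:n-1}\rangle$ is, for bounded measurable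 $h$, $$\sigma_\chi^2\langle y_{0:n-1}\rangle(h)=\sum_{k=0}^n\int\phi_\chi\langle y_{0:k-1}\rangle(dx)\left(\frac{L\langle y_{k:n-1}\rangle h(x)-\phi_\chi\langle y_{0:n-1}\rangle h\cdot L\langle y_{k:n-1}\rangle\mathbf 1_{\mathsf X}(x)}{\phi_\chi\langle y_{0:k-1}\rangle L\langle y_{k:n-1}\rangle\mathbf 1_{\mathsf X}}\right)^2 .$$ For an integer $r\ge1$, a set $C\in\mathcal X$ is *$r$-local Doeblin* if there are functions $\epsilon_C^\pm:\mathsf Y^r\to(0,\infty)$, probability measures $\lambda_C\langle z\rangle$ on $\mathsf X$ with $\lambda_C\langle z\rangle(C)=1$, and functions $\varphi_C\langle z\rangle:\mathsf X\to(0,\infty)$, $z\in\mathsf Y^r$, such that for all $z\in\mathsf Y^r$, $A\in\mathcal X$ and $x\in C$, $$\epsilon_C^-\langle z\rangle\,\varphi_C\langle z\rangle(x)\,\lambda_C\langle z\rangle(A)\le L\langle z\rangle(x,A\cap C)\le\epsilon_C^+\langle z\rangle\,\varphi_C\langle z\rangle(x)\,\lambda_C\langle z\rangle(A).$$ **Assumptions.**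 Let $(Y_n)_{n\ge0}$ be a $\mathsf Y$-valued process on a probability space $(\Omega,\mathcal A,\mathbb P)$; its law need not be related to the model $(Q,G)$. (A1) $(Y_n)$ is strictly stationary and ergodic, and there are an integer $r\ge1$ and a set $K\in\mathcal Y^{\otimes r}$ such that: (i) the process $Z_n=(Y_{nr},\dots,Y_{(n+1)r-1})$, $n\ge 0$, is ergodic and $\mathbb P(Z_0\in K)>2/3$; (ii) for every $\eta>0$ there is an $r$-local Doeblin set $C$, with associated functions $\epsilon^\pm_C$, such that $$\sup_{x\notin C}L\langle z\rangle(x,\mathsf X)\le\eta\,\sup_{x\in\mathsf X}L\langle z\rangle(x,\mathsf X)<\infty\quad\text{for all } z\in K,\qquad\text{and}\qquad \inf_{z\in K}\epsilon_C^-\langle z\rangle/\epsilon_C^+\langle z\rangle>0;$$ (iii) there is a set $D\in\mathcal X$ with $\mathbb E\big[\ln^-\inf_{x\in D}L\langle Y_{0:r-1}\rangle(x,D)\big]<\infty$. (A2) $g(x,y)>0$ for all $(x,y)\in\mathsf X\times\mathsf Y$, and $\mathbb E\big[\ln^+\sup_{x\in\mathsf X}g(x,Y_0)\big]<\infty$.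 For $r$ and $D$ as in (A1), let $\mathcal M(D,r)$ be the set of probability measures $\chi$ on $\mathsf X$ with $\mathbb E[\ln^-\chi L\langle Y_{0:\ell-1}\rangle\mathbf 1_D]<\infty$ for all $\ell\in\{0,\dots,r\}$. **Theorem.** Assume (A1)–(A2). Then for every $\chi\in\mathcal M(D,r)$ and every bounded measurable $h:\mathsf X\to\mathbb R$, the sequence of random variables $\big(\sigma_\chi^2\langle Y_{0:n-1}\rangle(h)\big)_{n\ge1}$ is tight, that is, for every $\epsilon>0$ there is $a>0$ with $\mathbb P\big(|\sigma_\chi^2\langle Y_{0:n-1}\rangle(h)|>a\big)\le\epsilon$ for all $n\ge1$. -/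

import Mathlib

open MeasureTheory ProbabilityTheory
open scoped ENNReal NNReal

namespace ParticleFilter

/-- A hidden Markov model with state space `X` and observation space `Y`: hidden Markov kernel `Q`,
observation kernel `G`, and a transition density `g` of `G` with respect to a `σ`-finite
measure `ref` on `Y`. -/
structure HMM (X Y : Type*) [MeasurableSpace X] [MeasurableSpace Y] where
  /-- kernel of the hidden chain -/
  Q : Kernel X X
  markov_Q : IsMarkovKernel Q
  /-- kernel of the observations given the states -/
  G : Kernel X Y
  markov_G : IsMarkovKernel G
  /-- reference measure -/
  ref : Measure Y
  sigmaFinite_ref : SigmaFinite ref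
  /-- likelihood `g x y` -/
  g : X → Y → ℝ
  measurable_g : Measurable (Function.uncurry g)
  g_nonneg : ∀ x y, 0 ≤ g x y
  G_eq : ∀ x, G x = ref.withDensity fun y => ENNReal.ofReal (g x y)

attribute [instance] HMM.markov_Q HMM.markov_G HMM.sigmaFinite_ref

/-- `ln⁻ x = max (-ln x) 0` for `x ∈ [0, ∞]`, with `ln⁻ 0 = ∞`. -/
noncomputable def lnMinus (x : ℝ≥0∞) : ℝ≥0∞ := (-ENNReal.log x).toENNReal

/-- `ln⁺ x = max (ln x) 0` for `x ∈ [0, ∞]`, with `ln⁺ ∞ = ∞`. -/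
noncomputable def lnPlus (x : ℝ≥0∞) : ℝ≥0∞ := (ENNReal.log x).toENNReal

/-- `E[f] < ∞` for a `[0, ∞]`-valued function `f` under the law `μ`. -/
def FiniteExpectation {S : Type*} [MeasurableSpace S] (μ : Measure S) (f : S → ℝ≥0∞) : Prop :=
  AEMeasurable f μ ∧ ∫⁻ s, f s ∂μ < ∞

/-- The law on `S^ℕ` of the process `U` is invariant and ergodic for the shift. -/
def IsStationaryErgodic {Ω S : Type*} [MeasurableSpace Ω] [MeasurableSpace S]
    (P : Measure Ω) (U : ℕ → Ω → S) : Prop :=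
  Ergodic (fun (s : ℕ → S) (n : ℕ) => s (n + 1)) (P.map fun ω n => U n ω)

/-- Tightness of a family of real random variables: tightness of the family of their laws. -/
def IsTightFamily {Ω ι : Type*} [MeasurableSpace Ω] (P : Measure Ω) (Z : ι → Ω → ℝ) : Prop :=
  (∀ i, AEMeasurable (Z i) P) ∧ IsTightMeasureSet (Set.range fun i => P.map (Z i))

/-- The record `y_k, …, y_{n-1}` (empty if `n ≤ k`). -/
def record {Y : Type*} (y : ℕ → Y) (k n : ℕ) : List Y := (List.range' k (n - k)).map y

/-- The blocks `Z_n = (Y_{nr}, …, Y_{(n+1)r-1})` of a process `Y`. -/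
def blocks {Ω Y : Type*} (r : ℕ) (U : ℕ → Ω → Y) (n : ℕ) (ω : Ω) : Fin r → Y :=
  fun i => U (n * r + i) ω

namespace HMM

variable {X Y : Type*} [MeasurableSpace X] [MeasurableSpace Y]

/-- The one-step unnormalized kernel `L⟨y⟩(x, A) = g(x, y) Q(x, A)`. -/
noncomputable def step (M : HMM X Y) (y : Y) : Kernel X X :=
  M.Q.withDensity fun x _ => ENNReal.ofReal (M.g x y)

/-- The unnormalized kernel `L⟨y_k, …, y_m⟩ = L⟨y_k⟩ ⋯ L⟨y_m⟩` of a record of observations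
(the first observation acts first), with `L⟨⟩(x, ·) = δ_x` for the empty record. -/
noncomputable def L (M : HMM X Y) : List Y → Kernel X X
  | [] => Kernel.id
  | y :: l => (M.L l) ∘ₖ (M.step y)

/-- The predictor `φ_χ⟨l⟩(A) = χ L⟨l⟩ 1_A / χ L⟨l⟩ 1_X`. -/
noncomputable def pred (M : HMM X Y) (χ : Measure X) (l : List Y) : Measure X :=
  ((χ.bind (M.L l)) Set.univ)⁻¹ • χ.bind (M.L l)

/-- The asymptotic variance `σ²_χ⟨y_{0:n-1}⟩(h)` of the bootstrap-filter approximation of the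
predictor. -/
noncomputable def asympVar (M : HMM X Y) (χ : Measure X) (h : X → ℝ) (y : ℕ → Y) (n : ℕ) : ℝ :=
  ∑ k ∈ Finset.range (n + 1),
    ∫ x, (((∫ x', h x' ∂(M.L (record y k n) x))
        - (∫ x', h x' ∂(M.pred χ (record y 0 n))) * (M.L (record y k n) x).real Set.univ)
      / ((M.pred χ (record y 0 k)).bind (M.L (record y k n))).real Set.univ) ^ 2
      ∂(M.pred χ (record y 0 k))

/-- `C` is an `r`-local Doeblin set, with the functions `εm = ε⁻`, `εp = ε⁺`, the probability
measures `lam z` and the positive functions `φ z` as witnesses. -/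
structure LocalDoeblinWith (M : HMM X Y) (r : ℕ) (C : Set X) (εm εp : (Fin r → Y) → ℝ)
    (lam : (Fin r → Y) → Measure X) (φ : (Fin r → Y) → X → ℝ) : Prop where
  measurableSet : MeasurableSet C
  εm_pos : ∀ z, 0 < εm z
  εp_pos : ∀ z, 0 < εp z
  φ_pos : ∀ z x, 0 < φ z x
  prob : ∀ z, IsProbabilityMeasure (lam z)
  lam_self : ∀ z, lam z C = 1
  lower : ∀ z, ∀ A, MeasurableSet A → ∀ x ∈ C,
    ENNReal.ofReal (εm z * φ z x) * lam z A ≤ M.L (List.ofFn z) x (A ∩ C)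
  upper : ∀ z, ∀ A, MeasurableSet A → ∀ x ∈ C,
    M.L (List.ofFn z) x (A ∩ C) ≤ ENNReal.ofReal (εp z * φ z x) * lam z A

/-- Stationarity, ergodicity, local Doeblin and minorization assumptions on the model and the
observation process `U`, for the integer `r` and the sets `K`, `D`. -/
structure ObservationCondition (M : HMM X Y) {Ω : Type*} [MeasurableSpace Ω]
    (P : Measure Ω) (U : ℕ → Ω → Y)
    (r : ℕ) (K : Set (Fin r → Y)) (D : Set X) : Prop where
  stationary_ergodic : IsStationaryErgodic P U
  r_pos : 0 < r
  measurableSet_K : MeasurableSet K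
  blocks_ergodic : IsStationaryErgodic P (blocks r U)
  prob_K : 2 / 3 < P {ω | blocks r U 0 ω ∈ K}
  doeblin : ∀ η : ℝ≥0, 0 < η → ∃ (C : Set X) (εm εp : (Fin r → Y) → ℝ)
    (lam : (Fin r → Y) → Measure X) (φ : (Fin r → Y) → X → ℝ),
    M.LocalDoeblinWith r C εm εp lam φ ∧
    (∀ z ∈ K,
      (⨆ x ∈ Cᶜ, M.L (List.ofFn z) x Set.univ) ≤ η * (⨆ x, M.L (List.ofFn z) x Set.univ) ∧
      (η : ℝ≥0∞) * (⨆ x, M.L (List.ofFn z) x Set.univ) < ∞) ∧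
    ∃ c : ℝ, 0 < c ∧ ∀ z ∈ K, c ≤ εm z / εp z
  measurableSet_D : MeasurableSet D
  minoration : FiniteExpectation (P.map (blocks r U 0))
    fun z => lnMinus (⨅ x ∈ D, M.L (List.ofFn z) x D)

/-- Positivity of the likelihood and `E[ln⁺ ‖g(·, Y_0)‖_∞] < ∞`. -/
structure LikelihoodCondition (M : HMM X Y) {Ω : Type*} [MeasurableSpace Ω]
    (P : Measure Ω) (U : ℕ → Ω → Y) :
    Prop where
  g_pos : ∀ x y, 0 < M.g x y
  moment : FiniteExpectation (P.map (U 0)) fun y => lnPlus (⨆ x, ENNReal.ofReal (M.g x y))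

/-- The class `M(D, r)` of initial distributions: the probability measures `χ` with
`E[ln⁻ χ L⟨Y_{0:ℓ-1}⟩ 1_D] < ∞` for all `ℓ ∈ {0, …, r}`. -/
def initialLaws (M : HMM X Y) {Ω : Type*} [MeasurableSpace Ω] (P : Measure Ω) (U : ℕ → Ω → Y)
    (D : Set X) (r : ℕ) : Set (Measure X) :=
  {χ | IsProbabilityMeasure χ ∧ ∀ ℓ ≤ r,
    FiniteExpectation P fun ω => lnMinus (χ.bind (M.L (record (fun k => U k ω) 0 ℓ)) D)}

end HMM

end ParticleFilter

/-! Write `μ_k = χ L⟨y_{0:k-1}⟩`. The `k`-th summand of the variance is a mean of squares of `μ_k(X)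
(L_k h(x) μ_n(X) - μ_n(h) L_k 1(x)) / μ_n(X)²`, where `L_k = L⟨y_{k:n-1}⟩`. It suffices to bound
this quantity, uniformly in `x`, by a random constant times an exponential in `-(n - k)`, with a
constant that is tight in `n`. The summands are then dominated by a geometric series
(`HMM.asympVar_le`).

Forgetting alone is not enough: `L_k 1(x)` must also be compared, uniformly in `x`, with its mean
under the predictor. Both are done by counting blocks of length `r`. Masses are weighted by `1` on a
local Doeblin set `C` and by `exp (-ℓ)` off `C`. A good block multiplies the weighted mass of paths
not staying in `C` by at most `exp (v - ℓ)`; any other block costs at most `exp (v + ℓ)`. The mass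
staying in `C` during a good block is renewed through the minorizing measure, hence comparable with
masses in `D` just before and just after. This yields, in forward time, `μ_k(X)` against a slightly
later mass of `D` (`Control.flow_univ_le_D`) and, in backward time, `L_k 1(x)` against `μ_n(X)`
(`Control.apply_univ_mul_le`), both up to `exp (O(δ) (n - k))` with `δ` arbitrarily small.

Forgetting is a coupling argument for pairs (`BlockChain.lintegral_mul_le_swap_add`): either a pair
meets in `C × C` at least `J` times, with a fixed contraction each time, or it carries small
weighted mass. Taking `J` proportional to the number of remaining blocks gives an exponential rate
that beats the `O(δ)` losses (`Control.osc_mul_le`).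

A block is good when it lies in `K` and finitely many masses around it are bounded below. Since
`P(K) > 2/3`, for large `ℓ` the drift over a long window is negative with high probability, which
forces paths from `D` to `D` through `C`. Good blocks thus have frequency above `3/5`, and the mean
of the slope `2 (v + b) + log 2 ± ℓ` is negative (`PathModel.exists_parameters`). The doubled terms
and `log 2` are what the pair estimate requires.

Tightness, rather than almost sure boundedness, comes from the ergodic input: sums of slopes are
read backward from the final block, and a coboundary approximation with a maximal inequality
controls all of them simultaneously, with a probability independent of the end point
(`exists_measure_backward_sum_le`). -/

namespace ParticleFilter

/-! ### Ergodic theory: backward sums, uniformly in the end point -/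

section Ergodic

open Filter Topology

variable {α : Type*}

/-- The running maximum of the backward Birkhoff sums of `f`, through its Lindley recursion. -/
noncomputable def lindley (T : α → α) (f : α → ℝ) : ℕ → α → ℝ
  | 0, _ => 0
  | n + 1, x => max 0 (lindley T f n x + f (T^[n] x))

theorem lindley_nonneg (T : α → α) (f : α → ℝ) (n : ℕ) (x : α) : 0 ≤ lindley T f n x := by
  cases n with
  | zero => exact le_rfl
  | succ n => exact le_max_left _ _

/-- Started from `T x`, the maximum runs over the same sums ending at the same iterate, without the
one that starts at `x` itself. -/
theorem lindley_comp_le (T : α → α) (f : α → ℝ) (n : ℕ) (x : α) :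
    lindley T f n (T x) ≤ lindley T f (n + 1) x := by
  induction n with
  | zero => exact le_max_left _ _
  | succ n ih =>
    have h : f (T^[n] (T x)) = f (T^[n + 1] x) := by rw [Function.iterate_succ_apply]
    change max 0 (lindley T f n (T x) + f (T^[n] (T x)))
      ≤ max 0 (lindley T f (n + 1) x + f (T^[n + 1] x))
    rw [h]
    gcongr

theorem sum_Ico_le_lindley (T : α → α) (f : α → ℝ) {i n : ℕ} (hin : i ≤ n) (x : α) :
    ∑ l ∈ Finset.Ico i n, f (T^[l] x) ≤ lindley T f n x := by
  induction n, hin using Nat.le_induction with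
  | base => simpa using lindley_nonneg T f i x
  | succ n hn ih =>
    rw [Finset.sum_Ico_succ_top hn]
    exact le_trans (by gcongr) (le_max_right _ _)

variable [MeasurableSpace α] {μ : Measure α} {T : α → α}

theorem integrable_lindley [IsFiniteMeasure μ] (hT : MeasurePreserving T μ μ) {f : α → ℝ}
    (hf : Integrable f μ) (n : ℕ) : Integrable (lindley T f n) μ := by
  induction n with
  | zero => exact integrable_const (0 : ℝ)
  | succ n ih =>
    exact (integrable_const (0 : ℝ)).sup (ih.add ((hT.iterate n).integrable_comp_of_integrable hf))

/-- Garsia's argument: by invariance the mean of the running maximum is nondecreasing in `n`, while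
its increment equals the last summand where the new maximum is positive and is nonpositive
elsewhere. -/
theorem integral_indicator_lindley_nonneg [IsFiniteMeasure μ] (hT : MeasurePreserving T μ μ)
    {f : α → ℝ} (hf : Integrable f μ) (n : ℕ) :
    0 ≤ ∫ x in {x | 0 < lindley T f (n + 1) x}, f (T^[n] x) ∂μ := by
  have hi := integrable_lindley hT hf
  have hS : NullMeasurableSet {x | 0 < lindley T f (n + 1) x} μ :=
    nullMeasurableSet_lt aemeasurable_const (hi (n + 1)).aemeasurable
  have hfn : Integrable (fun x => f (T^[n] x)) μ :=
    (hT.iterate n).integrable_comp_of_integrable hf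
  rw [← integral_indicator₀ hS]
  have h1 : ∫ x, lindley T f n x ∂μ ≤ ∫ x, lindley T f (n + 1) x ∂μ := by
    have : ∫ x, lindley T f n (T x) ∂μ = ∫ x, lindley T f n x ∂μ := by
      conv_rhs => rw [← hT.map_eq]
      rw [integral_map hT.aemeasurable]
      rw [hT.map_eq]
      exact (hi n).aestronglyMeasurable
    rw [← this]
    exact integral_mono (hT.integrable_comp_of_integrable (hi n)) (hi (n + 1))
      (lindley_comp_le T f n)
  have h2 : ∫ x, (lindley T f (n + 1) x - lindley T f n x) ∂μ
      ≤ ∫ x, Set.indicator {x | 0 < lindley T f (n + 1) x} (fun x => f (T^[n] x)) x ∂μ := by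
    refine integral_mono ((hi _).sub (hi _)) (hfn.indicator₀ hS) fun x => ?_
    by_cases hx : 0 < lindley T f (n + 1) x
    · rw [Set.indicator_of_mem (by exact hx)]
      have : lindley T f (n + 1) x = lindley T f n x + f (T^[n] x) := by
        have h0 : lindley T f (n + 1) x = max 0 (lindley T f n x + f (T^[n] x)) := rfl
        rw [h0] at hx ⊢
        exact max_eq_right (by
          by_contra hc
          rw [max_eq_left (not_le.1 hc).le] at hx
          exact lt_irrefl _ hx)
      simp only
      linarith
    · rw [Set.indicator_of_notMem (by exact hx)]
      have h0 := lindley_nonneg T f n x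
      simp only
      linarith
  rw [integral_sub (hi _) (hi _)] at h2
  linarith

/-- Maximal inequality for the backward averages of a nonnegative function. -/
theorem mul_measureReal_exists_lt_sum_Ico_le [IsProbabilityMeasure μ]
    (hT : MeasurePreserving T μ μ) {e : α → ℝ} (he : Integrable e μ) (he0 : ∀ x, 0 ≤ e x)
    {a : ℝ} (ha : 0 < a) (n : ℕ) :
    a * μ.real {x | ∃ i ≤ n, a * (n - i : ℝ) < ∑ l ∈ Finset.Ico i n, e (T^[l] x)}
      ≤ ∫ x, e x ∂μ := by
  cases n with
  | zero =>
    have : {x | ∃ i ≤ 0, a * (((0 : ℕ) : ℝ) - i) < ∑ l ∈ Finset.Ico i 0, e (T^[l] x)} = ∅ := by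
      ext x
      simp
    rw [this]
    simpa using integral_nonneg he0
  | succ n =>
    -- Subtracting the level `a` turns the event into positivity of the running maximum.
    set f : α → ℝ := fun x => e x - a with hf
    have hfi : Integrable f μ := he.sub (integrable_const a)
    set S := {x | 0 < lindley T f (n + 1) x} with hSdef
    have hS : NullMeasurableSet S μ :=
      nullMeasurableSet_lt aemeasurable_const (integrable_lindley hT hfi (n + 1)).aemeasurable
    have hsub : {x | ∃ i ≤ n + 1, a * (((n + 1 : ℕ) : ℝ) - i)
        < ∑ l ∈ Finset.Ico i (n + 1), e (T^[l] x)} ⊆ S := by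
      rintro x ⟨i, hi, hlt⟩
      refine lt_of_lt_of_le ?_ (sum_Ico_le_lindley T f hi x)
      simp only [hf, Finset.sum_sub_distrib, Finset.sum_const, Nat.card_Ico, nsmul_eq_mul]
      rw [Nat.cast_sub hi]
      linarith
    have h0 := integral_indicator_lindley_nonneg hT hfi n
    have hen : Integrable (fun x => e (T^[n] x)) μ :=
      (hT.iterate n).integrable_comp_of_integrable he
    have h1 : ∫ x in S, f (T^[n] x) ∂μ = ∫ x in S, e (T^[n] x) ∂μ - a * μ.real S := by
      simp only [hf]
      rw [integral_sub hen.integrableOn (integrable_const a)]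
      simp [mul_comm]
    have h2 : ∫ x in S, e (T^[n] x) ∂μ ≤ ∫ x, e (T^[n] x) ∂μ :=
      setIntegral_le_integral hen (Eventually.of_forall fun x => he0 _)
    have h3 : ∫ x, e (T^[n] x) ∂μ = ∫ x, e x ∂μ := by
      conv_rhs => rw [← (hT.iterate n).map_eq]
      rw [integral_map (hT.iterate n).aemeasurable]
      rw [(hT.iterate n).map_eq]
      exact he.aestronglyMeasurable
    have h4 : a * μ.real {x | ∃ i ≤ n + 1, a * (((n + 1 : ℕ) : ℝ) - i)
        < ∑ l ∈ Finset.Ico i (n + 1), e (T^[l] x)} ≤ a * μ.real S :=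
      mul_le_mul_of_nonneg_left (measureReal_mono hsub) ha.le
    linarith

/-- Mean ergodic theorem in `L¹` for square integrable functions. -/
theorem exists_integral_abs_average_sub_le [IsProbabilityMeasure μ] (hT : Ergodic T μ)
    {f : α → ℝ} (hf : MemLp f 2 μ) {ε : ℝ} (hε : 0 < ε) :
    ∃ n : ℕ, 0 < n ∧
      ∫ x, |(n : ℝ)⁻¹ * ∑ i ∈ Finset.range n, f (T^[i] x) - ∫ x, f x ∂μ| ∂μ ≤ ε := by
  have hTm := hT.toMeasurePreserving
  set K : Lp ℝ 2 μ →ₗᵢ[ℝ] Lp ℝ 2 μ := Lp.compMeasurePreservingₗᵢ ℝ T hTm with hK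
  set F : Lp ℝ 2 μ := hf.toLp f with hF
  have hnorm : ‖K.toContinuousLinearMap‖ ≤ 1 := K.norm_toContinuousLinearMap_le
  have hlim := K.toContinuousLinearMap.tendsto_birkhoffAverage_orthogonalProjection hnorm F
  set p : Lp ℝ 2 μ := ((K.toContinuousLinearMap.eqLocus
    (1 : Lp ℝ 2 μ →L[ℝ] Lp ℝ 2 μ)).orthogonalProjectionOnto F : Lp ℝ 2 μ) with hp
  have hpK : K p = p :=
    ((K.toContinuousLinearMap.eqLocus
      (1 : Lp ℝ 2 μ →L[ℝ] Lp ℝ 2 μ)).orthogonalProjectionOnto F).2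
  -- The limit in von Neumann's theorem is fixed by the Koopman isometry, hence constant by
  -- ergodicity.
  obtain ⟨c, hc⟩ : ∃ c, (p : α → ℝ) =ᵐ[μ] Function.const α c := by
    refine hT.ae_eq_const_of_ae_eq_comp_ae (Lp.aestronglyMeasurable p) ?_
    have h1 := Lp.coeFn_compMeasurePreserving p hTm
    have h2 : (Lp.compMeasurePreserving T hTm p) = p := hpK
    rw [h2] at h1
    exact h1.symm
  have hiter : ∀ i : ℕ, (K.toContinuousLinearMap)^[i] F
      = (hf.comp_measurePreserving (hTm.iterate i)).toLp (f ∘ T^[i]) := by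
    intro i
    have h1 : (⇑(K.toContinuousLinearMap))^[i] F = (Lp.compMeasurePreserving T hTm)^[i] F := rfl
    rw [h1, Lp.compMeasurePreserving_iterate]
    rfl
  have havg : ∀ n : ℕ, (birkhoffAverage ℝ K.toContinuousLinearMap _root_.id n F : Lp ℝ 2 μ)
      =ᵐ[μ] fun x => (n : ℝ)⁻¹ * ∑ i ∈ Finset.range n, f (T^[i] x) := by
    intro n
    have hs : birkhoffAverage ℝ K.toContinuousLinearMap _root_.id n F
        = (n : ℝ)⁻¹ • ∑ i ∈ Finset.range n,
          (hf.comp_measurePreserving (hTm.iterate i)).toLp (f ∘ T^[i]) := by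
      simp only [birkhoffAverage, birkhoffSum, _root_.id]
      congr 1
      exact Finset.sum_congr rfl fun i _ => hiter i
    rw [hs]
    have h2 : ∀ᵐ x ∂μ, ∀ i ∈ Finset.range n,
        ((hf.comp_measurePreserving (hTm.iterate i)).toLp (f ∘ T^[i]) : α → ℝ) x = f (T^[i] x) := by
      rw [Filter.eventually_all_finset]
      intro i _
      exact (hf.comp_measurePreserving (hTm.iterate i)).coeFn_toLp
    filter_upwards [Lp.coeFn_smul ((n : ℝ)⁻¹) (∑ i ∈ Finset.range n,
      (hf.comp_measurePreserving (hTm.iterate i)).toLp (f ∘ T^[i])),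
      Lp.coeFn_finsetSum (Finset.range n)
        (fun i => (hf.comp_measurePreserving (hTm.iterate i)).toLp (f ∘ T^[i])), h2]
      with x hx1 hx2 hx3
    rw [hx1, Pi.smul_apply, hx2, smul_eq_mul]
    congr 1
    rw [Finset.sum_apply, Finset.sum_congr rfl hx3]
  have hfi : Integrable f μ := hf.integrable (by norm_num)
  have hL1 : ∀ n : ℕ, ∫ x, |(n : ℝ)⁻¹ * ∑ i ∈ Finset.range n, f (T^[i] x) - c| ∂μ
      ≤ ‖birkhoffAverage ℝ K.toContinuousLinearMap _root_.id n F - p‖ := by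
    intro n
    set G := birkhoffAverage ℝ K.toContinuousLinearMap _root_.id n F - p with hG
    have h1 : (G : α → ℝ) =ᵐ[μ]
        fun x => (n : ℝ)⁻¹ * ∑ i ∈ Finset.range n, f (T^[i] x) - c := by
      filter_upwards [Lp.coeFn_sub (birkhoffAverage ℝ K.toContinuousLinearMap _root_.id n F) p,
        havg n, hc] with x h1 h2 h3
      rw [h1, Pi.sub_apply, h2, h3]
      rfl
    have h2 : ∫ x, |(n : ℝ)⁻¹ * ∑ i ∈ Finset.range n, f (T^[i] x) - c| ∂μ
        = ∫ x, ‖G x‖ ∂μ :=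
      integral_congr_ae (by filter_upwards [h1] with x hx; rw [hx, Real.norm_eq_abs])
    rw [h2, integral_norm_eq_lintegral_enorm (Lp.aestronglyMeasurable G), Lp.norm_def]
    refine ENNReal.toReal_mono (Lp.eLpNorm_ne_top G) ?_
    rw [← eLpNorm_one_eq_lintegral_enorm]
    exact eLpNorm_le_eLpNorm_of_exponent_le (by norm_num) (Lp.aestronglyMeasurable G)
  have hinteg : ∀ n : ℕ, Integrable (fun x => (n : ℝ)⁻¹ * ∑ i ∈ Finset.range n, f (T^[i] x)) μ :=
    fun n => (integrable_finsetSum _ fun i _ =>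
      (hTm.iterate i).integrable_comp_of_integrable hfi).const_mul _
  have hmean : ∀ n : ℕ, 0 < n →
      ∫ x, (n : ℝ)⁻¹ * ∑ i ∈ Finset.range n, f (T^[i] x) ∂μ = ∫ x, f x ∂μ := by
    intro n hn
    have hfi' : ∀ i ∈ Finset.range n, Integrable (fun x => f (T^[i] x)) μ := fun i _ =>
      (hTm.iterate i).integrable_comp_of_integrable hfi
    rw [integral_const_mul, integral_finsetSum _ hfi']
    have : ∀ i ∈ Finset.range n, ∫ x, f (T^[i] x) ∂μ = ∫ x, f x ∂μ := by
      intro i _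
      conv_rhs => rw [← (hTm.iterate i).map_eq]
      rw [integral_map (hTm.iterate i).aemeasurable]
      rw [(hTm.iterate i).map_eq]
      exact hfi.aestronglyMeasurable
    rw [Finset.sum_congr rfl this]
    simp only [Finset.sum_const, Finset.card_range, nsmul_eq_mul]
    field_simp
  have hev : ∀ᶠ n : ℕ in atTop,
      ‖birkhoffAverage ℝ K.toContinuousLinearMap _root_.id n F - p‖ < ε / 2 := by
    have := (tendsto_iff_norm_sub_tendsto_zero.1 hlim)
    exact this.eventually (gt_mem_nhds (half_pos hε))
  obtain ⟨n, hn, hn0⟩ := (hev.and (eventually_gt_atTop 0)).exists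
  refine ⟨n, hn0, ?_⟩
  have hA : ∫ x, |(n : ℝ)⁻¹ * ∑ i ∈ Finset.range n, f (T^[i] x) - c| ∂μ ≤ ε / 2 :=
    (hL1 n).trans hn.le
  -- The constant need not be identified exactly: the averages have mean `∫ f` and are `ε / 2`-close
  -- to `c` in `L¹`.
  have hB : |c - ∫ x, f x ∂μ| ≤ ε / 2 := by
    rw [← hmean n hn0, abs_sub_comm]
    have h1 : ∫ x, (n : ℝ)⁻¹ * ∑ i ∈ Finset.range n, f (T^[i] x) ∂μ - c
        = ∫ x, ((n : ℝ)⁻¹ * ∑ i ∈ Finset.range n, f (T^[i] x) - c) ∂μ := by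
      rw [integral_sub (hinteg n) (integrable_const c)]
      simp
    rw [h1]
    exact (abs_integral_le_integral_abs).trans hA
  calc ∫ x, |(n : ℝ)⁻¹ * ∑ i ∈ Finset.range n, f (T^[i] x) - ∫ x, f x ∂μ| ∂μ
      ≤ ∫ x, (|(n : ℝ)⁻¹ * ∑ i ∈ Finset.range n, f (T^[i] x) - c| + ε / 2) ∂μ := by
        refine integral_mono ((hinteg n).sub (integrable_const _)).abs
          (((hinteg n).sub (integrable_const _)).abs.add (integrable_const _)) fun x => ?_
        refine le_trans ?_ (add_le_add le_rfl hB)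
        exact abs_sub_le _ _ _
    _ ≤ ε := by
        have hi : Integrable
            (fun x => |(n : ℝ)⁻¹ * ∑ i ∈ Finset.range n, f (T^[i] x) - c|) μ :=
          ((hinteg n).sub (integrable_const _)).abs
        rw [integral_add hi (integrable_const _)]
        simp only [integral_const, probReal_univ, one_smul]
        linarith

/-- Every integrable function is, up to its mean and a small error in `L¹`, the coboundary of
a bounded function. -/
theorem exists_coboundary_approx [IsProbabilityMeasure μ] (hT : Ergodic T μ) {f : α → ℝ}
    (hf : Integrable f μ) {ε : ℝ} (hε : 0 < ε) :
    ∃ (g : α → ℝ) (B : ℝ), (∀ x, |g x| ≤ B) ∧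
      Integrable (fun x => f x - ∫ x, f x ∂μ - (g x - g (T x))) μ ∧
      ∫ x, |f x - ∫ x, f x ∂μ - (g x - g (T x))| ∂μ ≤ ε := by
  have hTm := hT.toMeasurePreserving
  obtain ⟨s, hs, hs1⟩ := (memLp_one_iff_integrable.2 hf).exists_simpleFunc_eLpNorm_sub_lt
    (by norm_num) (ε := ENNReal.ofReal (ε / 3)) (by simpa using hε)
  have hsi : Integrable (s : α → ℝ) μ := memLp_one_iff_integrable.1 hs1
  obtain ⟨B, hB⟩ := s.exists_forall_norm_le
  have hs2 : MemLp (s : α → ℝ) 2 μ := MemLp.of_bound s.measurable.aestronglyMeasurable B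
    (Eventually.of_forall hB)
  obtain ⟨n, hn, hn2⟩ := exists_integral_abs_average_sub_le hT hs2 (ε := ε / 3) (by linarith)
  have hfs : ∫ x, |f x - s x| ∂μ ≤ ε / 3 := by
    have h1 := integral_norm_eq_lintegral_enorm (hf.sub hsi).aestronglyMeasurable
    rw [← eLpNorm_one_eq_lintegral_enorm] at h1
    calc ∫ x, |f x - s x| ∂μ = (eLpNorm (f - ⇑s) 1 μ).toReal := h1
      _ ≤ ε / 3 := ENNReal.toReal_le_of_le_ofReal (by linarith) hs.le
  -- Averaging the partial sums of `s` over their length makes `g - g ∘ T` telescope to `s` minus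
  -- its average over `n` steps, and `g` is bounded because `s` is simple.
  set g : α → ℝ := fun x =>
    (n : ℝ)⁻¹ * ∑ j ∈ Finset.range n, ∑ i ∈ Finset.range j, s (T^[i] x) with hg
  have hn' : (n : ℝ) ≠ 0 := by exact_mod_cast hn.ne'
  have hcob : ∀ x, g x - g (T x)
      = s x - (n : ℝ)⁻¹ * ∑ i ∈ Finset.range n, s (T^[i] x) := by
    intro x
    simp only [hg]
    rw [← mul_sub, ← Finset.sum_sub_distrib]
    have : ∀ j ∈ Finset.range n, (∑ i ∈ Finset.range j, s (T^[i] x)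
        - ∑ i ∈ Finset.range j, s (T^[i] (T x))) = s x - s (T^[j] x) := by
      intro j _
      rw [← Finset.sum_sub_distrib]
      have h := Finset.sum_range_sub' (fun i => s (T^[i] x)) j
      simpa [Function.iterate_succ_apply] using h
    rw [Finset.sum_congr rfl this, Finset.sum_sub_distrib]
    simp only [Finset.sum_const, Finset.card_range, nsmul_eq_mul]
    field_simp
  have hB0 : ∀ x, |s x| ≤ |B| := fun x => (hB x).trans (le_abs_self B)
  have hbd : ∀ x, |g x| ≤ (n : ℝ)⁻¹ * ∑ j ∈ Finset.range n, ∑ i ∈ Finset.range j, |B| := by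
    intro x
    simp only [hg]
    rw [abs_mul, abs_of_nonneg (by positivity : (0 : ℝ) ≤ (n : ℝ)⁻¹)]
    gcongr
    refine (Finset.abs_sum_le_sum_abs _ _).trans (Finset.sum_le_sum fun j _ => ?_)
    exact (Finset.abs_sum_le_sum_abs _ _).trans (Finset.sum_le_sum fun i _ => hB0 _)
  have hinteg : Integrable (fun x => (n : ℝ)⁻¹ * ∑ i ∈ Finset.range n, s (T^[i] x)) μ :=
    (integrable_finsetSum _ fun i _ =>
      (hTm.iterate i).integrable_comp_of_integrable hsi).const_mul _
  have heq : (fun x => f x - ∫ x, f x ∂μ - (g x - g (T x))) = fun x => (f x - s x)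
      + ((n : ℝ)⁻¹ * ∑ i ∈ Finset.range n, s (T^[i] x) - ∫ x, s x ∂μ)
      + (∫ x, s x ∂μ - ∫ x, f x ∂μ) := by
    funext x
    rw [hcob x]
    ring
  have hconst : |∫ x, s x ∂μ - ∫ x, f x ∂μ| ≤ ε / 3 := by
    rw [abs_sub_comm, ← integral_sub hf hsi]
    exact abs_integral_le_integral_abs.trans hfs
  refine ⟨g, _, hbd, ?_, ?_⟩
  · rw [heq]
    exact ((hf.sub hsi).add (hinteg.sub (integrable_const _))).add (integrable_const _)
  · have heq' : (fun x => |f x - ∫ x, f x ∂μ - (g x - g (T x))|) = fun x => |(f x - s x)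
        + ((n : ℝ)⁻¹ * ∑ i ∈ Finset.range n, s (T^[i] x) - ∫ x, s x ∂μ)
        + (∫ x, s x ∂μ - ∫ x, f x ∂μ)| := by
      funext x
      rw [← congrFun heq x]
    rw [heq']
    have i1 : Integrable (fun x => |f x - s x|) μ := (hf.sub hsi).abs
    have i2 : Integrable
        (fun x => |(n : ℝ)⁻¹ * ∑ i ∈ Finset.range n, s (T^[i] x) - ∫ x, s x ∂μ|) μ :=
      (hinteg.sub (integrable_const (∫ x, s x ∂μ))).abs
    have i3 : Integrable (fun x => |f x - s x|
        + |(n : ℝ)⁻¹ * ∑ i ∈ Finset.range n, s (T^[i] x) - ∫ x, s x ∂μ|) μ := i1.add i2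
    calc _ ≤ ∫ x, (|f x - s x|
          + |(n : ℝ)⁻¹ * ∑ i ∈ Finset.range n, s (T^[i] x) - ∫ x, s x ∂μ| + ε / 3) ∂μ := by
          refine integral_mono
            (((hf.sub hsi).add (hinteg.sub (integrable_const _))).add (integrable_const _)).abs
            ((i1.add i2).add (integrable_const _)) fun x => ?_
          exact (abs_add_three _ _ _).trans (add_le_add le_rfl hconst)
      _ ≤ ε := by
          rw [integral_add i3 (integrable_const _), integral_add i1 i2]
          simp only [integral_const, probReal_univ, one_smul]
          linarith

/-- Backward sums of an integrable function along an ergodic map are close to their mean,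
with a probability that is uniform in the end point. -/
theorem exists_measure_backward_sum_le [IsProbabilityMeasure μ] (hT : Ergodic T μ) {f : α → ℝ}
    (hf : Integrable f μ) {ε δ : ℝ} (hε : 0 < ε) (hδ : 0 < δ) :
    ∃ A : ℝ, 0 ≤ A ∧ ∀ n : ℕ, μ {x | ¬ ∀ i ≤ n,
      |∑ l ∈ Finset.Ico i n, f (T^[l] x) - (n - i : ℝ) * ∫ x, f x ∂μ| ≤ A + δ * (n - i : ℝ)}
      ≤ ENNReal.ofReal ε := by
  have hTm := hT.toMeasurePreserving
  -- An `L¹` error of size `δ * ε` turns the maximal inequality at level `δ` into probability `ε`.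
  -- The coboundary contributes at most `2 * |B|`, whatever the end points.
  obtain ⟨g, B, hgB, hei, he⟩ := exists_coboundary_approx hT hf (mul_pos hδ hε)
  set e : α → ℝ := fun x => f x - ∫ x, f x ∂μ - (g x - g (T x)) with hedef
  refine ⟨2 * |B|, by positivity, fun n => ?_⟩
  have hmax := mul_measureReal_exists_lt_sum_Ico_le hTm hei.abs (fun x => abs_nonneg (e x)) hδ n
  have hle : μ.real {x | ∃ i ≤ n, δ * (n - i : ℝ) < ∑ l ∈ Finset.Ico i n, |e (T^[l] x)|} ≤ ε := by
    have := hmax.trans he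
    exact le_of_mul_le_mul_left this hδ
  refine (measure_mono ?_).trans
    ((ENNReal.le_ofReal_iff_toReal_le (measure_ne_top _ _) hε.le).2 hle)
  intro x hx
  by_contra hcon
  apply hx
  intro i hi
  have h1 : ∑ l ∈ Finset.Ico i n, |e (T^[l] x)| ≤ δ * (n - i : ℝ) := by
    by_contra hc
    exact hcon ⟨i, hi, not_le.1 hc⟩
  have h2 : ∑ l ∈ Finset.Ico i n, f (T^[l] x) - (n - i : ℝ) * ∫ x, f x ∂μ
      = (∑ l ∈ Finset.Ico i n, e (T^[l] x)) + (g (T^[i] x) - g (T^[n] x)) := by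
    have h3 : ∀ l ∈ Finset.Ico i n, e (T^[l] x)
        = f (T^[l] x) - ∫ x, f x ∂μ - (g (T^[l] x) - g (T^[l + 1] x)) := by
      intro l _
      simp only [hedef, Function.iterate_succ_apply']
    have h4 := Finset.sum_Ico_sub (fun l => g (T^[l] x)) hi
    rw [Finset.sum_congr rfl h3]
    simp only [Finset.sum_sub_distrib, Finset.sum_const, Nat.card_Ico, nsmul_eq_mul] at h4 ⊢
    rw [Nat.cast_sub hi]
    linarith
  rw [h2]
  have h5 : |∑ l ∈ Finset.Ico i n, e (T^[l] x)| ≤ δ * (n - i : ℝ) :=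
    (Finset.abs_sum_le_sum_abs _ _).trans h1
  have h6 : |g (T^[i] x) - g (T^[n] x)| ≤ 2 * |B| := by
    have ha := (hgB (T^[i] x)).trans (le_abs_self B)
    have hb := (hgB (T^[n] x)).trans (le_abs_self B)
    exact (abs_sub _ _).trans (by linarith)
  exact (abs_add_le _ _).trans (by linarith)

end Ergodic

/-! ### Exponentials with values in `[0, ∞]` -/

/-- The exponential as an extended nonnegative real. -/
noncomputable def ex (t : ℝ) : ℝ≥0∞ := ENNReal.ofReal (Real.exp t)

theorem ex_add (s t : ℝ) : ex (s + t) = ex s * ex t := by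
  rw [ex, Real.exp_add, ENNReal.ofReal_mul (Real.exp_pos s).le, ex, ex]

theorem ex_zero : ex 0 = 1 := by simp [ex]

theorem ex_ne_zero (t : ℝ) : ex t ≠ 0 := by
  simpa [ex] using Real.exp_pos t

theorem ex_pos (t : ℝ) : 0 < ex t := pos_iff_ne_zero.2 (ex_ne_zero t)

theorem ex_ne_top (t : ℝ) : ex t ≠ ∞ := ENNReal.ofReal_ne_top

theorem ex_mono {s t : ℝ} (h : s ≤ t) : ex s ≤ ex t :=
  ENNReal.ofReal_le_ofReal (Real.exp_le_exp.2 h)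

theorem ex_le_one {t : ℝ} (h : t ≤ 0) : ex t ≤ 1 := ex_zero ▸ ex_mono h

theorem ex_mul_le_iff {t : ℝ} {x y : ℝ≥0∞} : ex t * x ≤ y ↔ x ≤ ex (-t) * y := by
  have h1 : ex (-t) * ex t = 1 := by rw [← ex_add]; simp [ex_zero]
  have h2 : ex t * ex (-t) = 1 := by rw [← ex_add]; simp [ex_zero]
  constructor
  · intro h
    calc x = ex (-t) * (ex t * x) := by rw [← mul_assoc, h1, one_mul]
      _ ≤ ex (-t) * y := by gcongr
  · intro h
    calc ex t * x ≤ ex t * (ex (-t) * y) := by gcongr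
      _ = y := by rw [← mul_assoc, h2, one_mul]

theorem ex_log_two : ex (Real.log 2) = 2 := by
  rw [ex, Real.exp_log (by norm_num)]
  simp

theorem natCast_le_ex (m : ℕ) : (m : ℝ≥0∞) ≤ ex m := by
  rw [ex, ← ENNReal.ofReal_natCast]
  exact ENNReal.ofReal_le_ofReal (by linarith [Real.add_one_le_exp (m : ℝ)])

/-! ### One-step estimates for weighted masses -/

section Steps

variable {X : Type*}

/-- The weight equal to `1` on `C` and to `exp (-ℓ)` off `C`. -/
noncomputable def wt (C : Set X) (ℓ : ℝ) (x : X) : ℝ≥0∞ :=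
  open Classical in if x ∈ C then 1 else ex (-ℓ)

theorem wt_mem {C : Set X} {ℓ : ℝ} {x : X} (hx : x ∈ C) : wt C ℓ x = 1 := if_pos hx

theorem wt_notMem {C : Set X} {ℓ : ℝ} {x : X} (hx : x ∉ C) : wt C ℓ x = ex (-ℓ) := if_neg hx

theorem wt_le_one {C : Set X} {ℓ : ℝ} (hℓ : 0 ≤ ℓ) (x : X) : wt C ℓ x ≤ 1 := by
  by_cases hx : x ∈ C
  · rw [wt_mem hx]
  · rw [wt_notMem hx]
    exact ex_le_one (by linarith)

theorem ex_le_wt {C : Set X} {ℓ : ℝ} (hℓ : 0 ≤ ℓ) (x : X) : ex (-ℓ) ≤ wt C ℓ x := by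
  by_cases hx : x ∈ C
  · rw [wt_mem hx]
    exact ex_le_one (by linarith)
  · rw [wt_notMem hx]

variable [MeasurableSpace X]

theorem lintegral_eq_add_compl {C : Set X} (hC : MeasurableSet C) (ν : Measure X) (f : X → ℝ≥0∞) :
    ∫⁻ x, f x ∂ν = ∫⁻ x in C, f x ∂ν + ∫⁻ x in Cᶜ, f x ∂ν :=
  (lintegral_add_compl f hC).symm

theorem measurable_wt {C : Set X} (hC : MeasurableSet C) (ℓ : ℝ) : Measurable (wt C ℓ) :=
  Measurable.ite hC measurable_const measurable_const

theorem lintegral_wt {C : Set X} (hC : MeasurableSet C) (ℓ : ℝ) (ν : Measure X) :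
    ∫⁻ x, wt C ℓ x ∂ν = ν C + ex (-ℓ) * ν Cᶜ := by
  rw [lintegral_eq_add_compl hC]
  congr 1
  · rw [setLIntegral_congr_fun hC fun x hx => wt_mem hx]
    simp
  · rw [setLIntegral_congr_fun hC.compl fun x hx => wt_notMem hx]
    simp

theorem measure_univ_le_lintegral_wt {C : Set X} {ℓ : ℝ} (hℓ : 0 ≤ ℓ) (ν : Measure X) :
    ν Set.univ ≤ ex ℓ * ∫⁻ x, wt C ℓ x ∂ν := by
  have h : ex (-ℓ) * ν Set.univ ≤ ∫⁻ x, wt C ℓ x ∂ν := by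
    calc ex (-ℓ) * ν Set.univ = ∫⁻ _, ex (-ℓ) ∂ν := by simp
      _ ≤ _ := lintegral_mono fun x => ex_le_wt hℓ x
  simpa using ex_mul_le_iff.1 h

theorem lintegral_wt_le {C : Set X} {ℓ : ℝ} (hℓ : 0 ≤ ℓ) (ν : Measure X) :
    ∫⁻ x, wt C ℓ x ∂ν ≤ ν Set.univ := by
  calc ∫⁻ x, wt C ℓ x ∂ν ≤ ∫⁻ _, 1 ∂ν := lintegral_mono fun x => wt_le_one hℓ x
    _ = ν Set.univ := by simp

/-- Two-sided comparison on `C` of the kernel `κ` with the rank-one kernel `κ(·, C) ⊗ lam`. -/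
structure IsLocalDoeblin (κ : Kernel X X) (C : Set X) (c : ℝ≥0∞) (lam : Measure X) : Prop where
  prob : IsProbabilityMeasure lam
  lower : ∀ x ∈ C, (c * κ x C) • lam ≤ (κ x).restrict C
  upper : ∀ x ∈ C, c • (κ x).restrict C ≤ (κ x C) • lam

theorem IsLocalDoeblin.lintegral_lower {κ : Kernel X X} {C : Set X} {c : ℝ≥0∞} {lam : Measure X}
    (h : IsLocalDoeblin κ C c lam) {x : X} (hx : x ∈ C) (f : X → ℝ≥0∞) :
    c * κ x C * ∫⁻ u, f u ∂lam ≤ ∫⁻ u in C, f u ∂(κ x) := by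
  calc c * κ x C * ∫⁻ u, f u ∂lam = ∫⁻ u, f u ∂((c * κ x C) • lam) := by
        rw [lintegral_smul_measure, smul_eq_mul]
    _ ≤ _ := lintegral_mono' (h.lower x hx) le_rfl

theorem IsLocalDoeblin.lintegral_upper {κ : Kernel X X} {C : Set X} {c : ℝ≥0∞} {lam : Measure X}
    (h : IsLocalDoeblin κ C c lam) {x : X} (hx : x ∈ C) (f : X → ℝ≥0∞) :
    c * ∫⁻ u in C, f u ∂(κ x) ≤ κ x C * ∫⁻ u, f u ∂lam := by
  calc c * ∫⁻ u in C, f u ∂(κ x) = ∫⁻ u, f u ∂(c • (κ x).restrict C) := by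
        rw [lintegral_smul_measure, smul_eq_mul]
    _ ≤ ∫⁻ u, f u ∂((κ x C) • lam) := lintegral_mono' (h.upper x hx) le_rfl
    _ = _ := by rw [lintegral_smul_measure, smul_eq_mul]

theorem lintegral_bind_kernel (ν : Measure X) (κ : Kernel X X) {f : X → ℝ≥0∞} (hf : Measurable f) :
    ∫⁻ x, f x ∂(ν.bind κ) = ∫⁻ x, ∫⁻ u, f u ∂(κ x) ∂ν :=
  Measure.lintegral_bind κ.aemeasurable hf.aemeasurable

theorem bind_kernel_apply (ν : Measure X) (κ : Kernel X X) {A : Set X} (hA : MeasurableSet A) :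
    ν.bind κ A = ∫⁻ x, κ x A ∂ν :=
  Measure.bind_apply hA κ.aemeasurable

theorem bind_univ_le {ν : Measure X} {κ : Kernel X X} {v : ℝ} (hκ : ∀ x, κ x Set.univ ≤ ex v) :
    ν.bind κ Set.univ ≤ ex v * ν Set.univ := by
  rw [bind_kernel_apply ν κ MeasurableSet.univ]
  calc ∫⁻ x, κ x Set.univ ∂ν ≤ ∫⁻ _, ex v ∂ν := lintegral_mono hκ
    _ = _ := by simp

/-- One step of the weighted mass, without any information off `C`. -/
theorem lintegral_wt_bind_le {C : Set X} {ℓ : ℝ} (hℓ : 0 ≤ ℓ) {ν : Measure X}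
    {κ : Kernel X X} {v : ℝ} (hκ : ∀ x, κ x Set.univ ≤ ex v) :
    ∫⁻ x, wt C ℓ x ∂(ν.bind κ) ≤ ex (v + ℓ) * ∫⁻ x, wt C ℓ x ∂ν := by
  refine (lintegral_wt_le hℓ _).trans ((bind_univ_le hκ).trans ?_)
  rw [ex_add, mul_assoc]
  gcongr
  exact measure_univ_le_lintegral_wt hℓ ν

/-- One step of the weighted mass when the kernel is small off `C`: up to the mass that stays
in `C`, the weighted mass is multiplied by a small factor. -/
theorem lintegral_wt_bind_le_add {C : Set X} (hC : MeasurableSet C) {ℓ : ℝ} (hℓ : 0 ≤ ℓ)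
    {ν : Measure X} {κ : Kernel X X} {v : ℝ} (hκ : ∀ x, κ x Set.univ ≤ ex v)
    (hout : ∀ x ∉ C, κ x Set.univ ≤ ex (v - 2 * ℓ)) :
    ∫⁻ x, wt C ℓ x ∂(ν.bind κ)
      ≤ ∫⁻ x in C, κ x C ∂ν + ex (v - ℓ) * ∫⁻ x, wt C ℓ x ∂ν := by
  rw [lintegral_bind_kernel ν κ (measurable_wt hC ℓ), lintegral_eq_add_compl hC,
    lintegral_eq_add_compl hC (f := wt C ℓ), mul_add, ← add_assoc]
  gcongr ?_ + ?_
  -- Mass going from `C` to `C` is kept apart, and mass leaving `C` gains `exp (-ℓ)` on arrival. In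
  -- the second bullet, mass starting off `C` gains `exp (-2 ℓ)`, half of which pays for the weight
  -- already present at the start.
  · have h1 : ∀ x, ∫⁻ u, wt C ℓ u ∂(κ x) ≤ κ x C + ex (v - ℓ) := by
      intro x
      rw [lintegral_wt hC]
      gcongr
      calc ex (-ℓ) * κ x Cᶜ ≤ ex (-ℓ) * ex v := by
            gcongr
            exact (measure_mono (Set.subset_univ _)).trans (hκ x)
        _ = ex (v - ℓ) := by rw [← ex_add]; congr 1; ring
    calc ∫⁻ x in C, ∫⁻ u, wt C ℓ u ∂(κ x) ∂ν ≤ ∫⁻ x in C, (κ x C + ex (v - ℓ)) ∂ν :=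
          lintegral_mono h1
      _ = ∫⁻ x in C, κ x C ∂ν + ex (v - ℓ) * ∫⁻ x in C, wt C ℓ x ∂ν := by
          rw [lintegral_add_right _ measurable_const,
            setLIntegral_congr_fun hC fun x hx => wt_mem (ℓ := ℓ) hx]
          simp
  · rw [← lintegral_const_mul _ (measurable_wt hC ℓ)]
    refine setLIntegral_mono ((measurable_wt hC ℓ).const_mul _) fun x hx => ?_
    rw [wt_notMem hx, ← ex_add]
    refine (lintegral_wt_le hℓ _).trans ((hout x hx).trans (ex_mono (by linarith)))

/-- Backward step without any information off `C`. -/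
theorem lintegral_le_of_le_wt {C : Set X} {ℓ : ℝ} (hℓ : 0 ≤ ℓ) {κ : Kernel X X} {v : ℝ}
    (hκ : ∀ x, κ x Set.univ ≤ ex v) {f : X → ℝ≥0∞} {G : ℝ≥0∞} (hf : ∀ x, f x ≤ G * wt C ℓ x)
    (x : X) : ∫⁻ u, f u ∂(κ x) ≤ ex (v + ℓ) * G * wt C ℓ x := by
  calc ∫⁻ u, f u ∂(κ x) ≤ ∫⁻ _, G ∂(κ x) :=
        lintegral_mono fun u => (hf u).trans (mul_le_of_le_one_right' (wt_le_one hℓ u))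
    _ = G * κ x Set.univ := by simp
    _ ≤ G * ex v := by gcongr; exact hκ x
    _ = ex (v + ℓ) * G * ex (-ℓ) := by
        rw [mul_right_comm, ← ex_add, mul_comm G]
        congr 2
        ring
    _ ≤ _ := by gcongr; exact ex_le_wt hℓ x

/-- Of the gain `exp (-2 ℓ)` off `C`, one factor rebuilds the weight at `x` and the other is left as
contraction. -/
theorem lintegral_le_of_le_wt_of_notMem {C : Set X} {ℓ : ℝ} (hℓ : 0 ≤ ℓ) {κ : Kernel X X} {v : ℝ}
    (hout : ∀ x ∉ C, κ x Set.univ ≤ ex (v - 2 * ℓ)) {f : X → ℝ≥0∞} {G : ℝ≥0∞}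
    (hf : ∀ x, f x ≤ G * wt C ℓ x) {x : X} (hx : x ∉ C) :
    ∫⁻ u, f u ∂(κ x) ≤ ex (v - ℓ) * G * wt C ℓ x := by
  calc ∫⁻ u, f u ∂(κ x) ≤ ∫⁻ _, G ∂(κ x) :=
        lintegral_mono fun u => (hf u).trans (mul_le_of_le_one_right' (wt_le_one hℓ u))
    _ = G * κ x Set.univ := by simp
    _ ≤ G * ex (v - 2 * ℓ) := by gcongr; exact hout x hx
    _ = ex (v - ℓ) * G * wt C ℓ x := by
        rw [wt_notMem hx, mul_right_comm, ← ex_add, mul_comm G]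
        congr 2
        ring

/-- From a point of `C` the contraction comes from the weight of the arrival point. -/
theorem setLIntegral_compl_le_of_le_wt {C : Set X} {ℓ : ℝ}
    {κ : Kernel X X} {v : ℝ} (hκ : ∀ x, κ x Set.univ ≤ ex v)
    {f : X → ℝ≥0∞} {G : ℝ≥0∞} (hf : ∀ x, f x ≤ G * wt C ℓ x) {x : X} (hx : x ∈ C) :
    ∫⁻ u in Cᶜ, f u ∂(κ x) ≤ ex (v - ℓ) * G * wt C ℓ x := by
  calc ∫⁻ u in Cᶜ, f u ∂(κ x) ≤ ∫⁻ _ in Cᶜ, G * ex (-ℓ) ∂(κ x) :=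
        setLIntegral_mono measurable_const fun u hu => by
          have := hf u
          rwa [wt_notMem hu] at this
    _ = G * ex (-ℓ) * κ x Cᶜ := by simp
    _ ≤ G * ex (-ℓ) * ex v := by
        gcongr
        exact (measure_mono (Set.subset_univ _)).trans (hκ x)
    _ = ex (v - ℓ) * G * wt C ℓ x := by
        rw [wt_mem hx, mul_assoc, ← ex_add, mul_comm G, mul_one]
        congr 2
        ring

end Steps

/-! ### Chains of blocks, and paths that cross `C` -/

section Chain

variable {X : Type*} [MeasurableSpace X]

/-- A composable family of kernels with growth bounds: `Λ k (k + 1)` has mass at most `exp (v k)`,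
keeps a mass `exp (-b k)` in `D`, and, at the indices selected by `S`, is small off `C` and
satisfies a local Doeblin condition on `C`. -/
structure BlockChain (Λ : ℕ → ℕ → Kernel X X) (C D : Set X) (v b : ℕ → ℝ) (ℓ a : ℝ)
    (S : ℕ → Prop) : Prop where
  measurableSet_C : MeasurableSet C
  measurableSet_D : MeasurableSet D
  id_eq : ∀ k, Λ k k = Kernel.id
  comp_eq : ∀ {i j k}, i ≤ j → j ≤ k → Λ i k = Λ j k ∘ₖ Λ i j
  ℓ_nonneg : 0 ≤ ℓ
  v_nonneg : ∀ k, 0 ≤ v k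
  b_nonneg : ∀ k, 0 ≤ b k
  upper : ∀ k x, Λ k (k + 1) x Set.univ ≤ ex (v k)
  lower : ∀ k, ∀ x ∈ D, ex (-b k) ≤ Λ k (k + 1) x D
  out : ∀ k, S k → ∀ x ∉ C, Λ k (k + 1) x Set.univ ≤ ex (v k - 2 * ℓ)
  doeblin : ∀ k, S k → ∃ lam, IsLocalDoeblin (Λ k (k + 1)) C (ex (-a)) lam

namespace BlockChain

variable {Λ : ℕ → ℕ → Kernel X X} {C D : Set X} {v b : ℕ → ℝ} {ℓ a : ℝ} {S : ℕ → Prop}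

theorem lintegral_comp (H : BlockChain Λ C D v b ℓ a S) {i j k : ℕ} (hij : i ≤ j) (hjk : j ≤ k)
    (x : X) {f : X → ℝ≥0∞} (hf : Measurable f) :
    ∫⁻ u, f u ∂(Λ i k x) = ∫⁻ w, ∫⁻ u, f u ∂(Λ j k w) ∂(Λ i j x) := by
  rw [H.comp_eq hij hjk, Kernel.lintegral_comp _ _ _ hf]

theorem apply_comp (H : BlockChain Λ C D v b ℓ a S) {i j k : ℕ} (hij : i ≤ j) (hjk : j ≤ k)
    (x : X) {A : Set X} (hA : MeasurableSet A) :
    Λ i k x A = ∫⁻ w, Λ j k w A ∂(Λ i j x) := by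
  rw [H.comp_eq hij hjk, Kernel.comp_apply' _ _ _ hA]

theorem lintegral_self (H : BlockChain Λ C D v b ℓ a S) (k : ℕ) (x : X) {f : X → ℝ≥0∞}
    (hf : Measurable f) : ∫⁻ u, f u ∂(Λ k k x) = f x := by
  rw [H.id_eq, Kernel.id_apply, lintegral_dirac' _ hf]

theorem univ_le (H : BlockChain Λ C D v b ℓ a S) {i k : ℕ} (hik : i ≤ k) (x : X) :
    Λ i k x Set.univ ≤ ex (∑ l ∈ Finset.Ico i k, v l) := by
  induction k, hik using Nat.le_induction with
  | base => simp [H.id_eq, ex_zero]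
  | succ k hk ih =>
    rw [H.apply_comp hk (Nat.le_succ k) x MeasurableSet.univ, Finset.sum_Ico_succ_top hk, ex_add]
    calc ∫⁻ w, Λ k (k + 1) w Set.univ ∂(Λ i k x) ≤ ∫⁻ _, ex (v k) ∂(Λ i k x) :=
          lintegral_mono fun w => H.upper k w
      _ = ex (v k) * Λ i k x Set.univ := by simp
      _ ≤ ex (v k) * ex (∑ l ∈ Finset.Ico i k, v l) := by gcongr
      _ = _ := mul_comm _ _

theorem apply_D_ge (H : BlockChain Λ C D v b ℓ a S) {i k : ℕ} (hik : i ≤ k) {x : X} (hx : x ∈ D) :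
    ex (-∑ l ∈ Finset.Ico i k, b l) ≤ Λ i k x D := by
  induction k, hik using Nat.le_induction with
  | base =>
    rw [H.id_eq, Kernel.id_apply, Measure.dirac_apply' _ H.measurableSet_D]
    simp [ex_zero, hx]
  | succ k hk ih =>
    rw [H.apply_comp hk (Nat.le_succ k) x H.measurableSet_D, Finset.sum_Ico_succ_top hk, neg_add,
      ex_add]
    calc ex (-∑ l ∈ Finset.Ico i k, b l) * ex (-b k) ≤ ex (-b k) * Λ i k x D := by
          rw [mul_comm]
          gcongr
      _ = ∫⁻ _ in D, ex (-b k) ∂(Λ i k x) := by simp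
      _ ≤ ∫⁻ w in D, Λ k (k + 1) w D ∂(Λ i k x) :=
          setLIntegral_mono ((Λ k (k + 1)).measurable_coe H.measurableSet_D) (H.lower k)
      _ ≤ _ := setLIntegral_le_lintegral _ _

/-- The sign of the drift of the weighted masses. -/
noncomputable def drift (S : ℕ → Prop) (ℓ : ℝ) (k : ℕ) : ℝ :=
  open Classical in if S k then -ℓ else ℓ

theorem drift_pos {k : ℕ} (h : S k) : drift S ℓ k = -ℓ := if_pos h

theorem drift_neg {k : ℕ} (h : ¬ S k) : drift S ℓ k = ℓ := if_neg h

/-- Mass of the paths from `x` at time `i` to `D` at time `n` that are in `C` at the times `l`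
and `l + 1`, when `l` is selected by `S`. -/
noncomputable def through (Λ : ℕ → ℕ → Kernel X X) (C D : Set X) (S : ℕ → Prop) (n i l : ℕ)
    (x : X) : ℝ≥0∞ :=
  open Classical in
  if S l then ∫⁻ w in C, ∫⁻ u in C, Λ (l + 1) n u D ∂(Λ l (l + 1) w) ∂(Λ i l x) else 0

theorem measurable_setLIntegral {κ : Kernel X X} {C : Set X} (hC : MeasurableSet C)
    {f : X → ℝ≥0∞} (hf : Measurable f) : Measurable fun x => ∫⁻ u in C, f u ∂(κ x) := by
  simp_rw [← lintegral_indicator hC]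
  exact (hf.indicator hC).lintegral_kernel

theorem measurable_through (H : BlockChain Λ C D v b ℓ a S) (n i l : ℕ) :
    Measurable (through Λ C D S n i l) := by
  unfold through
  by_cases h : S l
  · simp only [h, if_true]
    exact measurable_setLIntegral H.measurableSet_C
      (measurable_setLIntegral H.measurableSet_C ((Λ _ _).measurable_coe H.measurableSet_D))
  · simp only [h, if_false]
    exact measurable_const

theorem lintegral_through (H : BlockChain Λ C D v b ℓ a S) {n i l : ℕ} (hil : i + 1 ≤ l) (x : X) :
    ∫⁻ u, through Λ C D S n (i + 1) l u ∂(Λ i (i + 1) x) = through Λ C D S n i l x := by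
  unfold through
  by_cases h : S l
  · simp only [h, if_true]
    have hm : Measurable fun w => ∫⁻ u in C, Λ (l + 1) n u D ∂(Λ l (l + 1) w) :=
      measurable_setLIntegral H.measurableSet_C ((Λ _ _).measurable_coe H.measurableSet_D)
    simp_rw [← lintegral_indicator H.measurableSet_C (fun w =>
      ∫⁻ u in C, Λ (l + 1) n u D ∂(Λ l (l + 1) w))]
    rw [H.lintegral_comp (Nat.le_succ i) hil x (hm.indicator H.measurableSet_C)]
  · simp [h]

/-- A path that is never in `C` at both ends of a selected block is off `C` at one end of each of
them, so it gains `exp (-ℓ)` there and loses at most `exp ℓ` at the other blocks. All other paths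
are covered by a union bound over the block of such a stay. The weight at `x` carries the count
through the backward induction. -/
theorem apply_D_le_add_through (H : BlockChain Λ C D v b ℓ a S) {i n : ℕ} (hin : i ≤ n) (x : X) :
    Λ i n x D ≤ ex (∑ l ∈ Finset.Ico i n, (v l + drift S ℓ l) + ℓ) * wt C ℓ x
      + ∑ l ∈ Finset.Ico i n, through Λ C D S n i l x := by
  induction hin using Nat.decreasingInduction generalizing x with
  | self =>
    simp only [Finset.Ico_self, Finset.sum_empty, zero_add, add_zero]
    calc Λ n n x D ≤ 1 := by
          rw [H.id_eq, Kernel.id_apply]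
          exact prob_le_one
      _ = ex ℓ * ex (-ℓ) := by rw [← ex_add]; simp [ex_zero]
      _ ≤ _ := by gcongr; exact ex_le_wt H.ℓ_nonneg x
  | of_succ i hi ih =>
    have hC := H.measurableSet_C
    set G := ex (∑ l ∈ Finset.Ico (i + 1) n, (v l + drift S ℓ l) + ℓ) with hG
    set r : X → ℝ≥0∞ := fun u => ∑ l ∈ Finset.Ico (i + 1) n, through Λ C D S n (i + 1) l u with hr
    have hrm : Measurable r :=
      Finset.measurable_fun_sum _ fun l _ => H.measurable_through n (i + 1) l
    have hrint : ∫⁻ u, r u ∂(Λ i (i + 1) x)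
        = ∑ l ∈ Finset.Ico (i + 1) n, through Λ C D S n i l x := by
      simp only [hr]
      rw [lintegral_finsetSum _ fun l _ => H.measurable_through n (i + 1) l]
      exact Finset.sum_congr rfl fun l hl => H.lintegral_through (Finset.mem_Ico.1 hl).1 x
    have hD : Measurable fun u => Λ (i + 1) n u D := (Λ _ _).measurable_coe H.measurableSet_D
    have hwtm : Measurable fun u => G * wt C ℓ u := (measurable_wt hC ℓ).const_mul _
    rw [H.apply_comp (Nat.le_succ i) hi x H.measurableSet_D,
      Finset.sum_eq_sum_Ico_succ_bot hi (fun l => through Λ C D S n i l x), ← hrint,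
      Finset.sum_eq_sum_Ico_succ_bot hi (fun l => v l + drift S ℓ l)]
    by_cases hS : S i
    · rw [drift_pos hS]
      have hex : ex (v i + -ℓ + ∑ l ∈ Finset.Ico (i + 1) n, (v l + drift S ℓ l) + ℓ)
          = ex (v i - ℓ) * G := by
        rw [hG, ← ex_add]; congr 1; ring
      rw [hex]
      by_cases hx : x ∈ C
      · rw [lintegral_eq_add_compl hC]
        have hself : through Λ C D S n i i x = ∫⁻ u in C, Λ (i + 1) n u D ∂(Λ i (i + 1) x) := by
          unfold through
          rw [if_pos hS, ← lintegral_indicator hC,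
            H.lintegral_self i x ((measurable_setLIntegral hC hD).indicator hC),
            Set.indicator_of_mem hx]
        rw [hself, add_left_comm]
        gcongr
        calc ∫⁻ u in Cᶜ, Λ (i + 1) n u D ∂(Λ i (i + 1) x)
            ≤ ∫⁻ u in Cᶜ, (G * wt C ℓ u + r u) ∂(Λ i (i + 1) x) := lintegral_mono fun u => ih u
          _ = ∫⁻ u in Cᶜ, G * wt C ℓ u ∂(Λ i (i + 1) x) + ∫⁻ u in Cᶜ, r u ∂(Λ i (i + 1) x) :=
              lintegral_add_left hwtm _
          _ ≤ ex (v i - ℓ) * G * wt C ℓ x + ∫⁻ u, r u ∂(Λ i (i + 1) x) := by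
              gcongr
              · exact setLIntegral_compl_le_of_le_wt (H.upper i) (fun _ => le_rfl) hx
              · exact Measure.restrict_le_self
      · calc ∫⁻ u, Λ (i + 1) n u D ∂(Λ i (i + 1) x)
            ≤ ∫⁻ u, (G * wt C ℓ u + r u) ∂(Λ i (i + 1) x) := lintegral_mono fun u => ih u
          _ = ∫⁻ u, G * wt C ℓ u ∂(Λ i (i + 1) x) + ∫⁻ u, r u ∂(Λ i (i + 1) x) :=
              lintegral_add_left hwtm _
          _ ≤ ex (v i - ℓ) * G * wt C ℓ x + ∫⁻ u, r u ∂(Λ i (i + 1) x) := by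
              gcongr
              exact lintegral_le_of_le_wt_of_notMem H.ℓ_nonneg (H.out i hS) (fun _ => le_rfl) hx
          _ ≤ _ := by gcongr; exact le_add_self
    · rw [drift_neg hS]
      have hex : ex (v i + ℓ + ∑ l ∈ Finset.Ico (i + 1) n, (v l + drift S ℓ l) + ℓ)
          = ex (v i + ℓ) * G := by
        rw [hG, ← ex_add]; congr 1; ring
      rw [hex]
      calc ∫⁻ u, Λ (i + 1) n u D ∂(Λ i (i + 1) x)
          ≤ ∫⁻ u, (G * wt C ℓ u + r u) ∂(Λ i (i + 1) x) := lintegral_mono fun u => ih u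
        _ = ∫⁻ u, G * wt C ℓ u ∂(Λ i (i + 1) x) + ∫⁻ u, r u ∂(Λ i (i + 1) x) :=
            lintegral_add_left hwtm _
        _ ≤ ex (v i + ℓ) * G * wt C ℓ x + ∫⁻ u, r u ∂(Λ i (i + 1) x) := by
            gcongr
            exact lintegral_le_of_le_wt H.ℓ_nonneg (H.upper i) (fun _ => le_rfl) x
        _ ≤ _ := by gcongr; exact le_add_self

/-- On a window where the drift is negative, the paths from `D` to `D` go through `C`. -/
theorem ex_le_sum_through (H : BlockChain Λ C D v b ℓ a S) {i n : ℕ} (hin : i ≤ n)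
    (hw : ∑ l ∈ Finset.Ico i n, (v l + b l + drift S ℓ l) + ℓ + Real.log 2 ≤ 0) {x : X}
    (hx : x ∈ D) :
    ex (-∑ l ∈ Finset.Ico i n, b l - Real.log 2) ≤ ∑ l ∈ Finset.Ico i n, through Λ C D S n i l x := by
  have h1 := (H.apply_D_ge hin hx).trans (H.apply_D_le_add_through hin x)
  set B := ∑ l ∈ Finset.Ico i n, b l with hB
  have h2 : ex (∑ l ∈ Finset.Ico i n, (v l + drift S ℓ l) + ℓ) * wt C ℓ x
      ≤ ex (-B - Real.log 2) := by
    refine (mul_le_of_le_one_right' (wt_le_one H.ℓ_nonneg x)).trans (ex_mono ?_)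
    simp only [Finset.sum_add_distrib] at hw ⊢
    linarith
  -- The window condition makes the avoiding part at most half of the lower bound for `D`, so the
  -- crossing paths carry the other half.
  have h3 : ex (-B) = ex (-B - Real.log 2) + ex (-B - Real.log 2) := by
    rw [← mul_two, ← ex_log_two, ← ex_add]
    congr 1
    ring
  rw [h3] at h1
  have h4 := h1.trans (add_le_add h2 le_rfl)
  exact (ENNReal.add_le_add_iff_left (ex_ne_top _)).1 h4

end BlockChain

end Chain

/-- One step of a geometric series: a contraction by `exp (-c)` leaves the fraction `1 - exp (-c)`
of the bound free. The recursions below use it to absorb a renewal term at every good index without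
changing their constant. -/
theorem ex_add_ex_le {c s t : ℝ} (hc : 0 < c) (h : s - Real.log (1 - Real.exp (-c)) ≤ t) :
    ex s + ex (t - c) ≤ ex t := by
  have h1 : Real.exp (-c) < 1 := by simpa using hc
  have h2 : Real.exp s ≤ Real.exp t * (1 - Real.exp (-c)) := by
    rw [← Real.exp_log (sub_pos.2 h1), ← Real.exp_add]
    exact Real.exp_le_exp.2 (by linarith)
  rw [ex, ex, ex, ← ENNReal.ofReal_add (Real.exp_pos _).le (Real.exp_pos _).le]
  refine ENNReal.ofReal_le_ofReal ?_
  rw [sub_eq_add_neg t, Real.exp_add]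
  linarith

/-! ### Good indices: mass staying in `C` against mass in `D` -/

namespace BlockChain

variable {X : Type*} [MeasurableSpace X]

/-- The index `k` is good: `k` is selected by `S`, `D` is reached from `C` in `j` steps, and the
window of length `m` before `k` has a negative drift and reaches `C` at the times `k`, `k + 1`. -/
structure GoodAt (Λ : ℕ → ℕ → Kernel X X) (C D : Set X) (v b : ℕ → ℝ) (ℓ : ℝ) (S : ℕ → Prop)
    (x₀ : X) (j m : ℕ) (A : ℝ) (k : ℕ) : Prop where
  sel : S k
  late : m + j ≤ k
  reach : ex (-A) ≤ ∫⁻ u in C, Λ (k + 1) (k + 1 + j) u D ∂(Λ k (k + 1) x₀)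
  stay : ∀ l ∈ Finset.Ico (k - m) k,
    ex (-A) ≤ ∫⁻ u in C, ∫⁻ w in C, Λ k (k + 1) w C ∂(Λ (l + 1) k u) ∂(Λ l (l + 1) x₀)
  window : ∑ l ∈ Finset.Ico (k - m) k, (v l + b l + drift S ℓ l) + ℓ + Real.log 2 ≤ 0
  v_le : ∑ l ∈ Finset.Ico (k - (m + j)) (k + j + 1), v l ≤ A
  b_le : ∑ l ∈ Finset.Ico (k - m) k, b l ≤ A

variable {Λ : ℕ → ℕ → Kernel X X} {C D : Set X} {v b : ℕ → ℝ} {ℓ a : ℝ} {S : ℕ → Prop}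
  {x₀ : X} {j m k : ℕ} {A : ℝ}

theorem GoodAt.sum_v_le (H : BlockChain Λ C D v b ℓ a S) (h : GoodAt Λ C D v b ℓ S x₀ j m A k)
    {p q : ℕ} (hp : k - (m + j) ≤ p) (hq : q ≤ k + j + 1) : ∑ l ∈ Finset.Ico p q, v l ≤ A :=
  (Finset.sum_le_sum_of_subset_of_nonneg (Finset.Ico_subset_Ico hp hq)
    fun l _ _ => H.v_nonneg l).trans h.v_le

theorem GoodAt.v_apply_le (H : BlockChain Λ C D v b ℓ a S)
    (h : GoodAt Λ C D v b ℓ S x₀ j m A k) {l : ℕ} (hp : k - (m + j) ≤ l) (hq : l ≤ k) :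
    v l ≤ A := by
  have := h.sum_v_le H hp (q := l + 1) (by omega)
  simpa using this

/-- A lower bound for the minorizing measure from a lower bound at the point `x₀`. -/
theorem ex_le_lintegral_lam (H : BlockChain Λ C D v b ℓ a S) (hx₀ : x₀ ∈ C) {l : ℕ}
    {lam : Measure X} (hl : IsLocalDoeblin (Λ l (l + 1)) C (ex (-a)) lam) {f : X → ℝ≥0∞} {A : ℝ}
    (hf : ex (-A) ≤ ∫⁻ u in C, f u ∂(Λ l (l + 1) x₀)) (hv : v l ≤ A) :
    ex (-(a + 2 * A)) ≤ ∫⁻ u, f u ∂lam := by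
  have h1 : ex (-a) * ex (-A) ≤ ex A * ∫⁻ u, f u ∂lam :=
    calc ex (-a) * ex (-A) ≤ ex (-a) * ∫⁻ u in C, f u ∂(Λ l (l + 1) x₀) := by gcongr
      _ ≤ Λ l (l + 1) x₀ C * ∫⁻ u, f u ∂lam := hl.lintegral_upper hx₀ f
      _ ≤ ex A * ∫⁻ u, f u ∂lam := by
          gcongr
          exact (measure_mono (Set.subset_univ _)).trans ((H.upper l x₀).trans (ex_mono hv))
  have h2 := mul_le_mul_right h1 (ex (-A))
  rw [← mul_assoc, ← ex_add, ← ex_add, ← mul_assoc, ← ex_add] at h2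
  calc ex (-(a + 2 * A)) = ex (-A + (-a + -A)) := by congr 1; ring
    _ = ex (-A + -a + -A) := by congr 1; ring
    _ ≤ _ := by
        simpa [ex_zero, add_assoc] using h2

/-- By the window condition, paths from `D` cross `C` at some selected block `l` before `k`. There
the Doeblin lower bound restarts them from the minorizing measure, whose mass staying in `C` at `k`
and `k + 1` is bounded below by testing at `x₀`. The number of possible `l` is bounded by `exp m`.
-/
theorem GoodAt.ex_le_setLIntegral (H : BlockChain Λ C D v b ℓ a S) (hx₀ : x₀ ∈ C)
    (h : GoodAt Λ C D v b ℓ S x₀ j m A k) {x : X} (hx : x ∈ D) :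
    ex (-(4 * A + 2 * a + Real.log 2 + m))
      ≤ ∫⁻ w in C, Λ k (k + 1) w C ∂(Λ (k - m) k x) := by
  have hC := H.measurableSet_C
  have hκ : Measurable fun w => Λ k (k + 1) w C := (Λ _ _).measurable_coe hC
  set φ : X → ℝ≥0∞ := C.indicator fun w => Λ k (k + 1) w C with hφ
  have hφm : Measurable φ := hκ.indicator hC
  set τ := ∫⁻ w in C, Λ k (k + 1) w C ∂(Λ (k - m) k x) with hτ
  have hτφ : τ = ∫⁻ w, φ w ∂(Λ (k - m) k x) := (lintegral_indicator hC _).symm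
  have key : ∀ l ∈ Finset.Ico (k - m) k,
      through Λ C D S k (k - m) l x ≤ ex (2 * a + 3 * A) * τ := by
    intro l hl
    obtain ⟨hl1, hl2⟩ := Finset.mem_Ico.1 hl
    unfold through
    split_ifs with hS
    swap
    · exact zero_le
    obtain ⟨lam, hlam⟩ := H.doeblin l hS
    set r : X → ℝ≥0∞ := fun u => ∫⁻ w, φ w ∂(Λ (l + 1) k u) with hr
    have hrm : Measurable r := hφm.lintegral_kernel
    have hlr : ex (-(a + 2 * A)) ≤ ∫⁻ u, r u ∂lam := by
      refine H.ex_le_lintegral_lam hx₀ hlam ?_ (h.v_apply_le H (by omega) (by omega))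
      have := h.stay l hl
      simp_rw [← lintegral_indicator hC (fun w => Λ k (k + 1) w C)] at this
      exact this
    set I := ∫⁻ w in C, Λ l (l + 1) w C ∂(Λ (k - m) l x) with hI
    have h1 : ∫⁻ w in C, ∫⁻ u in C, Λ (l + 1) k u D ∂(Λ l (l + 1) w) ∂(Λ (k - m) l x)
        ≤ ex A * I := by
      rw [hI, ← lintegral_const_mul _ ((Λ _ _).measurable_coe hC)]
      refine lintegral_mono fun w => ?_
      calc ∫⁻ u in C, Λ (l + 1) k u D ∂(Λ l (l + 1) w)
          ≤ ∫⁻ _ in C, ex A ∂(Λ l (l + 1) w) := lintegral_mono fun u =>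
            (measure_mono (Set.subset_univ _)).trans ((H.univ_le (by omega) u).trans
              (ex_mono (h.sum_v_le H (by omega) (by omega))))
        _ = ex A * Λ l (l + 1) w C := by simp
    have h2 : ex (-a) * ex (-(a + 2 * A)) * I ≤ τ := by
      rw [hτφ, H.lintegral_comp hl1 hl2.le x hφm, hI,
        ← lintegral_const_mul _ ((Λ _ _).measurable_coe hC)]
      refine le_trans ?_ (setLIntegral_le_lintegral C _)
      refine setLIntegral_mono hφm.lintegral_kernel fun w hw => ?_
      rw [H.lintegral_comp (Nat.le_succ l) hl2 w hφm]
      calc ex (-a) * ex (-(a + 2 * A)) * Λ l (l + 1) w C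
          = ex (-a) * Λ l (l + 1) w C * ex (-(a + 2 * A)) := mul_right_comm _ _ _
        _ ≤ ex (-a) * Λ l (l + 1) w C * ∫⁻ u, r u ∂lam := by gcongr
        _ ≤ ∫⁻ u in C, r u ∂(Λ l (l + 1) w) := hlam.lintegral_lower hw r
        _ ≤ _ := setLIntegral_le_lintegral _ _
    rw [← ex_add] at h2
    refine h1.trans ?_
    rw [ex_mul_le_iff] at h2
    calc ex A * I ≤ ex A * (ex (-(-a + -(a + 2 * A))) * τ) := by gcongr
      _ = ex (2 * a + 3 * A) * τ := by
          rw [← mul_assoc, ← ex_add]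
          congr 2
          ring
  have hsum := (H.ex_le_sum_through (Nat.sub_le k m) h.window hx).trans (Finset.sum_le_sum key)
  rw [Finset.sum_const, Nat.card_Ico, nsmul_eq_mul] at hsum
  have hm : ((k - (k - m) : ℕ) : ℝ≥0∞) ≤ ex m := by
    refine le_trans ?_ (natCast_le_ex m)
    exact_mod_cast (by omega : k - (k - m) ≤ m)
  have h3 : ex (-A - Real.log 2) ≤ ex (m + (2 * a + 3 * A)) * τ := by
    rw [ex_add, mul_assoc]
    refine (ex_mono ?_).trans (hsum.trans (mul_le_mul_left hm _))
    have := h.b_le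
    linarith
  have h4 := mul_le_mul_right h3 (ex (-(m + (2 * a + 3 * A))))
  rw [← ex_add, ← mul_assoc, ← ex_add, neg_add_cancel, ex_zero, one_mul] at h4
  refine le_trans (ex_mono ?_) h4
  linarith

/-- The mass that stays in `C` between the times `k` and `k + 1`. -/
noncomputable def stayMass (Λ : ℕ → ℕ → Kernel X X) (C : Set X) (μ : ℕ → Measure X) (k : ℕ) :
    ℝ≥0∞ := ∫⁻ x in C, Λ k (k + 1) x C ∂(μ k)

/-- The sequence of measures `μ` is transported by the kernels `Λ`. -/
def IsFlow (Λ : ℕ → ℕ → Kernel X X) (μ : ℕ → Measure X) : Prop :=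
  ∀ i k : ℕ, i ≤ k → μ k = (μ i).bind (Λ i k)

variable {μ : ℕ → Measure X}

theorem IsFlow.lintegral_eq (hμ : IsFlow Λ μ) {i k : ℕ} (hik : i ≤ k) {f : X → ℝ≥0∞}
    (hf : Measurable f) : ∫⁻ x, f x ∂(μ k) = ∫⁻ x, ∫⁻ u, f u ∂(Λ i k x) ∂(μ i) := by
  rw [hμ i k hik, lintegral_bind_kernel _ _ hf]

theorem IsFlow.apply_eq (hμ : IsFlow Λ μ) {i k : ℕ} (hik : i ≤ k) {B : Set X}
    (hB : MeasurableSet B) : μ k B = ∫⁻ x, Λ i k x B ∂(μ i) := by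
  rw [hμ i k hik, bind_kernel_apply _ _ hB]

theorem flow_univ_le (H : BlockChain Λ C D v b ℓ a S) (hμ : IsFlow Λ μ) {i k : ℕ} (hik : i ≤ k) :
    μ k Set.univ ≤ ex (∑ l ∈ Finset.Ico i k, v l) * μ i Set.univ := by
  rw [hμ i k hik]
  exact bind_univ_le fun x => H.univ_le hik x

theorem flow_D_ge (H : BlockChain Λ C D v b ℓ a S) (hμ : IsFlow Λ μ) {i k : ℕ} (hik : i ≤ k) :
    μ i D ≤ ex (∑ l ∈ Finset.Ico i k, b l) * μ k D := by
  have h : ex (-∑ l ∈ Finset.Ico i k, b l) * μ i D ≤ μ k D := by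
    rw [hμ.apply_eq hik H.measurableSet_D]
    calc ex (-∑ l ∈ Finset.Ico i k, b l) * μ i D
        = ∫⁻ _ in D, ex (-∑ l ∈ Finset.Ico i k, b l) ∂(μ i) := by simp
      _ ≤ ∫⁻ x in D, Λ i k x D ∂(μ i) :=
          setLIntegral_mono ((Λ _ _).measurable_coe H.measurableSet_D)
            fun x hx => H.apply_D_ge hik hx
      _ ≤ _ := setLIntegral_le_lintegral _ _
  simpa using ex_mul_le_iff.1 h

/-- Keeping only the mass that stays in `C`, the Doeblin lower bound gives a renewal inequality:
after the step the flow dominates a multiple of `lam`. -/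
theorem stayMass_mul_le (H : BlockChain Λ C D v b ℓ a S) (hμ : IsFlow Λ μ) {lam : Measure X}
    (hlam : IsLocalDoeblin (Λ k (k + 1)) C (ex (-a)) lam) {f : X → ℝ≥0∞} (hf : Measurable f) :
    ex (-a) * stayMass Λ C μ k * ∫⁻ u, f u ∂lam ≤ ∫⁻ x, f x ∂(μ (k + 1)) := by
  rw [hμ.lintegral_eq (Nat.le_succ k) hf, stayMass, mul_right_comm,
    ← lintegral_const_mul _ ((Λ _ _).measurable_coe H.measurableSet_C)]
  refine le_trans ?_ (setLIntegral_le_lintegral C _)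
  refine setLIntegral_mono hf.lintegral_kernel fun x hx => ?_
  calc ex (-a) * (∫⁻ u, f u ∂lam) * Λ k (k + 1) x C
      = ex (-a) * Λ k (k + 1) x C * ∫⁻ u, f u ∂lam := mul_right_comm _ _ _
    _ ≤ ∫⁻ u in C, f u ∂(Λ k (k + 1) x) := hlam.lintegral_lower hx f
    _ ≤ _ := setLIntegral_le_lintegral _ _

/-- The minorizing measure reaches `D` in `j` blocks, by `reach` tested at `x₀`; the renewed mass
therefore feeds `D`. -/
theorem GoodAt.stayMass_le (H : BlockChain Λ C D v b ℓ a S) (hμ : IsFlow Λ μ) (hx₀ : x₀ ∈ C)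
    (h : GoodAt Λ C D v b ℓ S x₀ j m A k) :
    stayMass Λ C μ k ≤ ex (2 * a + 2 * A) * μ (k + 1 + j) D := by
  obtain ⟨lam, hlam⟩ := H.doeblin k h.sel
  have hD := H.measurableSet_D
  have h1 := H.ex_le_lintegral_lam hx₀ hlam h.reach (h.v_apply_le H (by omega) le_rfl)
  have h2 := H.stayMass_mul_le hμ hlam (f := fun u => Λ (k + 1) (k + 1 + j) u D)
    ((Λ _ _).measurable_coe hD)
  rw [← hμ.apply_eq (Nat.le_add_right _ _) hD] at h2
  have h3 : ex (-(2 * a + 2 * A)) * stayMass Λ C μ k ≤ μ (k + 1 + j) D := by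
    refine le_trans ?_ h2
    calc ex (-(2 * a + 2 * A)) * stayMass Λ C μ k
        = ex (-a) * stayMass Λ C μ k * ex (-(a + 2 * A)) := by
          rw [mul_right_comm, ← ex_add]
          congr 2
          ring
      _ ≤ _ := by gcongr
  simpa using ex_mul_le_iff.1 h3

/-- Together with `GoodAt.stayMass_le`, this sandwiches the mass staying in `C` between masses of
`D` at nearby times. -/
theorem GoodAt.le_stayMass (H : BlockChain Λ C D v b ℓ a S) (hμ : IsFlow Λ μ) (hx₀ : x₀ ∈ C)
    (h : GoodAt Λ C D v b ℓ S x₀ j m A k) :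
    μ (k - m) D ≤ ex (4 * A + 2 * a + Real.log 2 + m) * stayMass Λ C μ k := by
  have hC := H.measurableSet_C
  have hκ : Measurable fun w => Λ k (k + 1) w C := (Λ _ _).measurable_coe hC
  have h1 : ex (-(4 * A + 2 * a + Real.log 2 + m)) * μ (k - m) D ≤ stayMass Λ C μ k := by
    rw [stayMass, ← lintegral_indicator hC, hμ.lintegral_eq (Nat.sub_le k m) (hκ.indicator hC)]
    calc ex (-(4 * A + 2 * a + Real.log 2 + m)) * μ (k - m) D
        = ∫⁻ _ in D, ex (-(4 * A + 2 * a + Real.log 2 + m)) ∂(μ (k - m)) := by simp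
      _ ≤ ∫⁻ x in D, ∫⁻ w, C.indicator (fun w => Λ k (k + 1) w C) w ∂(Λ (k - m) k x)
            ∂(μ (k - m)) := by
          refine setLIntegral_mono (hκ.indicator hC).lintegral_kernel fun x hx => ?_
          rw [lintegral_indicator hC]
          exact h.ex_le_setLIntegral H hx₀ hx
      _ ≤ _ := setLIntegral_le_lintegral _ _
  simpa using ex_mul_le_iff.1 h1

end BlockChain

/-! ### Control of the masses along the flow and seen from a point -/

namespace BlockChain

variable {X : Type*} [MeasurableSpace X]

/-- The logarithm of the factor that bounds one step of the weighted masses. -/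
noncomputable def slope (v b : ℕ → ℝ) (j : ℕ) (G : ℕ → Prop) (ℓ : ℝ) (k : ℕ) : ℝ :=
  2 * (v k + b (k + j)) + Real.log 2 + drift G ℓ k

/-- A block chain with a flow `μ`, observed up to the time `N`, for which the backward sums of
the slopes are close to a negative linear function. -/
structure Control (Λ : ℕ → ℕ → Kernel X X) (C D : Set X) (v b : ℕ → ℝ) (ℓ a : ℝ) (S : ℕ → Prop)
    (x₀ : X) (j m : ℕ) (A : ℝ) (μ : ℕ → Measure X) (N : ℕ) (c δ A₁ : ℝ) : Prop where
  chain : BlockChain Λ C D v b ℓ a S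
  mem : x₀ ∈ C
  flow : IsFlow Λ μ
  late : m + j ≤ N
  a_nonneg : 0 ≤ a
  A_nonneg : 0 ≤ A
  A₁_nonneg : 0 ≤ A₁
  δ_pos : 0 < δ
  δ_lt : δ < c
  initial : ∀ i ≤ m + j, μ i Set.univ ≤ ex A₁ * μ (i + j) D
  tail : ∑ l ∈ Finset.Ico N (N + j), v l ≤ A₁
  sums : ∀ k, m + j ≤ k → k ≤ N →
    |∑ l ∈ Finset.Ico k N, slope v b j (GoodAt Λ C D v b ℓ S x₀ j m A) ℓ l + c * (N - k : ℝ)|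
      ≤ A₁ + δ * (N - k : ℝ)

namespace Control

/-- Constant in the bound for the ratio of the total mass to the later mass of `D`. -/
noncomputable def massConst (a A c δ A₁ : ℝ) : ℝ :=
  2 * a + 2 * A + 2 * A₁ - Real.log (1 - Real.exp (-(c - δ)))

theorem neg_log_nonneg {t : ℝ} (ht : 0 < t) : 0 ≤ -Real.log (1 - Real.exp (-t)) := by
  have h1 : Real.exp (-t) < 1 := by simpa using ht
  have := Real.log_nonpos (sub_nonneg.2 h1.le) (by linarith [Real.exp_pos (-t)])
  linarith

variable {Λ : ℕ → ℕ → Kernel X X} {C D : Set X} {v b : ℕ → ℝ} {ℓ a : ℝ} {S : ℕ → Prop}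
  {x₀ : X} {j m : ℕ} {A : ℝ} {μ : ℕ → Measure X} {N : ℕ} {c δ A₁ : ℝ}

/-- The slope is sized for pairs of paths. A single path uses one copy of `v` and `b`, and what is
dropped is nonnegative. -/
theorem slope_good (H : Control Λ C D v b ℓ a S x₀ j m A μ N c δ A₁) {k : ℕ}
    (h : GoodAt Λ C D v b ℓ S x₀ j m A k) :
    v k + b (k + j) - ℓ ≤ slope v b j (GoodAt Λ C D v b ℓ S x₀ j m A) ℓ k := by
  rw [slope, drift_pos h]
  have := H.chain.v_nonneg k
  have := H.chain.b_nonneg (k + j)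
  have := Real.log_nonneg (show (1 : ℝ) ≤ 2 by norm_num)
  linarith

theorem slope_bad (H : Control Λ C D v b ℓ a S x₀ j m A μ N c δ A₁) {k : ℕ}
    (h : ¬ GoodAt Λ C D v b ℓ S x₀ j m A k) :
    v k + b (k + j) + ℓ ≤ slope v b j (GoodAt Λ C D v b ℓ S x₀ j m A) ℓ k := by
  rw [slope, drift_neg h]
  have := H.chain.v_nonneg k
  have := H.chain.b_nonneg (k + j)
  have := Real.log_nonneg (show (1 : ℝ) ≤ 2 by norm_num)
  linarith

theorem flow_D_step (H : Control Λ C D v b ℓ a S x₀ j m A μ N c δ A₁) (k : ℕ) :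
    μ (k + j) D ≤ ex (b (k + j)) * μ (k + 1 + j) D := by
  have h := H.chain.flow_D_ge H.flow (Nat.le_succ (k + j))
  rw [show k + 1 + j = k + j + 1 by ring]
  simpa using h

/-- The induction runs forward in `k`, but the bound is normalized at `N`, so that only sums ending
at `N` occur. The term `(c - δ) * (N - k)` gives each step a spare factor `exp (-(c - δ))`, while
`sums` keeps the exponent above a fixed level; a renewal at a good index is then absorbed by
`ex_add_ex_le`. -/
theorem lintegral_wt_flow_le (H : Control Λ C D v b ℓ a S x₀ j m A μ N c δ A₁) {k : ℕ}
    (hk : m + j ≤ k) (hkN : k ≤ N) :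
    ∫⁻ x, wt C ℓ x ∂(μ k) ≤ ex (massConst a A c δ A₁
      - ∑ l ∈ Finset.Ico k N, slope v b j (GoodAt Λ C D v b ℓ S x₀ j m A) ℓ l
      - (c - δ) * (N - k : ℝ)) * μ (k + j) D := by
  set W := slope v b j (GoodAt Λ C D v b ℓ S x₀ j m A) ℓ with hW
  have hcδ : 0 < c - δ := sub_pos.2 H.δ_lt
  have hlog := neg_log_nonneg hcδ
  have hℓ := H.chain.ℓ_nonneg
  have ha := H.a_nonneg
  have hA := H.A_nonneg
  have hA₁ := H.A₁_nonneg
  induction k, hk using Nat.le_induction with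
  | base =>
    refine (lintegral_wt_le hℓ _).trans ((H.initial _ le_rfl).trans ?_)
    gcongr
    refine ex_mono ?_
    have := (abs_le.1 (H.sums _ le_rfl H.late)).2
    rw [massConst]
    linarith
  | succ k hk ih =>
    specialize ih (by omega)
    have hsum : ∑ l ∈ Finset.Ico k N, W l = W k + ∑ l ∈ Finset.Ico (k + 1) N, W l :=
      Finset.sum_eq_sum_Ico_succ_bot (by omega) W
    set s' := ∑ l ∈ Finset.Ico (k + 1) N, W l with hs'
    have hbd := (abs_le.1 (H.sums (k + 1) (by omega) hkN)).2
    rw [← hW, ← hs'] at hbd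
    set t := massConst a A c δ A₁ - s' - (c - δ) * (N - (k + 1 : ℕ) : ℝ) with ht
    have hstep : ∀ w : ℝ, w + b (k + j) ≤ W k →
        ex w * ∫⁻ x, wt C ℓ x ∂(μ k) ≤ ex (t - (c - δ)) * μ (k + 1 + j) D := by
      intro w hw
      calc ex w * ∫⁻ x, wt C ℓ x ∂(μ k)
          ≤ ex w * (ex (massConst a A c δ A₁ - ∑ l ∈ Finset.Ico k N, W l
            - (c - δ) * (N - k : ℝ)) * (ex (b (k + j)) * μ (k + 1 + j) D)) := by
            gcongr
            exact ih.trans (by gcongr; exact H.flow_D_step k)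
        _ = ex (w + (massConst a A c δ A₁ - ∑ l ∈ Finset.Ico k N, W l
            - (c - δ) * (N - k : ℝ)) + b (k + j)) * μ (k + 1 + j) D := by
            rw [ex_add, ex_add]
            ring
        _ ≤ _ := by
            gcongr
            refine ex_mono ?_
            rw [hsum, ht]
            push_cast
            linarith
    have hflow : μ (k + 1) = (μ k).bind (Λ k (k + 1)) := H.flow k (k + 1) (Nat.le_succ k)
    by_cases hG : GoodAt Λ C D v b ℓ S x₀ j m A k
    · have h1 := lintegral_wt_bind_le_add H.chain.measurableSet_C hℓ (ν := μ k) (H.chain.upper k)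
        (H.chain.out k hG.sel)
      rw [← hflow] at h1
      refine h1.trans ?_
      calc _ ≤ ex (2 * a + 2 * A) * μ (k + 1 + j) D + ex (t - (c - δ)) * μ (k + 1 + j) D := by
            refine add_le_add (hG.stayMass_le H.chain H.flow H.mem) (hstep _ ?_)
            have := H.slope_good hG
            linarith
        _ = (ex (2 * a + 2 * A) + ex (t - (c - δ))) * μ (k + 1 + j) D := by ring
        _ ≤ _ := by
            gcongr
            refine ex_add_ex_le hcδ ?_
            rw [ht, massConst]
            linarith
    · have h1 := lintegral_wt_bind_le (C := C) hℓ (ν := μ k) (H.chain.upper k)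
      rw [← hflow] at h1
      refine h1.trans ((hstep _ ?_).trans ?_)
      · have := H.slope_bad hG
        linarith
      · gcongr
        exact ex_mono (by linarith)

/-- Removing the weight costs `exp ℓ`. In the exponent the `c` terms cancel by the lower half of
`sums`, and the two errors `δ` remain. The indices up to `m + j` are covered by `initial`. -/
theorem flow_univ_le_D (H : Control Λ C D v b ℓ a S x₀ j m A μ N c δ A₁) {k : ℕ} (hkN : k ≤ N) :
    μ k Set.univ ≤ ex (massConst a A c δ A₁ + A₁ + ℓ + 2 * δ * (N - k : ℝ)) * μ (k + j) D := by
  have hcδ : 0 < c - δ := sub_pos.2 H.δ_lt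
  have hlog := neg_log_nonneg hcδ
  have hℓ := H.chain.ℓ_nonneg
  have ha := H.a_nonneg
  have hA := H.A_nonneg
  have hA₁ := H.A₁_nonneg
  have hNk : (0 : ℝ) ≤ N - k := sub_nonneg.2 (by exact_mod_cast hkN)
  have hδ := mul_nonneg H.δ_pos.le hNk
  rcases le_total (m + j) k with hk | hk
  · refine (measure_univ_le_lintegral_wt (C := C) hℓ (μ k)).trans ?_
    refine (mul_le_mul_right (H.lintegral_wt_flow_le hk hkN) _).trans ?_
    rw [← mul_assoc, ← ex_add]
    gcongr
    refine ex_mono ?_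
    have := (abs_le.1 (H.sums k hk hkN)).1
    linarith
  · refine (H.initial k hk).trans ?_
    gcongr
    refine ex_mono ?_
    rw [massConst]
    linarith

/-- Bound for one reset of the backward recursion. -/
noncomputable def resetConst (ℓ a : ℝ) (j m : ℕ) (A c δ A₁ : ℝ) : ℝ :=
  6 * A + 4 * a + (massConst a A c δ A₁ + A₁ + ℓ) + Real.log 2 + m + 2 * δ * (m + j)

/-- Constant in the bound for the total masses seen from the points of the space. -/
noncomputable def supConst (ℓ a : ℝ) (j m : ℕ) (A c δ A₁ : ℝ) : ℝ :=
  resetConst ℓ a j m A c δ A₁ + A₁ - Real.log (1 - Real.exp (-(c + 3 * δ)))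

/-- After a stay in `C` the starting point is forgotten: up to constants the future mass is that of
the minorizing measure, and this measure times the staying mass is dominated by the flow. The
staying mass is compared with `μ (k + j) D` by going back to `k - (m + j)`: the total mass there is
controlled by the mass of `D` at `k - m`, which feeds the stay at `k`. -/
theorem reset_le (H : Control Λ C D v b ℓ a S x₀ j m A μ N c δ A₁) {k : ℕ}
    (hkN : k + 1 ≤ N) (hG : GoodAt Λ C D v b ℓ S x₀ j m A k) {x : X} (hx : x ∈ C) :
    (∫⁻ u in C, Λ (k + 1) N u Set.univ ∂(Λ k (k + 1) x)) * μ (k + j) D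
      ≤ ex (resetConst ℓ a j m A c δ A₁ + 2 * δ * (N - k : ℝ)) * μ N Set.univ := by
  obtain ⟨lam, hlam⟩ := H.chain.doeblin k hG.sel
  set f : X → ℝ≥0∞ := fun u => Λ (k + 1) N u Set.univ with hf
  have hfm : Measurable f := (Λ _ _).measurable_coe MeasurableSet.univ
  have hlate := hG.late
  set I := ∫⁻ u, f u ∂lam with hI
  have h1 : ∫⁻ u in C, f u ∂(Λ k (k + 1) x) ≤ ex (a + A) * I := by
    have h := ex_mul_le_iff.1 (hlam.lintegral_upper hx f)
    refine h.trans ?_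
    rw [neg_neg, ex_add, mul_assoc]
    gcongr
    exact (measure_mono (Set.subset_univ _)).trans ((H.chain.upper k x).trans
      (ex_mono (hG.v_apply_le H.chain (by omega) le_rfl)))
  have h2 : I * stayMass Λ C μ k ≤ ex a * μ N Set.univ := by
    have h := H.chain.stayMass_mul_le H.flow hlam hfm
    rw [hf, ← H.flow.apply_eq hkN MeasurableSet.univ, mul_assoc, ex_mul_le_iff, neg_neg] at h
    rwa [mul_comm]
  have h3 : μ (k + j) D ≤ ex (A + (massConst a A c δ A₁ + A₁ + ℓ + 2 * δ * (N - k + (m + j)))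
      + (4 * A + 2 * a + Real.log 2 + m)) * stayMass Λ C μ k := by
    calc μ (k + j) D ≤ μ (k + j) Set.univ := measure_mono (Set.subset_univ _)
      _ ≤ ex A * μ (k - (m + j)) Set.univ := by
          refine (H.chain.flow_univ_le H.flow (show k - (m + j) ≤ k + j by omega)).trans ?_
          gcongr
          exact ex_mono (hG.sum_v_le H.chain le_rfl (by omega))
      _ ≤ ex A * (ex (massConst a A c δ A₁ + A₁ + ℓ + 2 * δ * (N - k + (m + j)))
            * μ (k - m) D) := by
          gcongr
          have h := H.flow_univ_le_D (k := k - (m + j)) (by omega)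
          rw [show k - (m + j) + j = k - m by omega, Nat.cast_sub hlate] at h
          refine h.trans ?_
          gcongr
          refine ex_mono (le_of_eq ?_)
          push_cast
          ring
      _ ≤ ex A * (ex (massConst a A c δ A₁ + A₁ + ℓ + 2 * δ * (N - k + (m + j)))
            * (ex (4 * A + 2 * a + Real.log 2 + m) * stayMass Λ C μ k)) := by
          gcongr
          exact hG.le_stayMass H.chain H.flow H.mem
      _ = _ := by
          rw [ex_add (A + _), ex_add A]
          ring
  calc _ ≤ (ex (a + A) * I) * (ex (A + (massConst a A c δ A₁ + A₁ + ℓ + 2 * δ * (N - k + (m + j)))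
      + (4 * A + 2 * a + Real.log 2 + m)) * stayMass Λ C μ k) := by gcongr
    _ = ex (a + A) * ex (A + (massConst a A c δ A₁ + A₁ + ℓ + 2 * δ * (N - k + (m + j)))
      + (4 * A + 2 * a + Real.log 2 + m)) * (I * stayMass Λ C μ k) := by ring
    _ ≤ ex (a + A) * ex (A + (massConst a A c δ A₁ + A₁ + ℓ + 2 * δ * (N - k + (m + j)))
      + (4 * A + 2 * a + Real.log 2 + m)) * (ex a * μ N Set.univ) := by gcongr
    _ = _ := by
      rw [← mul_assoc, ← ex_add, ← ex_add]
      congr 2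
      rw [resetConst]
      ring

/-- Backward counterpart of `lintegral_wt_flow_le`, with the weight at the starting point. In the
rate `c + 3 * δ`, the term `c` offsets the mean slope, one `δ` the error in `sums`, and `2 * δ` the
growth allowed by `reset_le`. -/
theorem apply_univ_mul_le_wt (H : Control Λ C D v b ℓ a S x₀ j m A μ N c δ A₁) {k : ℕ}
    (hk : m + j ≤ k) (hkN : k ≤ N) (x : X) :
    Λ k N x Set.univ * μ (k + j) D ≤ ex (supConst ℓ a j m A c δ A₁
      + ∑ l ∈ Finset.Ico k N, slope v b j (GoodAt Λ C D v b ℓ S x₀ j m A) ℓ l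
      + (c + 3 * δ) * (N - k : ℝ)) * μ N Set.univ * wt C ℓ x := by
  set W := slope v b j (GoodAt Λ C D v b ℓ S x₀ j m A) ℓ with hW
  have hδ := H.δ_pos
  have hc : 0 < c := H.δ_pos.trans H.δ_lt
  have hcδ : 0 < c + 3 * δ := by positivity
  have hlog := neg_log_nonneg hcδ
  have hlog' := neg_log_nonneg (sub_pos.2 H.δ_lt)
  have hℓ := H.chain.ℓ_nonneg
  have ha := H.a_nonneg
  have hA := H.A_nonneg
  have hA₁ := H.A₁_nonneg
  have hlog2 := Real.log_nonneg (show (1 : ℝ) ≤ 2 by norm_num)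
  induction hkN using Nat.decreasingInduction generalizing x with
  | self =>
    have h1 : Λ N N x Set.univ = 1 := by rw [H.chain.id_eq, Kernel.id_apply]; simp
    rw [h1, one_mul, Finset.Ico_self, Finset.sum_empty]
    calc μ (N + j) D ≤ μ (N + j) Set.univ := measure_mono (Set.subset_univ _)
      _ ≤ ex A₁ * μ N Set.univ :=
          (H.chain.flow_univ_le H.flow (Nat.le_add_right N j)).trans
            (by gcongr; exact ex_mono H.tail)
      _ = ex (A₁ + ℓ) * μ N Set.univ * ex (-ℓ) := by
          rw [mul_right_comm, ← ex_add]
          congr 2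
          ring
      _ ≤ _ := by
          gcongr
          · refine ex_mono ?_
            rw [supConst, resetConst, massConst]
            have : 0 ≤ 2 * δ * ((m : ℝ) + j) := by positivity
            have : (0 : ℝ) ≤ m := by positivity
            linarith
          · exact ex_le_wt hℓ x
  | of_succ k hkN ih =>
    specialize ih (by omega)
    have hsum : ∑ l ∈ Finset.Ico k N, W l = W k + ∑ l ∈ Finset.Ico (k + 1) N, W l :=
      Finset.sum_eq_sum_Ico_succ_bot hkN W
    have hbd := (abs_le.1 (H.sums k hk hkN.le)).1
    rw [← hW] at hbd
    set s := ∑ l ∈ Finset.Ico k N, W l with hs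
    set t := supConst ℓ a j m A c δ A₁ + s + (c + 3 * δ) * (N - k : ℝ) with ht
    set G := ex (supConst ℓ a j m A c δ A₁ + ∑ l ∈ Finset.Ico (k + 1) N, W l
      + (c + 3 * δ) * (N - (k + 1 : ℕ) : ℝ)) * μ N Set.univ with hGdef
    have hfm : Measurable fun u => Λ (k + 1) N u Set.univ :=
      (Λ _ _).measurable_coe MeasurableSet.univ
    have hstep : ∀ (w : ℝ) (I J : ℝ≥0∞), w + b (k + j) ≤ W k →
        I * μ (k + 1 + j) D ≤ ex w * G * J → I * μ (k + j) D
          ≤ ex (t - (c + 3 * δ)) * μ N Set.univ * J := by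
      intro w I J hw hI
      calc I * μ (k + j) D ≤ I * (ex (b (k + j)) * μ (k + 1 + j) D) := by
            gcongr
            exact H.flow_D_step k
        _ = ex (b (k + j)) * (I * μ (k + 1 + j) D) := by ring
        _ ≤ ex (b (k + j)) * (ex w * G * J) := by gcongr
        _ = ex (b (k + j) + w + (supConst ℓ a j m A c δ A₁ + ∑ l ∈ Finset.Ico (k + 1) N, W l
              + (c + 3 * δ) * (N - (k + 1 : ℕ) : ℝ))) * μ N Set.univ * J := by
            rw [hGdef, ex_add (b (k + j) + w), ex_add (b (k + j))]
            ring
        _ ≤ _ := by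
            gcongr
            refine ex_mono ?_
            rw [ht, hsum]
            push_cast
            linarith
    have hmulc : ∀ (B : Set X), (∫⁻ u in B, Λ (k + 1) N u Set.univ ∂(Λ k (k + 1) x))
        * μ (k + 1 + j) D = ∫⁻ u in B, Λ (k + 1) N u Set.univ * μ (k + 1 + j) D
          ∂(Λ k (k + 1) x) := fun B => (lintegral_mul_const _ hfm).symm
    have hmulc' : (∫⁻ u, Λ (k + 1) N u Set.univ ∂(Λ k (k + 1) x))
        * μ (k + 1 + j) D = ∫⁻ u, Λ (k + 1) N u Set.univ * μ (k + 1 + j) D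
          ∂(Λ k (k + 1) x) := (lintegral_mul_const _ hfm).symm
    rw [H.chain.apply_comp (Nat.le_succ k) hkN x MeasurableSet.univ]
    by_cases hG : GoodAt Λ C D v b ℓ S x₀ j m A k
    · have hsl := H.slope_good hG
      by_cases hx : x ∈ C
      · rw [lintegral_eq_add_compl H.chain.measurableSet_C, add_mul]
        have h1 := H.reset_le hkN hG hx
        have h2 := hstep (v k - ℓ) (∫⁻ u in Cᶜ, Λ (k + 1) N u Set.univ ∂(Λ k (k + 1) x))
          (wt C ℓ x) (by linarith) (by
            rw [hmulc]
            exact setLIntegral_compl_le_of_le_wt (H.chain.upper k) ih hx)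
        refine (add_le_add h1 h2).trans ?_
        rw [wt_mem hx, mul_one, mul_one, ← add_mul]
        gcongr
        refine ex_add_ex_le hcδ ?_
        rw [ht, supConst]
        linarith
      · refine (hstep (v k - ℓ) _ (wt C ℓ x) (by linarith) ?_).trans ?_
        · rw [hmulc']
          exact lintegral_le_of_le_wt_of_notMem hℓ (H.chain.out k hG.sel) ih hx
        · gcongr
          exact ex_mono (by linarith)
    · have hsl := H.slope_bad hG
      refine (hstep (v k + ℓ) _ (wt C ℓ x) (by linarith) ?_).trans ?_
      · rw [hmulc']
        exact lintegral_le_of_le_wt hℓ (H.chain.upper k) ih x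
      · gcongr
        exact ex_mono (by linarith)

/-- The upper half of `sums` cancels `c` and adds one more `δ`. -/
theorem apply_univ_mul_le (H : Control Λ C D v b ℓ a S x₀ j m A μ N c δ A₁) {k : ℕ}
    (hk : m + j ≤ k) (hkN : k ≤ N) (x : X) :
    Λ k N x Set.univ * μ (k + j) D
      ≤ ex (supConst ℓ a j m A c δ A₁ + A₁ + 4 * δ * (N - k : ℝ)) * μ N Set.univ := by
  refine (H.apply_univ_mul_le_wt hk hkN x).trans
    ((mul_le_of_le_one_right' (wt_le_one H.chain.ℓ_nonneg x)).trans ?_)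
  gcongr
  refine ex_mono ?_
  have := (abs_le.1 (H.sums k hk hkN)).2
  linarith

/-- The mass of `D` is followed up to `N + j`, and `tail` brings the comparison back to `N`. -/
theorem flow_D_le (H : Control Λ C D v b ℓ a S x₀ j m A μ N c δ A₁) {k : ℕ} (hkN : k ≤ N) :
    μ (k + j) D ≤ ex (∑ l ∈ Finset.Ico k N, b (l + j) + A₁) * μ N Set.univ := by
  calc μ (k + j) D ≤ ex (∑ l ∈ Finset.Ico (k + j) (N + j), b l) * μ (N + j) D :=
        H.chain.flow_D_ge H.flow (by omega)
    _ ≤ ex (∑ l ∈ Finset.Ico (k + j) (N + j), b l) * (ex A₁ * μ N Set.univ) := by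
        gcongr
        exact (measure_mono (Set.subset_univ _)).trans
          ((H.chain.flow_univ_le H.flow (Nat.le_add_right N j)).trans
            (by gcongr; exact ex_mono H.tail))
    _ = _ := by
        rw [← mul_assoc, ← ex_add, Finset.sum_Ico_add']

end Control

end BlockChain

/-! ### Coupling of pairs and forgetting -/

section Coupling

variable {X : Type*} [MeasurableSpace X]

/-- Coupling estimate: if the measure `π` on the product dominates a symmetric measure `σ` that is
comparable to `π`, an approximately symmetric function has approximately symmetric integral, with
an error reduced by a constant factor. -/
theorem lintegral_le_lintegral_swap_add {π σ : Measure (X × X)} [IsFiniteMeasure π]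
    [IsFiniteMeasure σ] (hσ : σ ≤ π) {d : ℝ≥0∞} (hd : d ≠ ∞) (hπ : d • π ≤ σ)
    (hsym : σ.map Prod.swap = σ) {α s : X × X → ℝ≥0∞} (hα : Measurable α)
    (hαs : ∀ᵐ p ∂π, α p ≤ α p.swap + s p) :
    ∫⁻ p, α p ∂π ≤ ∫⁻ p, α p.swap ∂π + (1 - d) * ∫⁻ p, s p ∂π := by
  -- On the symmetric part `σ` the function and its swap have the same integral. The error `s` is
  -- charged only on the remainder `τ`, which is at most `(1 - d) • π`.
  set τ := π - σ with hR
  have hdec : τ + σ = π := Measure.sub_add_cancel_of_le hσ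
  have hRπ : τ ≤ π := by
    rw [← hdec]
    exact Measure.le_add_right le_rfl
  have hRd : τ ≤ (1 - d) • π := by
    rw [Measure.le_iff]
    intro B _
    have h1 : τ B + d * π B ≤ π B := by
      calc τ B + d * π B ≤ τ B + σ B := by
            gcongr
            exact hπ B
        _ = π B := by rw [← Measure.add_apply, hdec]
    rw [Measure.smul_apply, smul_eq_mul, ENNReal.sub_mul fun _ _ => measure_ne_top _ _, one_mul]
    exact ENNReal.le_sub_of_add_le_right (ENNReal.mul_ne_top hd (measure_ne_top _ _)) h1
  have hswap : ∫⁻ p, α p.swap ∂σ = ∫⁻ p, α p ∂σ := by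
    conv_rhs => rw [← hsym]
    rw [lintegral_map hα measurable_swap]
  have hαR : ∀ᵐ p ∂τ, α p ≤ α p.swap + s p := Measure.absolutelyContinuous_of_le hRπ hαs
  calc ∫⁻ p, α p ∂π = ∫⁻ p, α p ∂τ + ∫⁻ p, α p.swap ∂σ := by
        rw [hswap, ← lintegral_add_measure, hdec]
    _ ≤ ∫⁻ p, (α p.swap + s p) ∂τ + ∫⁻ p, α p.swap ∂σ := by
        exact add_le_add (lintegral_mono_ae hαR) le_rfl
    _ = ∫⁻ p, α p.swap ∂τ + ∫⁻ p, s p ∂τ + ∫⁻ p, α p.swap ∂σ := by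
        have hm : Measurable fun p : X × X => α p.swap := hα.comp measurable_swap
        rw [lintegral_add_left hm]
    _ = ∫⁻ p, α p.swap ∂π + ∫⁻ p, s p ∂τ := by
        rw [add_right_comm, ← lintegral_add_measure, hdec]
    _ ≤ ∫⁻ p, α p.swap ∂π + (1 - d) * ∫⁻ p, s p ∂π := by
        gcongr
        calc ∫⁻ p, s p ∂τ ≤ ∫⁻ p, s p ∂((1 - d) • π) := lintegral_mono' hRd le_rfl
          _ = _ := by rw [lintegral_smul_measure, smul_eq_mul]

/-- The symmetric measure is a multiple of `lam.prod lam`. The lower bounds put it below the product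
with one `c` per coordinate, and the upper bounds lose one more `c` per coordinate, hence `c ^ 4`.
-/
theorem IsLocalDoeblin.lintegral_prod_le {κ : Kernel X X} {C : Set X} {c : ℝ≥0∞} (hc : c ≠ ∞)
    {lam : Measure X} (h : IsLocalDoeblin κ C c lam) {x x' : X}
    (hx : x ∈ C) (hx' : x' ∈ C) [IsFiniteMeasure (κ x)] [IsFiniteMeasure (κ x')]
    {α s : X × X → ℝ≥0∞} (hα : Measurable α) (hαs : ∀ p, α p ≤ α p.swap + s p) :
    ∫⁻ p in C ×ˢ C, α p ∂((κ x).prod (κ x')) ≤ ∫⁻ p in C ×ˢ C, α p.swap ∂((κ x).prod (κ x'))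
      + (1 - c ^ 4) * ∫⁻ p in C ×ˢ C, s p ∂((κ x).prod (κ x')) := by
  have := h.prob
  rw [← Measure.prod_restrict]
  have h1 : (κ x C • lam).prod (κ x' C • lam) = (κ x C * κ x' C) • lam.prod lam := by
    rw [Measure.prod_smul_left, Measure.prod_smul_right, smul_smul]
  have hK : κ x C * κ x' C ≠ ∞ := ENNReal.mul_ne_top (measure_ne_top _ _) (measure_ne_top _ _)
  set σ := (c ^ 2 * (κ x C * κ x' C)) • lam.prod lam with hσ
  have hfin : IsFiniteMeasure σ :=
    Measure.smul_finite _ (ENNReal.mul_ne_top (ENNReal.pow_ne_top hc) hK)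
  have hup : c ^ 2 • ((κ x).restrict C).prod ((κ x').restrict C)
      ≤ (κ x C * κ x' C) • lam.prod lam := by
    have hm := Measure.prod_mono (h.upper x hx) (h.upper x' hx')
    rw [h1] at hm
    refine le_trans (le_of_eq ?_) hm
    rw [Measure.prod_smul_left, Measure.prod_smul_right, smul_smul, sq]
  refine lintegral_le_lintegral_swap_add (σ := σ) ?_ (ENNReal.pow_ne_top hc) ?_ ?_ hα
    (Filter.Eventually.of_forall hαs)
  · refine le_trans (le_of_eq ?_) (Measure.prod_mono (h.lower x hx) (h.lower x' hx'))
    rw [Measure.prod_smul_left, Measure.prod_smul_right, smul_smul, hσ]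
    congr 1
    ring
  · rw [Measure.le_iff] at hup ⊢
    intro B hB
    have := hup B hB
    simp only [hσ, Measure.smul_apply, smul_eq_mul] at this ⊢
    calc c ^ 4 * _ = c ^ 2 * (c ^ 2 * (((κ x).restrict C).prod ((κ x').restrict C)) B) := by ring
      _ ≤ c ^ 2 * (κ x C * κ x' C * (lam.prod lam) B) := by gcongr
      _ = _ := by ring
  · rw [hσ, Measure.map_smul, Measure.prod_swap]

/-- The weight equal to `1` on `C × C` and to `exp (-ℓ)` off `C × C`. -/
noncomputable def pairWt (C : Set X) (ℓ : ℝ) (p : X × X) : ℝ≥0∞ :=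
  open Classical in if p ∈ C ×ˢ C then 1 else ex (-ℓ)

namespace BlockChain

variable {Λ : ℕ → ℕ → Kernel X X} {C D : Set X} {v b : ℕ → ℝ} {ℓ a : ℝ} {S : ℕ → Prop}

/-- Forgetting estimate for a block chain. -/
theorem lintegral_mul_le_swap_add (H : BlockChain Λ C D v b ℓ a S) {G : ℕ → Prop}
    (hG : ∀ k, G k → S k) {h : X → ℝ≥0∞} (hh : Measurable h) (hh1 : ∀ x, h x ≤ 1) {N : ℕ} {k : ℕ}
    (hkN : k ≤ N) (J : ℕ) (x x' : X) :
    (∫⁻ u, h u ∂(Λ k N x)) * Λ k N x' Set.univ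
      ≤ (∫⁻ u, h u ∂(Λ k N x')) * Λ k N x Set.univ
        + ((1 - ex (-a) ^ 4) ^ J * (Λ k N x Set.univ * Λ k N x' Set.univ)
          + ex (ℓ * J + ℓ + ∑ l ∈ Finset.Ico k N, (2 * v l + Real.log 2 + drift G ℓ l))
            * pairWt C ℓ (x, x')) := by
  have hC := H.measurableSet_C
  have hℓ := H.ℓ_nonneg
  set ρ := 1 - ex (-a) ^ 4 with hρ
  -- Here `J` is the number of couplings still requested. A good block spent inside `C × C` consumes
  -- one and contributes a factor `ρ`; lowering `J` supplies the factor `exp (-ℓ)` that the drift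
  -- demands although no weight was gained. The second error term thus accounts for pairs with fewer
  -- than `J` couplings.
  induction hkN using Nat.decreasingInduction generalizing J x x' with
  | self =>
    have h1 : ∀ x, Λ N N x Set.univ = 1 := fun x => by
      rw [H.id_eq, Kernel.id_apply]; simp
    rw [h1, h1, H.lintegral_self N x hh, Finset.Ico_self, Finset.sum_empty]
    calc h x * 1 ≤ 1 := by rw [mul_one]; exact hh1 x
      _ = ex ℓ * ex (-ℓ) := by rw [← ex_add]; simp [ex_zero]
      _ ≤ ex (ℓ * J + ℓ + 0) * pairWt C ℓ (x, x') := by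
          gcongr
          · refine ex_mono ?_
            have : 0 ≤ ℓ * (J : ℝ) := by positivity
            linarith
          · unfold pairWt
            split_ifs
            · exact ex_le_one (by linarith)
            · exact le_rfl
      _ ≤ _ := le_add_self.trans le_add_self
  | of_succ k hk ih =>
    cases J with
    | zero =>
      have hle : ∫⁻ u, h u ∂(Λ k N x) ≤ Λ k N x Set.univ := by
        calc ∫⁻ u, h u ∂(Λ k N x) ≤ ∫⁻ _, 1 ∂(Λ k N x) := lintegral_mono hh1
          _ = _ := by simp
      calc (∫⁻ u, h u ∂(Λ k N x)) * Λ k N x' Set.univ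
          ≤ ρ ^ 0 * (Λ k N x Set.univ * Λ k N x' Set.univ) := by
            rw [pow_zero, one_mul]
            gcongr
        _ ≤ _ := le_self_add.trans le_add_self
    | succ J =>
    set κ := Λ k (k + 1) with hκ
    set f : X → ℝ≥0∞ := fun u => Λ (k + 1) N u Set.univ with hf
    set g : X → ℝ≥0∞ := fun u => ∫⁻ w, h w ∂(Λ (k + 1) N u) with hg
    have hfm : Measurable f := (Λ _ _).measurable_coe MeasurableSet.univ
    have hgm : Measurable g := hh.lintegral_kernel
    have hfin : ∀ x, IsFiniteMeasure (κ x) := fun x =>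
      ⟨(H.upper k x).trans_lt (ex_ne_top _).lt_top⟩
    have hfx : ∀ x, Λ k N x Set.univ = ∫⁻ u, f u ∂(κ x) := fun x =>
      H.apply_comp (Nat.le_succ k) hk x MeasurableSet.univ
    have hgx : ∀ x, ∫⁻ u, h u ∂(Λ k N x) = ∫⁻ u, g u ∂(κ x) := fun x =>
      H.lintegral_comp (Nat.le_succ k) hk x hh
    set θ := (κ x).prod (κ x') with hθ
    set σ' := ∑ l ∈ Finset.Ico (k + 1) N, (2 * v l + Real.log 2 + drift G ℓ l) with hσ'
    set P : ℝ≥0∞ := ex (ℓ * (J + 1 : ℕ) + ℓ + σ') with hP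
    have hP' : ex (ℓ * J + ℓ + σ') = P * ex (-ℓ) := by
      rw [hP, ← ex_add]
      congr 1
      push_cast
      ring
    have hsum : ∑ l ∈ Finset.Ico k N, (2 * v l + Real.log 2 + drift G ℓ l)
        = 2 * v k + Real.log 2 + drift G ℓ k + σ' :=
      Finset.sum_eq_sum_Ico_succ_bot hk _
    have hPk : ex (ℓ * (J + 1 : ℕ) + ℓ + ∑ l ∈ Finset.Ico k N,
        (2 * v l + Real.log 2 + drift G ℓ l)) = P * ex (2 * v k + Real.log 2 + drift G ℓ k) := by
      rw [hsum, hP, ← ex_add]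
      congr 1
      ring
    set α : X × X → ℝ≥0∞ := fun p => g p.1 * f p.2 with hα
    have hαm : Measurable α := (hgm.comp measurable_fst).mul (hfm.comp measurable_snd)
    have hffm : Measurable fun p : X × X => f p.1 * f p.2 :=
      (hfm.comp measurable_fst).mul (hfm.comp measurable_snd)
    have hαsm : Measurable fun p : X × X => α p.swap := hαm.comp measurable_swap
    have e1 : (∫⁻ u, g u ∂(κ x)) * ∫⁻ u, f u ∂(κ x') = ∫⁻ p, α p ∂θ :=
      (lintegral_prod_mul hgm.aemeasurable hfm.aemeasurable).symm
    have e2 : (∫⁻ u, g u ∂(κ x')) * ∫⁻ u, f u ∂(κ x) = ∫⁻ p, α p.swap ∂θ := by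
      rw [mul_comm, ← lintegral_prod_mul hfm.aemeasurable hgm.aemeasurable]
      exact lintegral_congr fun p => mul_comm _ _
    have e3 : (∫⁻ u, f u ∂(κ x)) * ∫⁻ u, f u ∂(κ x') = ∫⁻ p, f p.1 * f p.2 ∂θ :=
      (lintegral_prod_mul hfm.aemeasurable hfm.aemeasurable).symm
    have hmass : θ Set.univ = κ x Set.univ * κ x' Set.univ := by
      rw [hθ, ← Set.univ_prod_univ, Measure.prod_prod]
    have hmass' : θ Set.univ ≤ ex (2 * v k) := by
      rw [hmass, two_mul, ex_add]
      gcongr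
      · exact H.upper k x
      · exact H.upper k x'
    set s : ℕ → X × X → ℝ≥0∞ := fun i p => ρ ^ i * (f p.1 * f p.2)
      + ex (ℓ * i + ℓ + σ') * pairWt C ℓ p with hs
    have ihs : ∀ i p, α p ≤ α p.swap + s i p := fun i p => ih i p.1 p.2
    have hpw1 : ∀ p, pairWt C ℓ p ≤ 1 := fun p => by
      unfold pairWt
      split_ifs
      · exact le_rfl
      · exact ex_le_one (by linarith)
    rw [hfx, hfx, hgx, hgx, e1, e2, e3, hPk]
    have crude : ∫⁻ p, α p ∂θ ≤ ∫⁻ p, α p.swap ∂θ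
        + (ρ ^ (J + 1) * ∫⁻ p, f p.1 * f p.2 ∂θ + P * θ Set.univ) := by
      calc ∫⁻ p, α p ∂θ ≤ ∫⁻ p, (α p.swap + (ρ ^ (J + 1) * (f p.1 * f p.2) + P)) ∂θ := by
            refine lintegral_mono fun p => (ihs (J + 1) p).trans ?_
            simp only [hs]
            gcongr
            exact mul_le_of_le_one_right' (hpw1 p)
        _ = _ := by
            rw [lintegral_add_left hαsm, lintegral_add_left (hffm.const_mul _),
              lintegral_const_mul _ hffm, lintegral_const]
    by_cases hGk : G k
    · rw [drift_pos hGk]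
      by_cases hxx : (x, x') ∈ C ×ˢ C
      · obtain ⟨lam, hlam⟩ := H.doeblin k (hG k hGk)
        have hT : MeasurableSet (C ×ˢ C) := hC.prod hC
        have hd := hlam.lintegral_prod_le (ex_ne_top _) hxx.1 hxx.2 hαm (ihs J)
        have b1 : ∫⁻ p in C ×ˢ C, s J p ∂θ ≤ ρ ^ J * ∫⁻ p in C ×ˢ C, f p.1 * f p.2 ∂θ
            + P * ex (-ℓ) * ex (2 * v k) := by
          calc ∫⁻ p in C ×ˢ C, s J p ∂θ
              ≤ ∫⁻ p in C ×ˢ C, (ρ ^ J * (f p.1 * f p.2) + P * ex (-ℓ)) ∂θ := by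
                refine lintegral_mono fun p => ?_
                simp only [hs]
                rw [hP']
                exact add_le_add le_rfl (mul_le_of_le_one_right' (hpw1 p))
            _ = ρ ^ J * ∫⁻ p in C ×ˢ C, f p.1 * f p.2 ∂θ + P * ex (-ℓ) * θ (C ×ˢ C) := by
                rw [lintegral_add_left (hffm.const_mul _), lintegral_const_mul _ hffm,
                  lintegral_const, Measure.restrict_apply_univ]
            _ ≤ _ := by
                gcongr
                exact (measure_mono (Set.subset_univ _)).trans hmass'
        -- A pair that leaves `C × C` consumes no coupling: the bound with the same `J` is used, and
        -- `exp (-ℓ)` is the weight on arrival.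
        have b2 : ∫⁻ p in (C ×ˢ C)ᶜ, α p ∂θ ≤ ∫⁻ p in (C ×ˢ C)ᶜ, α p.swap ∂θ
            + (ρ ^ (J + 1) * ∫⁻ p in (C ×ˢ C)ᶜ, f p.1 * f p.2 ∂θ
              + P * ex (-ℓ) * ex (2 * v k)) := by
          calc ∫⁻ p in (C ×ˢ C)ᶜ, α p ∂θ
              ≤ ∫⁻ p in (C ×ˢ C)ᶜ, (α p.swap + (ρ ^ (J + 1) * (f p.1 * f p.2)
                + P * ex (-ℓ))) ∂θ := by
                refine setLIntegral_mono (hαsm.add ((hffm.const_mul _).add measurable_const))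
                  fun p hp => (ihs (J + 1) p).trans (le_of_eq ?_)
                simp only [hs, pairWt]
                rw [if_neg hp]
            _ = ∫⁻ p in (C ×ˢ C)ᶜ, α p.swap ∂θ
                + (ρ ^ (J + 1) * ∫⁻ p in (C ×ˢ C)ᶜ, f p.1 * f p.2 ∂θ
                  + P * ex (-ℓ) * θ (C ×ˢ C)ᶜ) := by
                rw [lintegral_add_left hαsm, lintegral_add_left (hffm.const_mul _),
                  lintegral_const_mul _ hffm, lintegral_const, Measure.restrict_apply_univ]
            _ ≤ _ := by
                gcongr
                exact (measure_mono (Set.subset_univ _)).trans hmass'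
        have hρ1 : ρ ≤ 1 := tsub_le_self
        rw [lintegral_eq_add_compl hT θ α]
        -- The pairs that stay and those that leave produce two equal error terms; `log 2` in the
        -- exponent pays for the doubling.
        calc _ ≤ (∫⁻ p in C ×ˢ C, α p.swap ∂θ + ρ * (ρ ^ J * ∫⁻ p in C ×ˢ C, f p.1 * f p.2 ∂θ
              + P * ex (-ℓ) * ex (2 * v k))) + (∫⁻ p in (C ×ˢ C)ᶜ, α p.swap ∂θ
            + (ρ ^ (J + 1) * ∫⁻ p in (C ×ˢ C)ᶜ, f p.1 * f p.2 ∂θ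
              + P * ex (-ℓ) * ex (2 * v k))) :=
              add_le_add (hd.trans (by gcongr)) b2
          _ = (∫⁻ p in C ×ˢ C, α p.swap ∂θ + ∫⁻ p in (C ×ˢ C)ᶜ, α p.swap ∂θ)
              + (ρ ^ (J + 1) * (∫⁻ p in C ×ˢ C, f p.1 * f p.2 ∂θ
                + ∫⁻ p in (C ×ˢ C)ᶜ, f p.1 * f p.2 ∂θ)
              + (ρ * (P * ex (-ℓ) * ex (2 * v k)) + P * ex (-ℓ) * ex (2 * v k))) := by ring
          _ ≤ (∫⁻ p in C ×ˢ C, α p.swap ∂θ + ∫⁻ p in (C ×ˢ C)ᶜ, α p.swap ∂θ)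
              + (ρ ^ (J + 1) * (∫⁻ p in C ×ˢ C, f p.1 * f p.2 ∂θ
                + ∫⁻ p in (C ×ˢ C)ᶜ, f p.1 * f p.2 ∂θ)
              + (P * ex (-ℓ) * ex (2 * v k) + P * ex (-ℓ) * ex (2 * v k))) := by
              exact add_le_add le_rfl (add_le_add le_rfl
                (add_le_add (mul_le_of_le_one_left' hρ1) le_rfl))
          _ = _ := by
              rw [← lintegral_eq_add_compl hT, ← lintegral_eq_add_compl hT, pairWt, if_pos hxx,
                ex_add (2 * v k + Real.log 2), ex_add (2 * v k), ex_log_two]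
              ring
      · refine crude.trans (add_le_add le_rfl (add_le_add le_rfl ?_))
        have hout : κ x Set.univ * κ x' Set.univ ≤ ex (v k - 2 * ℓ) * ex (v k) := by
          by_cases hx : x ∈ C
          · have hx' : x' ∉ C := fun hx' => hxx ⟨hx, hx'⟩
            rw [mul_comm]
            gcongr
            · exact H.out k (hG k hGk) x' hx'
            · exact H.upper k x
          · gcongr
            · exact H.out k (hG k hGk) x hx
            · exact H.upper k x'
        rw [hmass, pairWt, if_neg hxx, mul_assoc]
        refine mul_le_mul_right (hout.trans ?_) _
        rw [← ex_add, ← ex_add]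
        refine ex_mono ?_
        have := Real.log_nonneg (show (1 : ℝ) ≤ 2 by norm_num)
        linarith
    · rw [drift_neg hGk]
      refine crude.trans ?_
      rw [mul_assoc]
      gcongr
      calc θ Set.univ ≤ ex (2 * v k) := hmass'
        _ ≤ ex (2 * v k + Real.log 2 + ℓ) * ex (-ℓ) := by
            rw [← ex_add]
            refine ex_mono ?_
            have := Real.log_nonneg (show (1 : ℝ) ≤ 2 by norm_num)
            linarith
        _ ≤ _ := by
            gcongr
            unfold pairWt
            split_ifs
            · exact ex_le_one (by linarith)
            · exact le_rfl

end BlockChain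

end Coupling

theorem pairWt_le_one {X : Type*} {C : Set X} {ℓ : ℝ} (hℓ : 0 ≤ ℓ) (p : X × X) :
    pairWt C ℓ p ≤ 1 := by
  unfold pairWt
  split_ifs
  · exact le_rfl
  · exact ex_le_one (by linarith)

/-! ### Forgetting with a geometric rate -/

namespace BlockChain.Control

variable {X : Type*} [MeasurableSpace X]
  {Λ : ℕ → ℕ → Kernel X X} {C D : Set X} {v b : ℕ → ℝ} {ℓ a : ℝ} {S : ℕ → Prop}
  {x₀ : X} {j m : ℕ} {A : ℝ} {μ : ℕ → Measure X} {N : ℕ} {c δ A₁ : ℝ}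

theorem massConst_nonneg (H : Control Λ C D v b ℓ a S x₀ j m A μ N c δ A₁) :
    0 ≤ massConst a A c δ A₁ := by
  have h1 := neg_log_nonneg (sub_pos.2 H.δ_lt)
  have h2 := H.a_nonneg
  have h3 := H.A_nonneg
  have h4 := H.A₁_nonneg
  rw [massConst]
  linarith

theorem supConst_nonneg (H : Control Λ C D v b ℓ a S x₀ j m A μ N c δ A₁) :
    0 ≤ supConst ℓ a j m A c δ A₁ := by
  have hδ := H.δ_pos
  have h1 := neg_log_nonneg (show 0 < c + 3 * δ by linarith [H.δ_lt])
  have h2 := H.a_nonneg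
  have h3 := H.A_nonneg
  have h4 := H.A₁_nonneg
  have h5 := H.massConst_nonneg
  have h6 := H.chain.ℓ_nonneg
  have h7 : 0 ≤ 2 * δ * ((m : ℝ) + j) := by positivity
  have h8 : (0 : ℝ) ≤ m := by positivity
  have h9 := Real.log_nonneg (show (1 : ℝ) ≤ 2 by norm_num)
  rw [supConst, resetConst]
  linarith

/-- Constant in the forgetting bound. -/
noncomputable def oscConst (ℓ a : ℝ) (j m : ℕ) (A c δ A₁ r : ℝ) : ℝ :=
  r + supConst ℓ a j m A c δ A₁ + 2 * ℓ + massConst a A c δ A₁ + 5 * A₁ + Real.log 2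

/-- Distance between the prediction from the point `x` and the prediction from the flow, as a bound
on the antisymmetric form of the two. -/
noncomputable def osc (Λ : ℕ → ℕ → Kernel X X) (μ : ℕ → Measure X) (v : ℕ → ℝ) (ℓ a : ℝ)
    (G : ℕ → Prop) (N k J : ℕ) (x : X) : ℝ≥0∞ :=
  (1 - ex (-a) ^ 4) ^ J * (Λ k N x Set.univ * μ N Set.univ)
    + ex (ℓ * J + ℓ + ∑ l ∈ Finset.Ico k N, (2 * v l + Real.log 2 + drift G ℓ l)) * μ k Set.univ

/-- Integrate the pair estimate in the second point against `μ k`, bounding the pair weight by one.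
-/
theorem lintegral_mul_le_add_osc (H : Control Λ C D v b ℓ a S x₀ j m A μ N c δ A₁) {k : ℕ}
    (hkN : k ≤ N) {h : X → ℝ≥0∞} (hh : Measurable h) (hh1 : ∀ x, h x ≤ 1) (J : ℕ) (x : X) :
    (∫⁻ u, h u ∂(Λ k N x)) * μ N Set.univ ≤ (∫⁻ u, h u ∂(μ N)) * Λ k N x Set.univ
      + osc Λ μ v ℓ a (GoodAt Λ C D v b ℓ S x₀ j m A) N k J x := by
  set G := GoodAt Λ C D v b ℓ S x₀ j m A with hG
  have hf : Measurable fun x' => Λ k N x' Set.univ := (Λ k N).measurable_coe MeasurableSet.univ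
  have hgm : Measurable fun x' => ∫⁻ u, h u ∂(Λ k N x') := hh.lintegral_kernel
  rw [H.flow.lintegral_eq hkN hh, osc, H.flow.apply_eq hkN MeasurableSet.univ]
  calc _ = ∫⁻ x', (∫⁻ u, h u ∂(Λ k N x)) * Λ k N x' Set.univ ∂(μ k) :=
        (lintegral_const_mul _ hf).symm
    _ ≤ ∫⁻ x', ((∫⁻ u, h u ∂(Λ k N x')) * Λ k N x Set.univ
        + ((1 - ex (-a) ^ 4) ^ J * (Λ k N x Set.univ * Λ k N x' Set.univ)
          + ex (ℓ * J + ℓ + ∑ l ∈ Finset.Ico k N, (2 * v l + Real.log 2 + drift G ℓ l))))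
          ∂(μ k) := by
        refine lintegral_mono fun x' => ?_
        refine (H.chain.lintegral_mul_le_swap_add (G := G) (fun k hk => hk.sel) hh hh1 hkN J
          x x').trans ?_
        exact add_le_add le_rfl (add_le_add le_rfl
          (mul_le_of_le_one_right' (pairWt_le_one H.chain.ℓ_nonneg _)))
    _ = _ := by
        rw [lintegral_add_left (hgm.mul_const _), lintegral_mul_const _ hgm,
          lintegral_add_left ((hf.const_mul _).const_mul _),
          lintegral_const_mul _ (hf.const_mul _), lintegral_const_mul _ hf, lintegral_const]

theorem lintegral_mul_le_add_osc' (H : Control Λ C D v b ℓ a S x₀ j m A μ N c δ A₁) {k : ℕ}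
    (hkN : k ≤ N) {h : X → ℝ≥0∞} (hh : Measurable h) (hh1 : ∀ x, h x ≤ 1) (J : ℕ) (x : X) :
    (∫⁻ u, h u ∂(μ N)) * Λ k N x Set.univ ≤ (∫⁻ u, h u ∂(Λ k N x)) * μ N Set.univ
      + osc Λ μ v ℓ a (GoodAt Λ C D v b ℓ S x₀ j m A) N k J x := by
  set G := GoodAt Λ C D v b ℓ S x₀ j m A with hG
  have hf : Measurable fun x' => Λ k N x' Set.univ := (Λ k N).measurable_coe MeasurableSet.univ
  have hgm : Measurable fun x' => ∫⁻ u, h u ∂(Λ k N x') := hh.lintegral_kernel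
  rw [H.flow.lintegral_eq hkN hh, osc, H.flow.apply_eq hkN MeasurableSet.univ]
  calc _ = ∫⁻ x', (∫⁻ u, h u ∂(Λ k N x')) * Λ k N x Set.univ ∂(μ k) :=
        (lintegral_mul_const _ hgm).symm
    _ ≤ ∫⁻ x', ((∫⁻ u, h u ∂(Λ k N x)) * Λ k N x' Set.univ
        + ((1 - ex (-a) ^ 4) ^ J * (Λ k N x Set.univ * Λ k N x' Set.univ)
          + ex (ℓ * J + ℓ + ∑ l ∈ Finset.Ico k N, (2 * v l + Real.log 2 + drift G ℓ l))))
          ∂(μ k) := by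
        refine lintegral_mono fun x' => ?_
        refine (H.chain.lintegral_mul_le_swap_add (G := G) (fun k hk => hk.sel) hh hh1 hkN J
          x' x).trans ?_
        rw [mul_comm (Λ k N x' Set.univ) (Λ k N x Set.univ)]
        exact add_le_add le_rfl (add_le_add le_rfl
          (mul_le_of_le_one_right' (pairWt_le_one H.chain.ℓ_nonneg _)))
    _ = _ := by
        rw [lintegral_add_left (hf.const_mul _), lintegral_const_mul _ hf,
          lintegral_add_left ((hf.const_mul _).const_mul _),
          lintegral_const_mul _ (hf.const_mul _), lintegral_const_mul _ hf, lintegral_const]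

/-- Budget per remaining block: the coupled part decays at rate `r * t ≥ 24 δ` against a growth `4
δ`. In the uncoupled part the slopes give `-c + δ`, the requested couplings cost `ℓ * t ≤ c / 2`,
and the total mass of the flow costs `2 δ`; since `c / 2 ≥ 12 δ`, a rate `9 δ` is left. -/
theorem osc_mul_le (H : Control Λ C D v b ℓ a S x₀ j m A μ N c δ A₁) {k : ℕ}
    (hk : m + j ≤ k) (hkN : k ≤ N) {r t : ℝ} (hr : 0 ≤ r) (hρ : 1 - ex (-a) ^ 4 ≤ ex (-r))
    (ht : 0 ≤ t) (hℓt : ℓ * t ≤ c / 2) (hδc : 24 * δ ≤ c) (hδr : 24 * δ ≤ r * t) (x : X) :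
    osc Λ μ v ℓ a (GoodAt Λ C D v b ℓ S x₀ j m A) N k ⌊t * (N - k : ℝ)⌋₊ x * μ (k + j) D
      ≤ ex (oscConst ℓ a j m A c δ A₁ r - 9 * δ * (N - k : ℝ)) * μ N Set.univ ^ 2 := by
  set G := GoodAt Λ C D v b ℓ S x₀ j m A with hG
  set J := ⌊t * (N - k : ℝ)⌋₊ with hJ
  have hNk : (0 : ℝ) ≤ N - k := sub_nonneg.2 (by exact_mod_cast hkN)
  have hJ1 : (J : ℝ) ≤ t * (N - k : ℝ) := Nat.floor_le (by positivity)
  have hJ2 : t * (N - k : ℝ) < J + 1 := Nat.lt_floor_add_one _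
  have hδ := H.δ_pos
  have hℓ := H.chain.ℓ_nonneg
  have hA₁ := H.A₁_nonneg
  have hm := H.massConst_nonneg
  have hs := H.supConst_nonneg
  set aN := μ N Set.univ with haN
  have hpow : (1 - ex (-a) ^ 4) ^ J ≤ ex (-(r * J)) := by
    calc (1 - ex (-a) ^ 4) ^ J ≤ ex (-r) ^ J := by gcongr
      _ = ex (-(r * J)) := by
          rw [ex, ex, ← ENNReal.ofReal_pow (Real.exp_pos _).le, ← Real.exp_nat_mul]
          congr 2
          ring
  set K := oscConst ℓ a j m A c δ A₁ r - Real.log 2 - 9 * δ * (N - k : ℝ) with hK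
  have h1 : (1 - ex (-a) ^ 4) ^ J * (Λ k N x Set.univ * aN) * μ (k + j) D ≤ ex K * aN ^ 2 := by
    calc _ = (1 - ex (-a) ^ 4) ^ J * (Λ k N x Set.univ * μ (k + j) D) * aN := by ring
      _ ≤ ex (-(r * J)) * (ex (supConst ℓ a j m A c δ A₁ + A₁ + 4 * δ * (N - k : ℝ)) * aN)
            * aN := by
          exact mul_le_mul' (mul_le_mul' hpow (H.apply_univ_mul_le hk hkN x)) le_rfl
      _ = ex (-(r * J) + (supConst ℓ a j m A c δ A₁ + A₁ + 4 * δ * (N - k : ℝ))) * aN ^ 2 := by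
          rw [ex_add (-(r * J)) (supConst ℓ a j m A c δ A₁ + A₁ + 4 * δ * (N - k : ℝ))]
          ring
      _ ≤ ex K * aN ^ 2 := by
          gcongr
          refine ex_mono ?_
          have e1 : r * (t * (N - k : ℝ)) ≤ r * (J + 1) := by gcongr
          have e2 : 24 * δ * (N - k : ℝ) ≤ r * t * (N - k : ℝ) := by gcongr
          have e3 : 0 ≤ δ * (N - k : ℝ) := by positivity
          rw [hK, oscConst]
          linarith
  have h2 : ex (ℓ * J + ℓ + ∑ l ∈ Finset.Ico k N, (2 * v l + Real.log 2 + drift G ℓ l))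
      * μ k Set.univ * μ (k + j) D ≤ ex K * aN ^ 2 := by
    set E := ∑ l ∈ Finset.Ico k N, b (l + j) + A₁ with hE
    have hD := H.flow_D_le hkN
    rw [← hE, ← haN] at hD
    calc _ ≤ ex (ℓ * J + ℓ + ∑ l ∈ Finset.Ico k N, (2 * v l + Real.log 2 + drift G ℓ l))
          * (ex (massConst a A c δ A₁ + A₁ + ℓ + 2 * δ * (N - k : ℝ)) * (ex E * aN))
          * (ex E * aN) := by
          gcongr
          exact (H.flow_univ_le_D hkN).trans (by gcongr)
      _ = ex (ℓ * J + ℓ + ∑ l ∈ Finset.Ico k N, (2 * v l + Real.log 2 + drift G ℓ l)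
          + (massConst a A c δ A₁ + A₁ + ℓ + 2 * δ * (N - k : ℝ)) + E + E) * aN ^ 2 := by
          rw [ex_add (_ + E) E, ex_add _ E, ex_add (ℓ * J + ℓ + _)
            (massConst a A c δ A₁ + A₁ + ℓ + 2 * δ * (N - k : ℝ))]
          ring
      _ ≤ ex K * aN ^ 2 := by
          gcongr
          refine ex_mono ?_
          -- Two masses of `D` are compared with the final mass, each at the cost of one sum of `b`.
          -- This is the origin of the doubled `b` in the slope.
          have hsum : ∑ l ∈ Finset.Ico k N, (2 * v l + Real.log 2 + drift G ℓ l)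
              + 2 * ∑ l ∈ Finset.Ico k N, b (l + j) = ∑ l ∈ Finset.Ico k N, slope v b j G ℓ l := by
            rw [Finset.mul_sum, ← Finset.sum_add_distrib]
            refine Finset.sum_congr rfl fun l _ => ?_
            rw [slope]
            ring
          have hb := (abs_le.1 (H.sums k hk hkN)).2
          rw [← hG] at hb
          have e1 : ℓ * J ≤ ℓ * (t * (N - k : ℝ)) := by gcongr
          have e2 : ℓ * t * (N - k : ℝ) ≤ c / 2 * (N - k : ℝ) := by gcongr
          have e3 : 24 * δ * (N - k : ℝ) ≤ c * (N - k : ℝ) := by gcongr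
          have e4 : 0 ≤ δ * (N - k : ℝ) := by positivity
          rw [hK, oscConst]
          linarith
  rw [osc, add_mul]
  refine (add_le_add h1 h2).trans (le_of_eq ?_)
  rw [← two_mul, ← mul_assoc, ← ex_log_two, ← ex_add]
  congr 2
  rw [hK]
  ring

/-- Needed for times inside a block, where a whole growth factor `exp (v k)` may be lost. A single
slope is a difference of two consecutive backward sums, so `v k` is at most a constant plus `δ * (N
- k)`. -/
theorem ex_mul_flow_univ_le (H : Control Λ C D v b ℓ a S x₀ j m A μ N c δ A₁) {k : ℕ}
    (hk : m + j ≤ k) (hkN : k + 1 ≤ N) :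
    ex (v k) * μ k Set.univ
      ≤ ex (massConst a A c δ A₁ + 2 * A₁ + 2 * ℓ + 3 * δ * (N - k : ℝ)) * μ (k + 1 + j) D := by
  set G := GoodAt Λ C D v b ℓ S x₀ j m A with hG
  have h1 := (abs_le.1 (H.sums k hk (by omega))).2
  have h2 := (abs_le.1 (H.sums (k + 1) (by omega) hkN)).1
  rw [Finset.sum_eq_sum_Ico_succ_bot (by omega : k < N)] at h1
  have hδ := H.δ_pos
  have hδc := H.δ_lt
  have hℓ := H.chain.ℓ_nonneg
  have hs : 2 * (v k + b (k + j)) - ℓ ≤ slope v b j G ℓ k := by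
    have := Real.log_nonneg (show (1 : ℝ) ≤ 2 by norm_num)
    rw [slope]
    by_cases h : G k
    · rw [drift_pos h]; linarith
    · rw [drift_neg h]; linarith
  have hw : v k + b (k + j) ≤ A₁ + ℓ + δ * (N - k : ℝ) := by
    rw [← hG] at h1 h2
    push_cast at h2
    linarith
  calc ex (v k) * μ k Set.univ
      ≤ ex (v k) * (ex (massConst a A c δ A₁ + A₁ + ℓ + 2 * δ * (N - k : ℝ))
        * (ex (b (k + j)) * μ (k + 1 + j) D)) := by
        gcongr
        exact (H.flow_univ_le_D (by omega)).trans (by gcongr; exact H.flow_D_step k)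
    _ = ex (v k + (massConst a A c δ A₁ + A₁ + ℓ + 2 * δ * (N - k : ℝ)) + b (k + j))
        * μ (k + 1 + j) D := by
        rw [ex_add (v k + _) (b (k + j)), ex_add (v k)]
        ring
    _ ≤ _ := by
        gcongr
        exact ex_mono (by linarith)

end BlockChain.Control

/-! ### Records of observations and the kernels of the model -/

theorem record_self {Y : Type*} (y : ℕ → Y) (k : ℕ) : record y k k = [] := by
  simp [record]

theorem record_append {Y : Type*} (y : ℕ → Y) {i k n : ℕ} (hik : i ≤ k) (hkn : k ≤ n) :
    record y i k ++ record y k n = record y i n := by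
  rw [record, record, record, ← List.map_append]
  congr 1
  have h1 : k = i + (k - i) := by omega
  have h2 : n - i = (k - i) + (n - k) := by omega
  rw [h2]
  conv_lhs => rw [show List.range' k (n - k) = List.range' (i + (k - i)) (n - k) by rw [← h1]]
  exact List.range'_append_1

theorem record_add {Y : Type*} (y : ℕ → Y) (s k n : ℕ) :
    record y (s + k) (s + n) = record (fun i => y (s + i)) k n := by
  rw [record, record, Nat.add_sub_add_left]
  refine List.ext_getElem (by simp) fun i h1 h2 => ?_
  simp [add_assoc]

theorem record_length {Y : Type*} (y : ℕ → Y) (k n : ℕ) : (record y k n).length = n - k := by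
  simp [record]

theorem record_eq_ofFn {Y : Type*} (y : ℕ → Y) (k r : ℕ) :
    record y k (k + r) = List.ofFn fun i : Fin r => y (k + i) := by
  refine List.ext_getElem (by simp [record]) fun i h1 h2 => ?_
  simp [record]

theorem sum_map_record {Y : Type*} (y : ℕ → Y) (w : Y → ℝ) (k n : ℕ) :
    ((record y k n).map w).sum = ∑ i ∈ Finset.Ico k n, w (y i) := by
  rw [Finset.sum_Ico_eq_sum_range, record]
  have : ∀ d : ℕ, (((List.range' k d).map y).map w).sum = ∑ i ∈ Finset.range d, w (y (k + i)) := by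
    intro d
    induction d with
    | zero => simp
    | succ d ih => rw [List.range'_1_concat, Finset.sum_range_succ, ← ih]; simp
  exact this _

namespace HMM

variable {X Y : Type*} [MeasurableSpace X] [MeasurableSpace Y] (M : HMM X Y)

theorem measurable_g_left (y : Y) : Measurable fun x => M.g x y :=
  M.measurable_g.comp (measurable_id.prodMk measurable_const)

theorem step_apply (y : Y) (x : X) : M.step y x = ENNReal.ofReal (M.g x y) • M.Q x := by
  have h : Measurable (Function.uncurry fun (x : X) (_ : X) => ENNReal.ofReal (M.g x y)) :=
    ((M.measurable_g_left y).comp measurable_fst).ennreal_ofReal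
  rw [step, Kernel.withDensity_apply _ h, withDensity_const]

theorem L_nil : M.L [] = Kernel.id := rfl

theorem L_append (l l' : List Y) : M.L (l ++ l') = M.L l' ∘ₖ M.L l := by
  induction l with
  | nil => simp [L_nil]
  | cons y l ih => rw [List.cons_append, L, ih, Kernel.comp_assoc, L]

theorem lintegral_L_cons (y : Y) (l : List Y) (x : X) {f : X → ℝ≥0∞} (hf : Measurable f) :
    ∫⁻ u, f u ∂(M.L (y :: l) x)
      = ENNReal.ofReal (M.g x y) * ∫⁻ w, ∫⁻ u, f u ∂(M.L l w) ∂(M.Q x) := by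
  rw [L, Kernel.lintegral_comp _ _ _ hf, step_apply, lintegral_smul_measure, smul_eq_mul]

theorem L_cons_apply (y : Y) (l : List Y) (x : X) {A : Set X} (hA : MeasurableSet A) :
    M.L (y :: l) x A = ENNReal.ofReal (M.g x y) * ∫⁻ w, M.L l w A ∂(M.Q x) := by
  rw [L, Kernel.comp_apply' _ _ _ hA, step_apply, lintegral_smul_measure, smul_eq_mul]

theorem L_univ_le {w : Y → ℝ} {l : List Y}
    (h : ∀ y ∈ l, ∀ x, ENNReal.ofReal (M.g x y) ≤ ex (w y)) (x : X) :
    M.L l x Set.univ ≤ ex (l.map w).sum := by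
  induction l generalizing x with
  | nil => simp [L_nil, ex_zero]
  | cons y l ih =>
    rw [L_cons_apply _ _ _ _ MeasurableSet.univ, List.map_cons, List.sum_cons, ex_add]
    refine mul_le_mul' (h y (by simp) x) ?_
    calc ∫⁻ w, M.L l w Set.univ ∂(M.Q x) ≤ ∫⁻ _, ex (l.map w).sum ∂(M.Q x) :=
          lintegral_mono fun u => ih (fun y hy => h y (by simp [hy])) u
      _ = _ := by simp

/-- The null sets of `L⟨l⟩` depend only on the length of the record `l`. -/
theorem L_apply_eq_zero (hg : ∀ x y, 0 < M.g x y) {l l' : List Y} (hl : l.length = l'.length)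
    {A : Set X} (hA : MeasurableSet A) {x : X} (h : M.L l x A = 0) : M.L l' x A = 0 := by
  induction l generalizing l' x with
  | nil =>
    rw [List.length_nil, eq_comm, List.length_eq_zero_iff] at hl
    rwa [hl]
  | cons y l ih =>
    cases l' with
    | nil => simp at hl
    | cons y' l' =>
      rw [L_cons_apply _ _ _ _ hA] at h ⊢
      have h1 : ENNReal.ofReal (M.g x y) ≠ 0 := by simpa using hg x y
      have h2 := (mul_eq_zero.1 h).resolve_left h1
      rw [lintegral_eq_zero_iff ((M.L l).measurable_coe hA)] at h2
      rw [mul_eq_zero, lintegral_eq_zero_iff ((M.L l').measurable_coe hA)]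
      right
      filter_upwards [h2] with u hu
      exact ih (by simpa using hl) hu

theorem L_record_self (y : ℕ → Y) (k : ℕ) : M.L (record y k k) = Kernel.id := by
  rw [record_self, L_nil]

theorem L_record_comp (y : ℕ → Y) {i k n : ℕ} (hik : i ≤ k) (hkn : k ≤ n) :
    M.L (record y i n) = M.L (record y k n) ∘ₖ M.L (record y i k) := by
  rw [← record_append y hik hkn, L_append]

theorem bind_L_record_comp (χ : Measure X) (y : ℕ → Y) {i k n : ℕ} (hik : i ≤ k) (hkn : k ≤ n) :
    χ.bind (M.L (record y i n)) = (χ.bind (M.L (record y i k))).bind (M.L (record y k n)) := by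
  rw [M.L_record_comp y hik hkn, Measure.bind_bind (Kernel.aemeasurable _) (Kernel.aemeasurable _)]
  rfl

theorem L_record_univ_le {w : Y → ℝ} {y : ℕ → Y}
    (h : ∀ i x, ENNReal.ofReal (M.g x (y i)) ≤ ex (w (y i))) (k n : ℕ) (x : X) :
    M.L (record y k n) x Set.univ ≤ ex (∑ i ∈ Finset.Ico k n, w (y i)) := by
  rw [← sum_map_record y w]
  refine M.L_univ_le (fun z hz => ?_) x
  obtain ⟨i, -, rfl⟩ := List.mem_map.1 hz
  exact h i

/-! ### Local Doeblin sets -/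

section Doeblin

variable {M} {r : ℕ} {C : Set X} {εm εp : (Fin r → Y) → ℝ} {lam : (Fin r → Y) → Measure X}
  {φ : (Fin r → Y) → X → ℝ}

theorem LocalDoeblinWith.nonempty (H : M.LocalDoeblinWith r C εm εp lam φ) (z : Fin r → Y) :
    C.Nonempty := by
  rw [Set.nonempty_iff_ne_empty]
  rintro rfl
  simpa using H.lam_self z

theorem LocalDoeblinWith.apply_pos (H : M.LocalDoeblinWith r C εm εp lam φ) (z : Fin r → Y)
    {x : X} (hx : x ∈ C) : 0 < M.L (List.ofFn z) x C := by
  have := H.prob z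
  have h := H.lower z Set.univ MeasurableSet.univ x hx
  rw [Set.univ_inter, measure_univ, mul_one] at h
  exact (ENNReal.ofReal_pos.2 (mul_pos (H.εm_pos z) (H.φ_pos z x))).trans_le h

/-- Taking the whole space as test set identifies `φ z x` with the mass of `C`, up to `εm z` and `εp
z`. Hence `φ` disappears and only the ratio `εm z / εp z` matters. -/
theorem LocalDoeblinWith.isLocalDoeblin (H : M.LocalDoeblinWith r C εm εp lam φ) {z : Fin r → Y}
    {a : ℝ} (ha : Real.exp (-a) ≤ εm z / εp z) :
    IsLocalDoeblin (M.L (List.ofFn z)) C (ex (-a)) (lam z) := by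
  have hp := H.prob z
  have hC := H.measurableSet
  have key : ∀ x, ex (-a) * ENNReal.ofReal (εp z * φ z x) ≤ ENNReal.ofReal (εm z * φ z x) := by
    intro x
    rw [ex, ← ENNReal.ofReal_mul (Real.exp_pos _).le]
    refine ENNReal.ofReal_le_ofReal ?_
    rw [le_div_iff₀ (H.εp_pos z)] at ha
    rw [← mul_assoc]
    exact mul_le_mul_of_nonneg_right ha (H.φ_pos z x).le
  refine ⟨hp, fun x hx => Measure.le_iff.2 fun A hA => ?_,
    fun x hx => Measure.le_iff.2 fun A hA => ?_⟩
  · have h1 := H.lower z A hA x hx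
    have h2 := H.upper z Set.univ MeasurableSet.univ x hx
    rw [Set.univ_inter, measure_univ, mul_one] at h2
    rw [Measure.smul_apply, smul_eq_mul, Measure.restrict_apply hA]
    refine le_trans ?_ h1
    gcongr
    exact (mul_le_mul_right h2 _).trans (key x)
  · have h1 := H.upper z A hA x hx
    have h2 := H.lower z Set.univ MeasurableSet.univ x hx
    rw [Set.univ_inter, measure_univ, mul_one] at h2
    rw [Measure.smul_apply, Measure.smul_apply, smul_eq_mul, smul_eq_mul, Measure.restrict_apply hA]
    calc ex (-a) * M.L (List.ofFn z) x (A ∩ C)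
        ≤ ex (-a) * (ENNReal.ofReal (εp z * φ z x) * lam z A) := by gcongr
      _ = ex (-a) * ENNReal.ofReal (εp z * φ z x) * lam z A := by ring
      _ ≤ _ := by
        gcongr
        exact (key x).trans h2

end Doeblin

/-! ### Joint measurability -/

section Measurability

variable {Γ : Type*} [MeasurableSpace Γ] {u : ℕ → Γ → Y}

/-- Inducting on the list of times keeps the list fixed while the observations vary. The test
function may depend on the parameter, so that such integrals can be nested. -/
theorem measurable_lintegral_L_map (hu : ∀ i, Measurable (u i)) (I : List ℕ)
    {f : Γ × X → ℝ≥0∞} (hf : Measurable f) :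
    Measurable fun p : Γ × X => ∫⁻ x, f (p.1, x) ∂(M.L (I.map fun i => u i p.1) p.2) := by
  induction I with
  | nil =>
    have h : ∀ p : Γ × X, ∫⁻ x, f (p.1, x) ∂(M.L (([] : List ℕ).map fun i => u i p.1) p.2) = f p := by
      intro p
      rw [List.map_nil, L_nil, Kernel.id_apply,
        lintegral_dirac' (f := fun x => f (p.1, x)) _ (hf.comp measurable_prodMk_left)]
    simpa only [h] using hf
  | cons i I ih =>
    let κ : Kernel (Γ × X) X := M.Q.comap Prod.snd measurable_snd
    have h : ∀ p : Γ × X, ∫⁻ x, f (p.1, x) ∂(M.L ((i :: I).map fun i => u i p.1) p.2)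
        = ENNReal.ofReal (M.g p.2 (u i p.1))
          * ∫⁻ w, ∫⁻ x, f (p.1, x) ∂(M.L (I.map fun i => u i p.1) w) ∂(κ p) := by
      intro p
      rw [List.map_cons]
      exact M.lintegral_L_cons _ _ _ (f := fun x => f (p.1, x)) (hf.comp measurable_prodMk_left)
    simp only [h]
    refine Measurable.mul ?_ ?_
    · exact (M.measurable_g.comp (measurable_snd.prodMk ((hu i).comp measurable_fst))).ennreal_ofReal
    · exact Measurable.lintegral_kernel_prod_right' (κ := κ)
        (f := fun q : (Γ × X) × X =>
          ∫⁻ x, f (q.1.1, x) ∂(M.L (I.map fun i => u i q.1.1) q.2))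
        (ih.comp ((measurable_fst.comp measurable_fst).prodMk measurable_snd))

theorem measurable_lintegral_L_record (hu : ∀ i, Measurable (u i)) (k n : ℕ)
    {f : Γ × X → ℝ≥0∞} (hf : Measurable f) :
    Measurable fun p : Γ × X => ∫⁻ x, f (p.1, x) ∂(M.L (record (fun i => u i p.1) k n) p.2) :=
  M.measurable_lintegral_L_map hu (List.range' k (n - k)) hf

/-- The kernel `L⟨y_{k:n-1}⟩` as a kernel in the record and the initial state. -/
noncomputable def jointL (hu : ∀ i, Measurable (u i)) (k n : ℕ) : Kernel (Γ × X) X where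
  toFun p := M.L (record (fun i => u i p.1) k n) p.2
  measurable' := by
    refine Measure.measurable_of_measurable_coe _ fun A hA => ?_
    have h := M.measurable_lintegral_L_record hu k n
      (f := fun q : Γ × X => A.indicator 1 q.2) ((measurable_one.indicator hA).comp measurable_snd)
    simpa only [lintegral_indicator_one hA] using h

theorem measurable_L_record_apply (hu : ∀ i, Measurable (u i)) (k n : ℕ) {A : Set X}
    (hA : MeasurableSet A) :
    Measurable fun p : Γ × X => M.L (record (fun i => u i p.1) k n) p.2 A :=
  (M.jointL hu k n).measurable_coe hA

theorem measurable_integral_L_record (hu : ∀ i, Measurable (u i)) (k n : ℕ) {h : X → ℝ}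
    (hh : Measurable h) :
    Measurable fun p : Γ × X => ∫ x, h x ∂(M.L (record (fun i => u i p.1) k n) p.2) :=
  (hh.stronglyMeasurable.integral_kernel (κ := M.jointL hu k n)).measurable

theorem measurable_lintegral_bind_L_record (χ : Measure X) [SFinite χ]
    (hu : ∀ i, Measurable (u i)) (k n : ℕ) {f : Γ × X → ℝ≥0∞} (hf : Measurable f) :
    Measurable fun p : Γ => ∫⁻ x, f (p, x) ∂(χ.bind (M.L (record (fun i => u i p) k n))) := by
  have h : ∀ p : Γ, ∫⁻ x, f (p, x) ∂(χ.bind (M.L (record (fun i => u i p) k n)))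
      = ∫⁻ w, ∫⁻ x, f (p, x) ∂(M.L (record (fun i => u i p) k n) w) ∂χ := fun p =>
    lintegral_bind_kernel _ _ (hf.comp measurable_prodMk_left)
  simp only [h]
  exact (M.measurable_lintegral_L_record hu k n hf).lintegral_prod_right'

theorem measurable_bind_L_record (χ : Measure X) [SFinite χ]
    (hu : ∀ i, Measurable (u i)) (k n : ℕ) :
    Measurable fun p : Γ => χ.bind (M.L (record (fun i => u i p) k n)) := by
  refine Measure.measurable_of_measurable_coe _ fun A hA => ?_
  have h := M.measurable_lintegral_bind_L_record χ hu k n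
    (f := fun q : Γ × X => A.indicator 1 q.2) ((measurable_one.indicator hA).comp measurable_snd)
  simpa only [lintegral_indicator_one hA] using h

theorem measurable_bind_L_record_apply (χ : Measure X) [SFinite χ]
    (hu : ∀ i, Measurable (u i)) (k n : ℕ) {A : Set X} (hA : MeasurableSet A) :
    Measurable fun p : Γ => χ.bind (M.L (record (fun i => u i p) k n)) A :=
  (Measure.measurable_coe hA).comp (M.measurable_bind_L_record χ hu k n)

theorem measurable_asympVar (χ : Measure X) [SFinite χ] (hu : ∀ i, Measurable (u i)) {h : X → ℝ}
    (hh : Measurable h) (n : ℕ) :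
    Measurable fun p : Γ => M.asympVar χ h (fun i => u i p) n := by
  have hpred : ∀ p : Γ, ∀ k, ∫ x, h x ∂(M.pred χ (record (fun i => u i p) 0 k))
      = ((χ.bind (M.L (record (fun i => u i p) 0 k))) Set.univ)⁻¹.toReal
        * ∫ x, h x ∂(χ.bind (M.L (record (fun i => u i p) 0 k))) := by
    intro p k
    rw [pred, integral_smul_measure, smul_eq_mul]
  have hm0 : ∀ k, Measurable fun p : Γ =>
      ((χ.bind (M.L (record (fun i => u i p) 0 k))) Set.univ)⁻¹ := fun k =>
    (M.measurable_bind_L_record_apply χ hu 0 k MeasurableSet.univ).inv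
  have hm1 : ∀ k, Measurable fun p : Γ =>
      ∫ x, h x ∂(χ.bind (M.L (record (fun i => u i p) 0 k))) := by
    intro k
    exact (hh.stronglyMeasurable.integral_kernel
      (κ := ⟨_, M.measurable_bind_L_record χ hu 0 k⟩)).measurable
  have hm2 : ∀ k, Measurable fun p : Γ =>
      ((M.pred χ (record (fun i => u i p) 0 k)).bind
        (M.L (record (fun i => u i p) k n))).real Set.univ := by
    intro k
    have h2 : ∀ p : Γ, ((M.pred χ (record (fun i => u i p) 0 k)).bind
        (M.L (record (fun i => u i p) k n))) Set.univ
        = ((χ.bind (M.L (record (fun i => u i p) 0 k))) Set.univ)⁻¹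
          * ∫⁻ x, M.L (record (fun i => u i p) k n) x Set.univ
            ∂(χ.bind (M.L (record (fun i => u i p) 0 k))) := by
      intro p
      rw [bind_kernel_apply _ _ MeasurableSet.univ, pred, lintegral_smul_measure, smul_eq_mul]
    simp only [Measure.real, h2]
    exact ((hm0 k).mul (M.measurable_lintegral_bind_L_record χ hu 0 k
      (M.measurable_L_record_apply hu k n MeasurableSet.univ))).ennreal_toReal
  refine Finset.measurable_fun_sum _ fun k _ => ?_
  set F : Γ × X → ℝ := fun q =>
    (((∫ x', h x' ∂(M.L (record (fun i => u i q.1) k n) q.2))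
        - (∫ x', h x' ∂(M.pred χ (record (fun i => u i q.1) 0 n)))
          * (M.L (record (fun i => u i q.1) k n) q.2).real Set.univ)
      / ((M.pred χ (record (fun i => u i q.1) 0 k)).bind
          (M.L (record (fun i => u i q.1) k n))).real Set.univ) ^ 2 with hF
  have hFm : Measurable F := by
    simp only [hF, hpred]
    refine Measurable.pow_const (Measurable.div (Measurable.sub ?_ (Measurable.mul ?_ ?_)) ?_) 2
    · exact M.measurable_integral_L_record hu k n hh
    · exact ((hm0 n).ennreal_toReal.mul (hm1 n)).comp measurable_fst
    · exact (M.measurable_L_record_apply hu k n MeasurableSet.univ).ennreal_toReal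
    · exact (hm2 k).comp measurable_fst
  have h3 : ∀ p : Γ, ∫ x, F (p, x) ∂(M.pred χ (record (fun i => u i p) 0 k))
      = (((χ.bind (M.L (record (fun i => u i p) 0 k))) Set.univ)⁻¹
        * ∫⁻ x, ENNReal.ofReal (F (p, x)) ∂(χ.bind (M.L (record (fun i => u i p) 0 k)))).toReal := by
    intro p
    rw [integral_eq_lintegral_of_nonneg_ae (Filter.Eventually.of_forall fun x => sq_nonneg _)
      (hFm.comp measurable_prodMk_left).aestronglyMeasurable, pred, lintegral_smul_measure,
      smul_eq_mul]
  change Measurable fun p : Γ => ∫ x, F (p, x) ∂(M.pred χ (record (fun i => u i p) 0 k))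
  simp only [h3]
  exact ((hm0 k).mul (M.measurable_lintegral_bind_L_record χ hu 0 k
    (f := fun q => ENNReal.ofReal (F q)) hFm.ennreal_ofReal)).ennreal_toReal

end Measurability

end HMM

/-! ### Bounds for the terms of the asymptotic variance -/

theorem ex_toReal (t : ℝ) : (ex t).toReal = Real.exp t := ENNReal.toReal_ofReal (Real.exp_pos t).le

/-- An affine change of function reduces a bounded `h` to the `[0, 1]`-valued functions of the
forgetting estimates. -/
theorem integral_eq_sub_of_abs_le {X : Type*} [MeasurableSpace X] (κ : Measure X)
    [IsFiniteMeasure κ] {h : X → ℝ} (hh : Measurable h) {B : ℝ} (hB : 0 < B)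
    (hhB : ∀ x, |h x| ≤ B) :
    ∫ x, h x ∂κ = 2 * B * (∫⁻ x, ENNReal.ofReal ((h x + B) / (2 * B)) ∂κ).toReal
      - B * κ.real Set.univ := by
  have hi : Integrable h κ :=
    Integrable.of_bound hh.aestronglyMeasurable B (Filter.Eventually.of_forall hhB)
  rw [← integral_eq_lintegral_of_nonneg_ae
    (Filter.Eventually.of_forall fun x =>
      div_nonneg (by linarith [(abs_le.1 (hhB x)).1]) (by linarith))
    ((hh.add_const B).div_const _).aestronglyMeasurable, integral_div,
    integral_add hi (integrable_const B), integral_const, smul_eq_mul]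
  field_simp
  ring

namespace HMM

variable {X Y : Type*} [MeasurableSpace X] [MeasurableSpace Y] (M : HMM X Y)
  {χ : Measure X} [IsProbabilityMeasure χ] {w : Y → ℝ} {y : ℕ → Y}

theorem bind_L_record_univ_le (hw : ∀ i x, ENNReal.ofReal (M.g x (y i)) ≤ ex (w (y i)))
    (k n : ℕ) :
    χ.bind (M.L (record y k n)) Set.univ ≤ ex (∑ i ∈ Finset.Ico k n, w (y i)) := by
  have h := bind_univ_le (ν := χ) (M.L_record_univ_le hw k n)
  rwa [measure_univ (μ := χ), mul_one] at h

/-- A term of the asymptotic variance is controlled by the antisymmetric form comparing the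
predictions at an intermediate time `t`. -/
theorem variance_term_le (hw : ∀ i x, ENNReal.ofReal (M.g x (y i)) ≤ ex (w (y i)))
    {k t n : ℕ} (hkt : k ≤ t) (htn : t ≤ n)
    (ha : χ.bind (M.L (record y 0 n)) Set.univ ≠ 0) {h : X → ℝ} (hh : Measurable h) {B : ℝ}
    (hB : 0 < B) (hhB : ∀ x, |h x| ≤ B) {Δ : ℝ≥0∞} {W R : ℝ}
    (hle : ∀ H : X → ℝ≥0∞, Measurable H → (∀ x, H x ≤ 1) → ∀ x,
      (∫⁻ u, H u ∂(M.L (record y t n) x)) * χ.bind (M.L (record y 0 n)) Set.univ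
        ≤ (∫⁻ u, H u ∂(χ.bind (M.L (record y 0 n)))) * M.L (record y t n) x Set.univ + Δ)
    (hge : ∀ H : X → ℝ≥0∞, Measurable H → (∀ x, H x ≤ 1) → ∀ x,
      (∫⁻ u, H u ∂(χ.bind (M.L (record y 0 n)))) * M.L (record y t n) x Set.univ
        ≤ (∫⁻ u, H u ∂(M.L (record y t n) x)) * χ.bind (M.L (record y 0 n)) Set.univ + Δ)
    (hW : ∀ x, M.L (record y k t) x Set.univ ≤ ex W)
    (hR : χ.bind (M.L (record y 0 k)) Set.univ * ex W * Δ
      ≤ ex R * χ.bind (M.L (record y 0 n)) Set.univ ^ 2) :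
    ∫ x, (((∫ x', h x' ∂(M.L (record y k n) x))
        - (∫ x', h x' ∂(M.pred χ (record y 0 n))) * (M.L (record y k n) x).real Set.univ)
      / ((M.pred χ (record y 0 k)).bind (M.L (record y k n))).real Set.univ) ^ 2
      ∂(M.pred χ (record y 0 k)) ≤ (2 * B * Real.exp R) ^ 2 := by
  have hkn := hkt.trans htn
  have hfin : ∀ i l, χ.bind (M.L (record y i l)) Set.univ ≠ ∞ := fun i l =>
    ((M.bind_L_record_univ_le hw i l).trans_lt (ex_ne_top _).lt_top).ne
  have hLfin : ∀ i l x, M.L (record y i l) x Set.univ ≠ ∞ := fun i l x =>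
    ((M.L_record_univ_le hw i l x).trans_lt (ex_ne_top _).lt_top).ne
  have hcomp := M.bind_L_record_comp χ y (Nat.zero_le k) hkn
  have hp : M.pred χ (record y 0 k)
      = ((χ.bind (M.L (record y 0 k))) Set.univ)⁻¹ • χ.bind (M.L (record y 0 k)) := rfl
  have hpn : M.pred χ (record y 0 n)
      = ((χ.bind (M.L (record y 0 n))) Set.univ)⁻¹ • χ.bind (M.L (record y 0 n)) := rfl
  set μk := χ.bind (M.L (record y 0 k)) with hμk
  set μn := χ.bind (M.L (record y 0 n)) with hμn
  have hμk0 : μk Set.univ ≠ 0 := by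
    intro h0
    rw [hcomp, Measure.measure_univ_eq_zero.1 h0] at ha
    simp at ha
  have hpos : 0 < μk.real Set.univ := ENNReal.toReal_pos hμk0 (hfin _ _)
  have hposn : 0 < μn.real Set.univ := ENNReal.toReal_pos ha (hfin _ _)
  have : IsFiniteMeasure μn := ⟨(hfin 0 n).lt_top⟩
  -- An infinite `Δ` would make the left side of `hR` infinite, while its right side is finite.
  have hΔ : Δ ≠ ∞ := by
    rintro rfl
    rw [ENNReal.mul_top (mul_ne_zero hμk0 (ex_ne_zero W)), top_le_iff] at hR
    exact ENNReal.mul_ne_top (ex_ne_top R) (ENNReal.pow_ne_top (hfin 0 n)) hR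
  have hprob : IsProbabilityMeasure (M.pred χ (record y 0 k)) := by
    refine ⟨?_⟩
    rw [hp, Measure.smul_apply, smul_eq_mul, ENNReal.inv_mul_cancel hμk0 (hfin _ _)]
  have hden : ((M.pred χ (record y 0 k)).bind (M.L (record y k n))).real Set.univ
      = μn.real Set.univ / μk.real Set.univ := by
    rw [Measure.real, hp, bind_kernel_apply _ _ MeasurableSet.univ, lintegral_smul_measure,
      ← bind_kernel_apply _ _ MeasurableSet.univ, ← hcomp, smul_eq_mul, ENNReal.toReal_mul,
      ENNReal.toReal_inv, Measure.real, Measure.real]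
    ring
  have hmean : ∫ x', h x' ∂(M.pred χ (record y 0 n))
      = (∫ x', h x' ∂μn) / μn.real Set.univ := by
    rw [hpn, integral_smul_measure, smul_eq_mul, ENNReal.toReal_inv, Measure.real]
    ring
  set H : X → ℝ≥0∞ := fun x => ENNReal.ofReal ((h x + B) / (2 * B)) with hH
  have hHm : Measurable H := ((hh.add_const B).div_const _).ennreal_ofReal
  have hH1 : ∀ x, H x ≤ 1 := by
    intro x
    rw [hH, ← ENNReal.ofReal_one]
    refine ENNReal.ofReal_le_ofReal ?_
    rw [div_le_one (by linarith)]
    linarith [(abs_le.1 (hhB x)).2]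
  have hLm : Measurable fun u => M.L (record y t n) u Set.univ :=
    (M.L _).measurable_coe MeasurableSet.univ
  have hIm : Measurable fun u => ∫⁻ x', H x' ∂(M.L (record y t n) u) := hHm.lintegral_kernel
  have huniv : ∀ x, M.L (record y k n) x Set.univ
      = ∫⁻ u, M.L (record y t n) u Set.univ ∂(M.L (record y k t) x) := by
    intro x
    rw [M.L_record_comp y hkt htn, Kernel.comp_apply' _ _ _ MeasurableSet.univ]
  have hinteg : ∀ x, ∫⁻ x', H x' ∂(M.L (record y k n) x)
      = ∫⁻ u, ∫⁻ x', H x' ∂(M.L (record y t n) u) ∂(M.L (record y k t) x) := by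
    intro x
    rw [M.L_record_comp y hkt htn, Kernel.lintegral_comp _ _ _ hHm]
  have hΔW : ∀ x, ∫⁻ _, Δ ∂(M.L (record y k t) x) ≤ ex W * Δ := by
    intro x
    rw [lintegral_const, mul_comm]
    gcongr
    exact hW x
  have hE : ex W * Δ ≠ ∞ := ENNReal.mul_ne_top (ex_ne_top W) hΔ
  have up : ∀ x, (∫⁻ x', H x' ∂(M.L (record y k n) x)) * μn Set.univ
      ≤ (∫⁻ x', H x' ∂μn) * M.L (record y k n) x Set.univ + ex W * Δ := by
    intro x
    rw [hinteg, huniv, ← lintegral_mul_const _ hIm, ← lintegral_const_mul _ hLm]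
    refine (lintegral_mono fun u => hle H hHm hH1 u).trans ?_
    rw [lintegral_add_left (hLm.const_mul _)]
    exact add_le_add le_rfl (hΔW x)
  have lo : ∀ x, (∫⁻ x', H x' ∂μn) * M.L (record y k n) x Set.univ
      ≤ (∫⁻ x', H x' ∂(M.L (record y k n) x)) * μn Set.univ + ex W * Δ := by
    intro x
    rw [hinteg, huniv, ← lintegral_mul_const _ hIm, ← lintegral_const_mul _ hLm]
    refine (lintegral_mono fun u => hge H hHm hH1 u).trans ?_
    rw [lintegral_add_left (hIm.mul_const _)]
    exact add_le_add le_rfl (hΔW x)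
  have hIfin : ∀ κ : Measure X, κ Set.univ ≠ ∞ → ∫⁻ x', H x' ∂κ ≠ ∞ := by
    intro κ hκ
    refine ((lintegral_mono hH1).trans_lt ?_).ne
    simpa using hκ.lt_top
  have hR' : μk.real Set.univ * (ex W * Δ).toReal ≤ Real.exp R * μn.real Set.univ ^ 2 := by
    have := ENNReal.toReal_mono (ENNReal.mul_ne_top (ex_ne_top R)
      (ENNReal.pow_ne_top (hfin 0 n))) hR
    rwa [mul_assoc, ENNReal.toReal_mul, ENNReal.toReal_mul (a := ex R), ENNReal.toReal_pow,
      ex_toReal] at this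
  have hbound : ∀ x, (((∫ x', h x' ∂(M.L (record y k n) x))
        - (∫ x', h x' ∂(M.pred χ (record y 0 n))) * (M.L (record y k n) x).real Set.univ)
      / ((M.pred χ (record y 0 k)).bind (M.L (record y k n))).real Set.univ) ^ 2
      ≤ (2 * B * Real.exp R) ^ 2 := by
    intro x
    have : IsFiniteMeasure (M.L (record y k n) x) := ⟨(hLfin k n x).lt_top⟩
    have hp1 := hIfin _ (hLfin k n x)
    have hp2 := hIfin _ (hfin 0 n)
    have u1 := ENNReal.toReal_mono
      (ENNReal.add_ne_top.2 ⟨ENNReal.mul_ne_top hp2 (hLfin k n x), hE⟩) (up x)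
    have l1 := ENNReal.toReal_mono
      (ENNReal.add_ne_top.2 ⟨ENNReal.mul_ne_top hp1 (hfin 0 n), hE⟩) (lo x)
    rw [ENNReal.toReal_add (ENNReal.mul_ne_top hp2 (hLfin k n x)) hE, ENNReal.toReal_mul,
      ENNReal.toReal_mul (a := ∫⁻ x', H x' ∂μn)] at u1
    rw [ENNReal.toReal_add (ENNReal.mul_ne_top hp1 (hfin 0 n)) hE, ENNReal.toReal_mul,
      ENNReal.toReal_mul (a := ∫⁻ x', H x' ∂(M.L (record y k n) x))] at l1
    rw [hden, hmean, integral_eq_sub_of_abs_le μn hh hB hhB,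
      integral_eq_sub_of_abs_le (M.L (record y k n) x) hh hB hhB]
    change (∫⁻ x', H x' ∂(M.L (record y k n) x)).toReal * μn.real Set.univ
      ≤ (∫⁻ x', H x' ∂μn).toReal * (M.L (record y k n) x).real Set.univ + (ex W * Δ).toReal at u1
    change (∫⁻ x', H x' ∂μn).toReal * (M.L (record y k n) x).real Set.univ
      ≤ (∫⁻ x', H x' ∂(M.L (record y k n) x)).toReal * μn.real Set.univ + (ex W * Δ).toReal at l1
    change ((2 * B * (∫⁻ x', H x' ∂(M.L (record y k n) x)).toReal
      - B * (M.L (record y k n) x).real Set.univ - (2 * B * (∫⁻ x', H x' ∂μn).toReal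
        - B * μn.real Set.univ) / μn.real Set.univ * (M.L (record y k n) x).real Set.univ)
      / (μn.real Set.univ / μk.real Set.univ)) ^ 2 ≤ _
    generalize (∫⁻ x', H x' ∂(M.L (record y k n) x)).toReal = p at u1 l1 ⊢
    generalize (∫⁻ x', H x' ∂μn).toReal = q at u1 l1 ⊢
    generalize (M.L (record y k n) x).real Set.univ = Lx at u1 l1 ⊢
    generalize (ex W * Δ).toReal = E at u1 l1 hR'
    generalize μn.real Set.univ = an at u1 l1 hR' hposn ⊢
    generalize μk.real Set.univ = ak at hR' hpos ⊢
    -- The constant part of the affine change cancels, and only the antisymmetric form `p * an - q *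
    -- Lx` is left.
    have e1 : (2 * B * p - B * Lx - (2 * B * q - B * an) / an * Lx) / (an / ak)
        = ak * (2 * B * (p * an - q * Lx)) / an ^ 2 := by
      field_simp
      ring
    have e2 : |p * an - q * Lx| ≤ E := abs_le.2 ⟨by linarith, by linarith⟩
    rw [e1]
    have e3 : |ak * (2 * B * (p * an - q * Lx)) / an ^ 2| ≤ 2 * B * Real.exp R := by
      rw [abs_div, abs_of_pos (by positivity : 0 < an ^ 2), div_le_iff₀ (by positivity), abs_mul,
        abs_mul, abs_of_pos hpos, abs_of_pos (by linarith : 0 < 2 * B)]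
      calc ak * (2 * B * |p * an - q * Lx|) ≤ ak * (2 * B * E) := by gcongr
        _ = 2 * B * (ak * E) := by ring
        _ ≤ 2 * B * (Real.exp R * an ^ 2) := by gcongr
        _ = _ := by ring
    rw [← sq_abs]
    exact pow_le_pow_left₀ (abs_nonneg _) e3 2
  calc _ ≤ ∫ _, (2 * B * Real.exp R) ^ 2 ∂(M.pred χ (record y 0 k)) :=
        integral_mono_of_nonneg (Filter.Eventually.of_forall fun x => sq_nonneg _)
          (integrable_const _) (Filter.Eventually.of_forall hbound)
    _ = _ := by simp

end HMM

theorem sum_pow_sub_le {q : ℝ} (hq : 0 ≤ q) (hq1 : q < 1) (n : ℕ) :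
    ∑ k ∈ Finset.range (n + 1), q ^ (n - k) ≤ (1 - q)⁻¹ := by
  have h : ∑ k ∈ Finset.range (n + 1), q ^ (n - k) = ∑ k ∈ Finset.range (n + 1), q ^ k := by
    rw [← Finset.sum_range_reflect (fun k => q ^ k) (n + 1)]
    exact Finset.sum_congr rfl fun k _ => by congr 1
  rw [h, ← tsum_geometric_of_lt_one hq hq1]
  exact (summable_geometric_of_lt_one hq hq1).sum_le_tsum _ fun i _ => pow_nonneg hq i

namespace HMM

open BlockChain BlockChain.Control

variable {X Y : Type*} [MeasurableSpace X] [MeasurableSpace Y] (M : HMM X Y)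
  {χ : Measure X} [IsProbabilityMeasure χ] {w : Y → ℝ} {y : ℕ → Y}
  {C D : Set X} {v b : ℕ → ℝ} {ℓ a : ℝ} {S : ℕ → Prop}
  {x₀ : X} {j m : ℕ} {A : ℝ} {N : ℕ} {c δ A₁ : ℝ} {r s : ℕ}

/-- Predictions are compared at a block time not before `k`. The forgetting bound is divided by a
mass of `D` slightly after that time, and `hR` restores it. -/
theorem variance_term_le_of_control (hw : ∀ i x, ENNReal.ofReal (M.g x (y i)) ≤ ex (w (y i)))
    (H : Control (fun i k => M.L (record y (s + i * r) (s + k * r))) C D v b ℓ a S x₀ j m A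
      (fun i => χ.bind (M.L (record y 0 (s + i * r)))) N c δ A₁)
    (ha : χ.bind (M.L (record y 0 (s + N * r))) Set.univ ≠ 0)
    {ρ t : ℝ} (hρ : 0 ≤ ρ) (haρ : 1 - ex (-a) ^ 4 ≤ ex (-ρ))
    (ht : 0 ≤ t) (hℓt : ℓ * t ≤ c / 2) (hδc : 24 * δ ≤ c) (hδρ : 24 * δ ≤ ρ * t)
    {h : X → ℝ} (hh : Measurable h) {B : ℝ} (hB : 0 < B) (hhB : ∀ x, |h x| ≤ B)
    {i k : ℕ} (hi : m + j ≤ i) (hiN : i ≤ N) (hk : k ≤ s + i * r) {W R : ℝ}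
    (hW : ∀ x, M.L (record y k (s + i * r)) x Set.univ ≤ ex W)
    (hR : χ.bind (M.L (record y 0 k)) Set.univ * ex W
      ≤ ex R * χ.bind (M.L (record y 0 (s + (i + j) * r))) D) :
    ∫ x, (((∫ x', h x' ∂(M.L (record y k (s + N * r)) x))
        - (∫ x', h x' ∂(M.pred χ (record y 0 (s + N * r))))
          * (M.L (record y k (s + N * r)) x).real Set.univ)
      / ((M.pred χ (record y 0 k)).bind (M.L (record y k (s + N * r)))).real Set.univ) ^ 2
      ∂(M.pred χ (record y 0 k))
      ≤ (2 * B * Real.exp (R + (oscConst ℓ a j m A c δ A₁ ρ - 9 * δ * (N - i : ℝ)))) ^ 2 := by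
  have hafin : χ.bind (M.L (record y 0 (s + N * r))) Set.univ ≠ ∞ :=
    ((M.bind_L_record_univ_le hw _ _).trans_lt (ex_ne_top _).lt_top).ne
  set Q := ex (oscConst ℓ a j m A c δ A₁ ρ - 9 * δ * (N - i : ℝ))
    * χ.bind (M.L (record y 0 (s + N * r))) Set.univ ^ 2 with hQ
  set d := χ.bind (M.L (record y 0 (s + (i + j) * r))) D with hd
  have hosc : ∀ x, osc (fun i k => M.L (record y (s + i * r) (s + k * r)))
      (fun i => χ.bind (M.L (record y 0 (s + i * r)))) v ℓ a
      (GoodAt (fun i k => M.L (record y (s + i * r) (s + k * r))) C D v b ℓ S x₀ j m A) N i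
      ⌊t * (N - i : ℝ)⌋₊ x ≤ Q / d := by
    intro x
    rw [ENNReal.le_div_iff_mul_le
      (Or.inr (mul_ne_zero (ex_ne_zero _) (pow_ne_zero 2 ha)))
      (Or.inr (ENNReal.mul_ne_top (ex_ne_top _) (ENNReal.pow_ne_top hafin)))]
    exact H.osc_mul_le hi hiN hρ haρ ht hℓt hδc hδρ x
  refine M.variance_term_le hw hk (by gcongr) ha hh hB hhB (Δ := Q / d) (W := W) ?_ ?_ hW ?_
  · intro F hF hF1 x
    exact (H.lintegral_mul_le_add_osc hiN hF hF1 ⌊t * (N - i : ℝ)⌋₊ x).trans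
      (add_le_add le_rfl (hosc x))
  · intro F hF hF1 x
    exact (H.lintegral_mul_le_add_osc' hiN hF hF1 ⌊t * (N - i : ℝ)⌋₊ x).trans
      (add_le_add le_rfl (hosc x))
  · calc _ ≤ ex R * d * (Q / d) := by gcongr
      _ = ex R * (d * (Q / d)) := mul_assoc _ _ _
      _ ≤ ex R * Q := by gcongr; exact ENNReal.mul_div_le
      _ = _ := by rw [hQ, ← mul_assoc, ← ex_add]

/-- A bound on the asymptotic variance that depends on the observations only through the
constants of a block decomposition of the record. -/
theorem asympVar_le (hw : ∀ i x, ENNReal.ofReal (M.g x (y i)) ≤ ex (w (y i)))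
    (hr : 0 < r)
    (H : Control (fun i k => M.L (record y (s + i * r) (s + k * r))) C D v b ℓ a S x₀ j m A
      (fun i => χ.bind (M.L (record y 0 (s + i * r)))) N c δ A₁)
    (hv : ∀ i, v i = ∑ l ∈ Finset.Ico (s + i * r) (s + (i + 1) * r), w (y l))
    {A₂ : ℝ} (hA₂ : 0 ≤ A₂)
    (hinit : ex (∑ l ∈ Finset.Ico 0 (s + (m + j) * r), w (y l))
      ≤ ex A₂ * χ.bind (M.L (record y 0 (s + (m + j + j) * r))) D)
    (ha : χ.bind (M.L (record y 0 (s + N * r))) Set.univ ≠ 0)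
    {ρ t : ℝ} (hρ : 0 ≤ ρ) (haρ : 1 - ex (-a) ^ 4 ≤ ex (-ρ))
    (ht : 0 ≤ t) (hℓt : ℓ * t ≤ c / 2) (hδc : 24 * δ ≤ c) (hδρ : 24 * δ ≤ ρ * t)
    {h : X → ℝ} (hh : Measurable h) {B : ℝ} (hB : 0 < B) (hhB : ∀ x, |h x| ≤ B) :
    M.asympVar χ h y (s + N * r)
      ≤ (2 * B * Real.exp (oscConst ℓ a j m A c δ A₁ ρ + massConst a A c δ A₁ + 2 * A₁ + 2 * ℓ
        + 9 * δ + A₂)) ^ 2 * ((s + (m + j) * r + 1 : ℕ) + (1 - Real.exp (-(12 * δ / r)))⁻¹) := by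
  have hδ := H.δ_pos
  have hℓ := H.chain.ℓ_nonneg
  have hA₁ := H.A₁_nonneg
  have hmass := H.massConst_nonneg
  have hr0 : (0 : ℝ) < r := by exact_mod_cast hr
  set Q := oscConst ℓ a j m A c δ A₁ ρ + massConst a A c δ A₁ + 2 * A₁ + 2 * ℓ + 9 * δ + A₂ with hQ
  set n := s + N * r with hn
  set q := Real.exp (-(12 * δ / r)) with hq
  have hq1 : q < 1 := by
    rw [hq, Real.exp_lt_one_iff]
    have : 0 < 12 * δ / r := by positivity
    linarith
  have hMN := H.late
  have hterm : ∀ k ∈ Finset.range (n + 1),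
      ∫ x, (((∫ x', h x' ∂(M.L (record y k n) x))
        - (∫ x', h x' ∂(M.pred χ (record y 0 n))) * (M.L (record y k n) x).real Set.univ)
      / ((M.pred χ (record y 0 k)).bind (M.L (record y k n))).real Set.univ) ^ 2
      ∂(M.pred χ (record y 0 k))
      ≤ (2 * B * Real.exp Q) ^ 2
        * ((if k ∈ Finset.range (s + (m + j) * r + 1) then 1 else 0) + q ^ (n - k)) := by
    intro k hk
    rw [Finset.mem_range] at hk
    by_cases hk' : k ∈ Finset.range (s + (m + j) * r + 1)
    -- The early terms are all compared at the block time `m + j`. They are bounded without decay,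
    -- since their number does not depend on `N`.
    · have hkt : k ≤ s + (m + j) * r := Nat.lt_succ_iff.1 (Finset.mem_range.1 hk')
      rw [if_pos hk']
      refine (M.variance_term_le_of_control hw H ha hρ haρ ht hℓt hδc hδρ hh hB hhB le_rfl hMN hkt
        (R := A₂) (M.L_record_univ_le hw k _) ?_).trans ?_
      · refine le_trans ?_ hinit
        rw [← Finset.sum_Ico_consecutive _ (Nat.zero_le k) hkt, ex_add]
        gcongr
        exact M.bind_L_record_univ_le hw 0 k
      · have hNM : (0 : ℝ) ≤ N - ((m + j : ℕ) : ℝ) := sub_nonneg.2 (by exact_mod_cast hMN)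
        have h9 : 0 ≤ 9 * δ * (N - ((m + j : ℕ) : ℝ)) := by positivity
        calc _ ≤ (2 * B * Real.exp Q) ^ 2 := by
              gcongr
              linarith
          _ ≤ _ := le_mul_of_one_le_right (sq_nonneg _)
              (le_add_of_nonneg_right (pow_nonneg (Real.exp_pos _).le _))
    · have hkt : s + (m + j) * r < k := by
        rw [Finset.mem_range] at hk'
        omega
      rw [if_neg hk', zero_add]
      -- With the `-1`, `k` lies in `(s + i r, s + (i + 1) r]`: a block time belongs to the block
      -- that it ends, and the comparison takes place at the right end.
      set i := (k - s - 1) / r with hi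
      have hi1 : s + i * r < k := by
        have := Nat.div_mul_le_self (k - s - 1) r
        rw [← hi] at this
        omega
      have hi2 : k ≤ s + (i + 1) * r := by
        have := Nat.lt_div_mul_add (a := k - s - 1) hr
        rw [← hi] at this
        rw [add_one_mul]
        omega
      have hi3 : m + j ≤ i := by
        rw [hi, Nat.le_div_iff_mul_le hr]
        omega
      have hi4 : i + 1 ≤ N := by
        by_contra hcon
        have : N * r ≤ i * r := Nat.mul_le_mul_right r (by omega)
        omega
      have hR : χ.bind (M.L (record y 0 k)) Set.univ
          * ex (∑ l ∈ Finset.Ico k (s + (i + 1) * r), w (y l))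
          ≤ ex (massConst a A c δ A₁ + 2 * A₁ + 2 * ℓ + 3 * δ * (N - i : ℝ))
            * χ.bind (M.L (record y 0 (s + (i + 1 + j) * r))) D := by
        refine le_trans ?_ (H.ex_mul_flow_univ_le hi3 hi4)
        rw [M.bind_L_record_comp χ y (Nat.zero_le _) hi1.le, hv,
          ← Finset.sum_Ico_consecutive _ hi1.le hi2, ex_add]
        calc _ ≤ ex (∑ l ∈ Finset.Ico (s + i * r) k, w (y l))
              * χ.bind (M.L (record y 0 (s + i * r))) Set.univ
              * ex (∑ l ∈ Finset.Ico k (s + (i + 1) * r), w (y l)) := by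
              gcongr
              exact bind_univ_le (M.L_record_univ_le hw _ _)
          _ = _ := by ring
      refine (M.variance_term_le_of_control hw H ha hρ haρ ht hℓt hδc hδρ hh hB hhB
        (hi3.trans (Nat.le_succ i)) hi4 hi2 (M.L_record_univ_le hw k _) hR).trans ?_
      have hnk : ((n - k : ℕ) : ℝ) ≤ (N - i : ℝ) * r := by
        rw [Nat.cast_sub (by omega), hn]
        push_cast
        have : (s : ℝ) + i * r < k := by exact_mod_cast hi1
        linarith
      -- Decay `9 δ (N - (i + 1))` against growth `3 δ (N - i)` leaves `6 δ (N - i)` up to the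
      -- constant `9 δ`. Squaring doubles the rate, and a block contains `r` times, hence `12 * δ /
      -- r` in `q`.
      have hqk : q ^ (n - k) = Real.exp (-(6 * δ * (((n - k : ℕ) : ℝ) / r))) ^ 2 := by
        rw [hq, ← Real.exp_nat_mul, ← Real.exp_nat_mul]
        congr 1
        push_cast
        ring
      rw [hqk, ← mul_pow, mul_assoc (2 * B), ← Real.exp_add]
      have h6 : 6 * δ * (((n - k : ℕ) : ℝ) / r) ≤ 6 * δ * (N - i : ℝ) := by
        gcongr
        rwa [div_le_iff₀ hr0]
      refine pow_le_pow_left₀ (by positivity) (mul_le_mul_of_nonneg_left ?_ (by positivity)) 2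
      refine Real.exp_le_exp.2 ?_
      push_cast
      linarith
  rw [asympVar]
  refine (Finset.sum_le_sum hterm).trans ?_
  rw [← Finset.mul_sum, Finset.sum_add_distrib]
  gcongr
  · rw [Finset.sum_ite_mem, Finset.sum_const, nsmul_eq_mul, mul_one]
    exact_mod_cast (Finset.card_le_card Finset.inter_subset_right).trans_eq (Finset.card_range _)
  · exact sum_pow_sub_le (Real.exp_pos _).le hq1 n

end HMM

/-! ### Logarithmic moments -/

theorem le_ex_of_lnPlus_eq {x : ℝ≥0∞} {t : ℝ} (ht : 0 ≤ t) (h : lnPlus x = ENNReal.ofReal t) :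
    x ≤ ex t := by
  have h1 : ENNReal.log x ≤ (t : EReal) := by
    have h2 : ((ENNReal.log x).toENNReal : EReal) = max 0 (ENNReal.log x) :=
      EReal.coe_toENNReal_eq_max
    rw [show (ENNReal.log x).toENNReal = ENNReal.ofReal t from h, EReal.coe_ennreal_ofReal,
      max_eq_left ht] at h2
    rw [h2]
    exact le_max_right _ _
  rwa [← EReal.log_exp (t : EReal), ENNReal.log_le_log_iff, EReal.exp_coe] at h1

theorem ex_neg_le_of_lnMinus_eq {x : ℝ≥0∞} {t : ℝ} (ht : 0 ≤ t)
    (h : lnMinus x = ENNReal.ofReal t) : ex (-t) ≤ x := by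
  have h1 : lnPlus x⁻¹ = ENNReal.ofReal t := by rw [lnPlus, ENNReal.log_inv]; exact h
  have h2 := le_ex_of_lnPlus_eq ht h1
  have h3 := (ex_mul_le_iff (t := -t) (x := x⁻¹) (y := 1)).2 (by simpa using h2)
  have h4 : ex (-t) * x⁻¹ ≤ 1 := h3
  rwa [← div_eq_mul_inv, ENNReal.div_le_iff_le_mul (Or.inr ENNReal.one_ne_top)
    (Or.inr one_ne_zero), one_mul] at h4

/-- A version that is real, nonnegative and measurable everywhere; agreement with `f` is needed only
almost surely. -/
theorem FiniteExpectation.exists_integrable {S : Type*} [MeasurableSpace S] {μ : Measure S}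
    {f : S → ℝ≥0∞} (hf : FiniteExpectation μ f) :
    ∃ w : S → ℝ, Measurable w ∧ (∀ s, 0 ≤ w s) ∧ Integrable w μ ∧
      ∀ᵐ s ∂μ, f s = ENNReal.ofReal (w s) := by
  obtain ⟨hm, hfin⟩ := hf
  have hfin' : ∫⁻ s, hm.mk f s ∂μ ≠ ∞ := by
    rw [← lintegral_congr_ae hm.ae_eq_mk]
    exact hfin.ne
  refine ⟨fun s => (hm.mk f s).toReal, hm.measurable_mk.ennreal_toReal,
    fun s => ENNReal.toReal_nonneg, integrable_toReal_of_lintegral_ne_top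
      hm.measurable_mk.aemeasurable hfin', ?_⟩
  filter_upwards [hm.ae_eq_mk, ae_lt_top hm.measurable_mk hfin'] with s h1 h2
  rw [ENNReal.ofReal_toReal h2.ne, h1]

/-! ### Shifts on the path space -/

/-- The path `y` seen from the time `p` on. -/
def shiftBy {Y : Type*} (p : ℕ) (y : ℕ → Y) : ℕ → Y := fun n => y (p + n)

section Shift

variable {Y : Type*}

theorem shiftBy_shiftBy (p q : ℕ) (y : ℕ → Y) : shiftBy p (shiftBy q y) = shiftBy (q + p) y := by
  funext n
  simp [shiftBy, add_assoc]

theorem shiftBy_zero (y : ℕ → Y) : shiftBy 0 y = y := by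
  funext n
  simp [shiftBy]

theorem iterate_shiftBy (r k : ℕ) : (shiftBy r)^[k] = (shiftBy (k * r) : (ℕ → Y) → ℕ → Y) := by
  induction k with
  | zero => funext y; simp [shiftBy_zero]
  | succ k ih =>
    funext y
    rw [Function.iterate_succ_apply', ih, shiftBy_shiftBy, add_one_mul]

theorem record_shiftBy (p k n : ℕ) (y : ℕ → Y) :
    record (shiftBy p y) k n = record y (p + k) (p + n) := (record_add y p k n).symm

variable [MeasurableSpace Y]

theorem measurable_shiftBy (p : ℕ) : Measurable (shiftBy p : (ℕ → Y) → ℕ → Y) :=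
  measurable_pi_lambda _ fun n => measurable_pi_apply (p + n)

theorem measurePreserving_shiftBy {ν : Measure (ℕ → Y)} (h : MeasurePreserving (shiftBy 1) ν ν)
    (p : ℕ) : MeasurePreserving (shiftBy p) ν ν := by
  have := h.iterate p
  rwa [iterate_shiftBy, mul_one] at this

end Shift

/-! ### The path space of the observations -/

/-- The observation model on the path space: `ν` is the law of the observations, `w` bounds the
logarithm of the likelihood, `β` bounds the logarithm of the mass kept in `D` over a block. -/
structure PathModel {X Y : Type*} [MeasurableSpace X] [MeasurableSpace Y] (M : HMM X Y)
    (ν : Measure (ℕ → Y)) (r : ℕ) (K : Set (Fin r → Y)) (D : Set X) (χ : Measure X) (w : Y → ℝ)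
    (β : (Fin r → Y) → ℝ) : Prop where
  shift : MeasurePreserving (shiftBy 1) ν ν
  ergodic : Ergodic (shiftBy r) ν
  r_pos : 0 < r
  measurableSet_K : MeasurableSet K
  prob_K : 2 / 3 < ν {y | (fun e : Fin r => y e) ∈ K}
  doeblin : ∀ η : ℝ≥0, 0 < η → ∃ (C : Set X) (εm εp : (Fin r → Y) → ℝ)
    (lam : (Fin r → Y) → Measure X) (φ : (Fin r → Y) → X → ℝ),
    M.LocalDoeblinWith r C εm εp lam φ ∧
    (∀ z ∈ K,
      (⨆ x ∈ Cᶜ, M.L (List.ofFn z) x Set.univ) ≤ η * (⨆ x, M.L (List.ofFn z) x Set.univ)) ∧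
    ∃ c : ℝ, 0 < c ∧ ∀ z ∈ K, c ≤ εm z / εp z
  measurableSet_D : MeasurableSet D
  measurable_w : Measurable w
  w_nonneg : ∀ y, 0 ≤ w y
  integrable_w : Integrable (fun y : ℕ → Y => w (y 0)) ν
  w_bound : ∀ᵐ y ∂ν, ∀ i x, ENNReal.ofReal (M.g x (y i)) ≤ ex (w (y i))
  measurable_β : Measurable β
  β_nonneg : ∀ z, 0 ≤ β z
  integrable_β : Integrable (fun y : ℕ → Y => β fun e => y e) ν
  β_bound : ∀ᵐ y ∂ν, ∀ p, ∀ x ∈ D,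
    ex (-β fun e => y (p + e)) ≤ M.L (record y p (p + r)) x D
  g_pos : ∀ x y, 0 < M.g x y
  initial : ∀ᵐ y ∂ν, ∀ s < r, χ.bind (M.L (record y 0 s)) D ≠ 0

/-- Concatenation of blocks is a factor map from the block shift onto the shift by `r`, and
ergodicity passes to factors. -/
theorem ergodic_shiftBy_of_blocks {Y Ω : Type*} [MeasurableSpace Y] [MeasurableSpace Ω]
    {P : Measure Ω} {U : ℕ → Ω → Y} (hU : ∀ n, Measurable (U n)) {r : ℕ} (hr : 0 < r)
    (h : IsStationaryErgodic P (blocks r U)) :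
    Ergodic (shiftBy r) (P.map fun ω n => U n ω) := by
  let unblock : (ℕ → Fin r → Y) → ℕ → Y := fun z n => z (n / r) ⟨n % r, Nat.mod_lt n hr⟩
  have hm : Measurable unblock := measurable_pi_lambda _ fun n =>
    (measurable_pi_apply _).comp (measurable_pi_apply _)
  have hb : Measurable fun ω n => blocks r U n ω := measurable_pi_lambda _ fun n =>
    measurable_pi_lambda _ fun e => hU _
  have hmap : (P.map fun ω n => blocks r U n ω).map unblock = P.map fun ω n => U n ω := by
    rw [Measure.map_map hm hb]
    congr 1
    funext ω n
    simp only [Function.comp, unblock, blocks]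
    rw [Nat.div_add_mod']
  refine MeasurePreserving.ergodic_of_ergodic_semiconj ⟨hm, hmap⟩ h (measurable_shiftBy r) ?_
  intro z
  funext n
  simp only [unblock, shiftBy]
  congr 1
  · exact (Nat.add_div_left n hr).symm
  · simp

/-- Invariance under the one-step shift spreads the almost sure bounds at time `0` to every time,
not only to block times. From the moments of `χ` only the positivity of the masses of `D` is
retained. -/
theorem HMM.exists_pathModel {X Y Ω : Type*} [MeasurableSpace X] [MeasurableSpace Y]
    [MeasurableSpace Ω] (M : HMM X Y) {P : Measure Ω}
    {U : ℕ → Ω → Y} (hU : ∀ n, Measurable (U n)) {r : ℕ} {K : Set (Fin r → Y)} {D : Set X}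
    (hA1 : M.ObservationCondition P U r K D) (hA2 : M.LikelihoodCondition P U)
    {χ : Measure X} (hχ : χ ∈ M.initialLaws P U D r) :
    ∃ w β, PathModel M (P.map fun ω n => U n ω) r K D χ w β := by
  have hpath : Measurable fun ω n => U n ω := measurable_pi_lambda _ hU
  set ν := P.map fun ω n => U n ω with hν
  have hshift : MeasurePreserving (shiftBy 1) ν ν := by
    have h := hA1.stationary_ergodic.toMeasurePreserving
    have e : (shiftBy 1 : (ℕ → Y) → ℕ → Y) = fun s n => s (n + 1) := by
      funext s n
      simp [shiftBy, add_comm]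
    rw [e]
    exact h
  obtain ⟨w, hwm, hw0, hwi, hwe⟩ := hA2.moment.exists_integrable
  obtain ⟨β, hβm, hβ0, hβi, hβe⟩ := hA1.minoration.exists_integrable
  have h0 : P.map (U 0) = ν.map fun y => y 0 := by
    rw [hν, Measure.map_map (measurable_pi_apply 0) hpath]
    rfl
  have hblk : Measurable fun (y : ℕ → Y) (e : Fin r) => y e :=
    measurable_pi_lambda _ fun e => measurable_pi_apply _
  have hb : P.map (blocks r U 0) = ν.map fun (y : ℕ → Y) (e : Fin r) => y e := by
    rw [hν, Measure.map_map hblk hpath]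
    congr 1
    funext ω e
    simp [blocks]
  rw [h0] at hwi hwe
  rw [hb] at hβi hβe
  refine ⟨w, β, hshift, ergodic_shiftBy_of_blocks hU hA1.r_pos hA1.blocks_ergodic, hA1.r_pos,
    hA1.measurableSet_K, ?_, fun η hη => ?_, hA1.measurableSet_D, hwm, hw0,
    hwi.comp_measurable (measurable_pi_apply 0), ?_, hβm, hβ0, hβi.comp_measurable hblk, ?_,
    hA2.g_pos, ?_⟩
  · have := hA1.prob_K
    have e : ν {y | (fun e : Fin r => y e) ∈ K} = P {ω | blocks r U 0 ω ∈ K} := by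
      refine (Measure.map_apply hpath (hblk hA1.measurableSet_K)).trans ?_
      have e0 : ∀ ω, blocks r U 0 ω = fun e : Fin r => U e ω := fun ω => by
        funext e
        simp [blocks]
      simp only [e0]
      rfl
    rwa [e]
  · obtain ⟨C, εm, εp, lam, φ, h1, h2, h3⟩ := hA1.doeblin η hη
    exact ⟨C, εm, εp, lam, φ, h1, fun z hz => (h2 z hz).1, h3⟩
  · have h := ae_of_ae_map (measurable_pi_apply 0).aemeasurable hwe
    rw [ae_all_iff]
    intro i
    have h2 := (measurePreserving_shiftBy hshift i).quasiMeasurePreserving.ae h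
    filter_upwards [h2] with y hy x
    refine (le_iSup (fun x => ENNReal.ofReal (M.g x (y i))) x).trans ?_
    exact le_ex_of_lnPlus_eq (hw0 _) (by simpa [shiftBy] using hy)
  · have h := ae_of_ae_map hblk.aemeasurable hβe
    rw [ae_all_iff]
    intro p
    have h2 := (measurePreserving_shiftBy hshift p).quasiMeasurePreserving.ae h
    filter_upwards [h2] with y hy x hx
    rw [record_eq_ofFn]
    exact (ex_neg_le_of_lnMinus_eq (hβ0 _) hy).trans (iInf₂_le x hx)
  · rw [ae_all_iff]
    intro s
    by_cases hs : s < r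
    · have := hχ.1
      have hm := M.measurable_bind_L_record_apply χ (u := fun i (y : ℕ → Y) => y i)
        (fun i => measurable_pi_apply i) 0 s hA1.measurableSet_D
      have hms : MeasurableSet {y : ℕ → Y | χ.bind (M.L (record y 0 s)) D ≠ 0} :=
        (measurableSet_eq_fun hm measurable_const).compl
      have h := (ae_map_iff hpath.aemeasurable hms (μ := P)).2 (by
        obtain ⟨w', -, hw', -, he⟩ := (hχ.2 s hs.le).exists_integrable
        filter_upwards [he] with ω hω
        exact ((ex_pos _).trans_le (ex_neg_le_of_lnMinus_eq (hw' ω) hω)).ne')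
      filter_upwards [h] with y hy _ using hy
    · exact Filter.Eventually.of_forall fun y h => absurd h hs

/-! ### Block decomposition of a path -/

section Blocks

variable {Y : Type*} {r : ℕ}

theorem sum_Ico_add_left (f : ℕ → ℝ) (p i k : ℕ) :
    ∑ l ∈ Finset.Ico i k, f (p + l) = ∑ l ∈ Finset.Ico (p + i) (p + k), f l := by
  rw [Finset.sum_Ico_add, add_comm i, add_comm k]

/-- The sum of `w` over the `i`-th block of the path `y`. -/
def blockSum (w : Y → ℝ) (r : ℕ) (y : ℕ → Y) (i : ℕ) : ℝ :=
  ∑ l ∈ Finset.Ico (i * r) ((i + 1) * r), w (y l)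

/-- The `i`-th block of length `r` of the path `y`. -/
def pathBlock (r : ℕ) (y : ℕ → Y) (i : ℕ) : Fin r → Y := fun e => y (i * r + e)

theorem blockSum_shiftBy (w : Y → ℝ) (r p : ℕ) (y : ℕ → Y) (i : ℕ) :
    blockSum w r (shiftBy (p * r) y) i = blockSum w r y (p + i) := by
  rw [blockSum, blockSum, add_mul p i, show (p + i + 1) * r = p * r + (i + 1) * r by ring,
    ← sum_Ico_add_left]
  rfl

theorem pathBlock_shiftBy (r p : ℕ) (y : ℕ → Y) (i : ℕ) :
    pathBlock r (shiftBy (p * r) y) i = pathBlock r y (p + i) := by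
  funext e
  rw [pathBlock, pathBlock, shiftBy]
  congr 1
  ring

theorem record_block (y : ℕ → Y) (i : ℕ) :
    record y (i * r) ((i + 1) * r) = List.ofFn (pathBlock r y i) := by
  rw [add_one_mul, record_eq_ofFn]
  rfl

variable [MeasurableSpace Y]

theorem measurable_blockSum {w : Y → ℝ} (hw : Measurable w) (r i : ℕ) :
    Measurable fun y : ℕ → Y => blockSum w r y i :=
  Finset.measurable_fun_sum _ fun l _ => hw.comp (measurable_pi_apply l)

theorem measurable_pathBlock (r i : ℕ) : Measurable fun y : ℕ → Y => pathBlock r y i :=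
  measurable_pi_lambda _ fun _ => measurable_pi_apply _

end Blocks

namespace BlockChain

variable {X : Type*} [MeasurableSpace X] {Λ : ℕ → ℕ → Kernel X X} {C D : Set X} {v b : ℕ → ℝ}
  {ℓ A : ℝ} {S : ℕ → Prop} {x₀ : X} {j m : ℕ}

/-- The conditions look back at most `m + j` blocks. From that index on no subtraction is truncated
and `late` holds on both sides, so goodness commutes with shifts. -/
theorem goodAt_add_iff (p : ℕ) {k : ℕ} (hk : m + j ≤ k) :
    GoodAt (fun i k => Λ (p + i) (p + k)) C D (fun i => v (p + i)) (fun i => b (p + i)) ℓ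
      (fun i => S (p + i)) x₀ j m A k ↔ GoodAt Λ C D v b ℓ S x₀ j m A (p + k) := by
  have e1 : p + (k + 1 + j) = p + k + 1 + j := by ring
  have e2 : p + (k - m) = p + k - m := by omega
  have e3 : p + (k - (m + j)) = p + k - (m + j) := by omega
  have e4 : p + (k + j + 1) = p + k + j + 1 := by ring
  have w1 : ∑ l ∈ Finset.Ico (k - m) k, (v (p + l) + b (p + l) + drift (fun i => S (p + i)) ℓ l)
      = ∑ l ∈ Finset.Ico (p + k - m) (p + k), (v l + b l + drift S ℓ l) := by
    rw [← e2, ← sum_Ico_add_left]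
    rfl
  have w2 : ∑ l ∈ Finset.Ico (k - (m + j)) (k + j + 1), v (p + l)
      = ∑ l ∈ Finset.Ico (p + k - (m + j)) (p + k + j + 1), v l := by
    rw [sum_Ico_add_left v, e3, e4]
  have w3 : ∑ l ∈ Finset.Ico (k - m) k, b (p + l) = ∑ l ∈ Finset.Ico (p + k - m) (p + k), b l := by
    rw [sum_Ico_add_left b, e2]
  constructor
  · intro h
    refine ⟨h.sel, by omega, ?_, ?_, w1 ▸ h.window, w2 ▸ h.v_le, w3 ▸ h.b_le⟩
    · have := h.reach
      rwa [e1] at this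
    · intro l hl
      rw [Finset.mem_Ico] at hl
      obtain ⟨l, rfl⟩ := Nat.exists_eq_add_of_le (show p ≤ l by omega)
      exact h.stay l (Finset.mem_Ico.2 (by omega))
  · intro h
    refine ⟨h.sel, hk, ?_, ?_, w1 ▸ h.window, w2 ▸ h.v_le, w3 ▸ h.b_le⟩
    · have := h.reach
      rwa [← e1] at this
    · intro l hl
      rw [Finset.mem_Ico] at hl
      exact h.stay (p + l) (Finset.mem_Ico.2 (by omega))

end BlockChain

/-! ### Positivity of the masses that return to `C` and reach `D` -/

namespace HMM

open BlockChain

variable {X Y : Type*} [MeasurableSpace X] [MeasurableSpace Y] (M : HMM X Y) {r : ℕ}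

/-- The kernels of the model between the block times. -/
noncomputable def blockL (r : ℕ) (y : ℕ → Y) (i k : ℕ) : Kernel X X :=
  M.L (record y (i * r) (k * r))

theorem blockL_shiftBy (r p : ℕ) (y : ℕ → Y) (i k : ℕ) :
    M.blockL r (shiftBy (p * r) y) i k = M.blockL r y (p + i) (p + k) := by
  rw [blockL, blockL, record_shiftBy, add_mul, add_mul]

theorem blockL_succ (y : ℕ → Y) (i : ℕ) :
    M.blockL r y i (i + 1) = M.L (List.ofFn (pathBlock r y i)) := by
  rw [blockL, record_block]

/-- A set `C` that is local Doeblin for the blocks in `K`, off which the mass of these blocks is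
small, and in which one can stay over any block. -/
structure IsDoeblinSet (M : HMM X Y) (r : ℕ) (K : Set (Fin r → Y)) (C : Set X) (ℓ a : ℝ) :
    Prop where
  measurableSet : MeasurableSet C
  out : ∀ z ∈ K, ∀ V : ℝ, (∀ x, M.L (List.ofFn z) x Set.univ ≤ ex V) → ∀ x ∉ C,
    M.L (List.ofFn z) x Set.univ ≤ ex (V - 2 * ℓ)
  doeblin : ∀ z ∈ K, ∃ lam, IsLocalDoeblin (M.L (List.ofFn z)) C (ex (-a)) lam
  pos : ∀ (z : Fin r → Y), ∀ x ∈ C, 0 < M.L (List.ofFn z) x C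

variable {M} {K : Set (Fin r → Y)} {C D : Set X} {ℓ a : ℝ}

/-- Staying in `C` at every block time already has positive mass, whatever the observations. -/
theorem IsDoeblinSet.blockL_pos (H : M.IsDoeblinSet r K C ℓ a) (y : ℕ → Y) {i k : ℕ}
    (hik : i ≤ k) {x : X} (hx : x ∈ C) : 0 < M.blockL r y i k x C := by
  induction k, hik using Nat.le_induction with
  | base =>
    rw [blockL, M.L_record_self, Kernel.id_apply, Measure.dirac_apply' _ H.measurableSet]
    simp [hx]
  | succ k hk ih =>
    have hm : Measurable fun u => M.blockL r y k (k + 1) u C :=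
      Kernel.measurable_coe _ H.measurableSet
    have hc : M.blockL r y i (k + 1) x C
        = ∫⁻ u, M.blockL r y k (k + 1) u C ∂(M.blockL r y i k x) := by
      rw [blockL, M.L_record_comp y (Nat.mul_le_mul_right r hk)
        (Nat.mul_le_mul_right r (Nat.le_succ k)), Kernel.comp_apply' _ _ _ H.measurableSet]
      rfl
    rw [hc]
    refine lt_of_lt_of_le ?_ (setLIntegral_le_lintegral C _)
    rw [setLIntegral_pos_iff hm]
    refine ih.trans_le (measure_mono fun u hu => ⟨?_, hu⟩)
    have := H.pos (pathBlock r y k) u hu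
    rw [← blockL_succ] at this
    exact this.ne'

theorem IsDoeblinSet.stay_pos (H : M.IsDoeblinSet r K C ℓ a) (y : ℕ → Y) {l k : ℕ}
    (hlk : l < k) {x : X} (hx : x ∈ C) :
    0 < ∫⁻ u in C, ∫⁻ w in C, M.blockL r y k (k + 1) w C ∂(M.blockL r y (l + 1) k u)
      ∂(M.blockL r y l (l + 1) x) := by
  have hm : Measurable fun u => M.blockL r y k (k + 1) u C :=
    Kernel.measurable_coe _ H.measurableSet
  rw [setLIntegral_pos_iff (measurable_setLIntegral H.measurableSet hm)]
  refine (H.blockL_pos y (Nat.le_succ l) hx).trans_le (measure_mono fun u hu => ⟨?_, hu⟩)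
  refine ne_of_gt ?_
  rw [setLIntegral_pos_iff hm]
  exact (H.blockL_pos y hlk hu).trans_le
    (measure_mono fun w hw => ⟨(H.blockL_pos y (Nat.le_succ k) hw).ne', hw⟩)

/-- With a positive likelihood, null sets depend only on the length of the record. Reaching `D`
along one record therefore implies reaching it along every record of the same length. -/
theorem reach_pos_of_pos (hg : ∀ x y, 0 < M.g x y) (hC : MeasurableSet C) (hD : MeasurableSet D)
    {x : X} {j k k' : ℕ} {y y' : ℕ → Y}
    (h : 0 < ∫⁻ u in C, M.blockL r y (k + 1) (k + 1 + j) u D ∂(M.blockL r y k (k + 1) x)) :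
    0 < ∫⁻ u in C, M.blockL r y' (k' + 1) (k' + 1 + j) u D ∂(M.blockL r y' k' (k' + 1) x) := by
  have hm : ∀ y k, Measurable fun u => M.blockL r y (k + 1) (k + 1 + j) u D := fun y k =>
    Kernel.measurable_coe _ hD
  have hlen : ∀ (y y' : ℕ → Y) (k k' d : ℕ),
      (record y (k * r) ((k + d) * r)).length = (record y' (k' * r) ((k' + d) * r)).length := by
    intro y y' k k' d
    rw [record_length, record_length, add_mul, add_mul, Nat.add_sub_cancel_left,
      Nat.add_sub_cancel_left]
  rw [setLIntegral_pos_iff (hm _ _)] at h ⊢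
  have hsup : (Function.support fun u => M.blockL r y (k + 1) (k + 1 + j) u D)
      = Function.support fun u => M.blockL r y' (k' + 1) (k' + 1 + j) u D := by
    ext u
    exact not_congr ⟨M.L_apply_eq_zero hg (hlen _ _ _ _ _) hD, M.L_apply_eq_zero hg (hlen _ _ _ _ _) hD⟩
  rw [pos_iff_ne_zero] at h ⊢
  rw [← hsup]
  exact fun h0 => h (M.L_apply_eq_zero hg (hlen _ _ _ _ _)
    ((measurableSet_support (hm _ _)).inter hC) h0)

end HMM

/-! ### Almost sure block chains and the Doeblin set -/

namespace PathModel

open HMM BlockChain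

variable {X Y : Type*} [MeasurableSpace X] [MeasurableSpace Y] {M : HMM X Y}
  {ν : Measure (ℕ → Y)} {r : ℕ} {K : Set (Fin r → Y)} {D : Set X} {χ : Measure X} {w : Y → ℝ}
  {β : (Fin r → Y) → ℝ} {C : Set X} {ℓ a : ℝ}

/-- The set comes from `η = exp (-2 ℓ)`, and `a` from the infimum of the Doeblin ratios, raised to
at least `1` for positivity. The block `z` only serves to show that `C` is nonempty. -/
theorem exists_isDoeblinSet (H : PathModel M ν r K D χ w β) (ℓ : ℝ) (z : Fin r → Y) :
    ∃ (C : Set X) (a : ℝ), 0 < a ∧ C.Nonempty ∧ M.IsDoeblinSet r K C ℓ a := by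
  obtain ⟨C, εm, εp, lam, φ, h1, h2, c, hc, h3⟩ :=
    H.doeblin (Real.exp (-(2 * ℓ))).toNNReal (Real.toNNReal_pos.2 (Real.exp_pos _))
  refine ⟨C, max 1 (-Real.log c), lt_max_of_lt_left one_pos, h1.nonempty z, h1.measurableSet, ?_,
    fun z hz => ⟨lam z, h1.isLocalDoeblin (le_trans ?_ (h3 z hz))⟩, fun z x hx => h1.apply_pos z hx⟩
  · intro z hz V hV x hx
    calc M.L (List.ofFn z) x Set.univ ≤ ⨆ x ∈ Cᶜ, M.L (List.ofFn z) x Set.univ :=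
          le_iSup₂ (f := fun x (_ : x ∈ Cᶜ) => M.L (List.ofFn z) x Set.univ) x hx
      _ ≤ ex (-(2 * ℓ)) * (⨆ x, M.L (List.ofFn z) x Set.univ) := h2 z hz
      _ ≤ ex (-(2 * ℓ)) * ex V := by gcongr; exact iSup_le hV
      _ = _ := by rw [← ex_add]; congr 1; ring
  · calc Real.exp (-max 1 (-Real.log c)) ≤ Real.exp (Real.log c) :=
          Real.exp_le_exp.2 (by linarith [le_max_right 1 (-Real.log c)])
      _ = c := Real.exp_log hc

/-- Almost every path, seen from any time, gives a block chain. -/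
theorem ae_blockChain (H : PathModel M ν r K D χ w β) (hC : M.IsDoeblinSet r K C ℓ a)
    (hℓ : 0 ≤ ℓ) :
    ∀ᵐ y ∂ν, ∀ s, BlockChain (M.blockL r (shiftBy s y)) C D (blockSum w r (shiftBy s y))
      (fun i => β (pathBlock r (shiftBy s y) i)) ℓ a (fun i => pathBlock r (shiftBy s y) i ∈ K) := by
  filter_upwards [H.w_bound, H.β_bound] with y hw hβ s
  have hup : ∀ k x, M.blockL r (shiftBy s y) k (k + 1) x Set.univ
      ≤ ex (blockSum w r (shiftBy s y) k) := fun k x =>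
    M.L_record_univ_le (y := shiftBy s y) (fun i x => hw (s + i) x) _ _ x
  refine ⟨hC.measurableSet, H.measurableSet_D, fun k => M.L_record_self _ _,
    fun hij hjk => M.L_record_comp _ (Nat.mul_le_mul_right r hij) (Nat.mul_le_mul_right r hjk), hℓ,
    fun k => Finset.sum_nonneg fun l _ => H.w_nonneg _, fun k => H.β_nonneg _, hup,
    fun k x hx => ?_, fun k hk x hx => ?_, fun k hk => ?_⟩
  · have := hβ (s + k * r) x hx
    rw [blockL, record_shiftBy, add_one_mul, ← add_assoc]
    convert this using 4
    funext e
    simp [pathBlock, shiftBy, add_assoc]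
  · have := hup k
    rw [blockL_succ] at this ⊢
    exact hC.out _ hk _ this x hx
  · rw [blockL_succ]
    exact hC.doeblin _ hk

/-- The set `D` is reached from `C`, at a fixed time and with a positive mass. -/
theorem exists_reach_pos (H : PathModel M ν r K D χ w β) (hC : M.IsDoeblinSet r K C ℓ a)
    {x₀ : X} (hx₀ : x₀ ∈ C) {y : ℕ → Y} {v b : ℕ → ℝ}
    (hy : BlockChain (M.blockL r y) C D v b ℓ a (fun i => pathBlock r y i ∈ K)) {m : ℕ}
    (hm : ∑ l ∈ Finset.Ico 0 m, (v l + b l + drift (fun i => pathBlock r y i ∈ K) ℓ l)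
      + ℓ + Real.log 2 ≤ 0) {x : X} (hx : x ∈ D) :
    ∃ j, ∀ (y' : ℕ → Y) (k : ℕ),
      0 < ∫⁻ u in C, M.blockL r y' (k + 1) (k + 1 + j) u D ∂(M.blockL r y' k (k + 1) x₀) := by
  have h1 := (ex_pos _).trans_le (hy.ex_le_sum_through (Nat.zero_le m) hm hx)
  obtain ⟨l, hl, hl0⟩ := Finset.exists_ne_zero_of_sum_ne_zero h1.ne'
  rw [Finset.mem_Ico] at hl
  unfold through at hl0
  split_ifs at hl0 with hS
  · obtain ⟨lam, hlam⟩ := hy.doeblin l hS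
    set f : X → ℝ≥0∞ := fun u => M.blockL r y (l + 1) m u D with hf
    -- Some point of `C` sees `D` through `C`; by the upper Doeblin bound so does the minorizing
    -- measure, and by the lower bound so does `x₀`.
    have hex : ∃ w ∈ C, ∫⁻ u in C, f u ∂(M.blockL r y l (l + 1) w) ≠ 0 := by
      by_contra! hcon
      refine hl0 ?_
      rw [setLIntegral_congr_fun hC.measurableSet hcon]
      simp
    obtain ⟨w, hwC, hw⟩ := hex
    have hlam0 : ∫⁻ u, f u ∂lam ≠ 0 := by
      intro h0
      have := hlam.lintegral_upper hwC f
      rw [h0, mul_zero, nonpos_iff_eq_zero, mul_eq_zero] at this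
      exact this.elim (ex_ne_zero _) hw
    have hpos : 0 < ∫⁻ u in C, f u ∂(M.blockL r y l (l + 1) x₀) := by
      refine lt_of_lt_of_le ?_ (hlam.lintegral_lower hx₀ f)
      exact pos_iff_ne_zero.2 (mul_ne_zero (mul_ne_zero (ex_ne_zero _)
        (hC.blockL_pos y (Nat.le_succ l) hx₀).ne') hlam0)
    -- The blocks left between `l + 1` and `m`; this number then works for every path and index.
    refine ⟨m - (l + 1), fun y' k => reach_pos_of_pos H.g_pos hC.measurableSet H.measurableSet_D
      (y := y) (k := l) ?_⟩
    rwa [show l + 1 + (m - (l + 1)) = m by omega]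
  · exact absurd rfl hl0

end PathModel

theorem eventually_ex_neg_le {e : ℝ≥0∞} (he : 0 < e) :
    ∀ᶠ N : ℕ in Filter.atTop, ex (-(N : ℝ)) ≤ e := by
  have h : Filter.Tendsto (fun N : ℕ => ex (-(N : ℝ))) Filter.atTop (nhds 0) := by
    have := ENNReal.tendsto_ofReal
      (Real.tendsto_exp_neg_atTop_nhds_zero.comp tendsto_natCast_atTop_atTop)
    simpa [ex] using this
  exact h.eventually_le_const he

theorem integrable_ite_neg {Γ : Type*} [MeasurableSpace Γ] {ν : Measure Γ} [IsProbabilityMeasure ν]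
    {p : Γ → Prop} [DecidablePred p] (hp : MeasurableSet {y | p y}) (ℓ : ℝ) :
    Integrable (fun y => if p y then -ℓ else ℓ) ν ∧
      ∫ y, (if p y then -ℓ else ℓ) ∂ν = ℓ * (1 - 2 * ν.real {y | p y}) := by
  have e : (fun y => if p y then -ℓ else ℓ)
      = fun y => ℓ + {y | p y}.indicator (fun _ => -(2 * ℓ)) y := by
    funext y
    by_cases h : p y
    · rw [if_pos h, Set.indicator_of_mem (by exact h)]
      ring
    · rw [if_neg h, Set.indicator_of_notMem (by exact h)]
      ring
  have hi : Integrable ({y | p y}.indicator fun _ => -(2 * ℓ)) ν :=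
    (integrable_const _).indicator hp
  refine ⟨e ▸ (integrable_const ℓ).add hi, ?_⟩
  rw [e, integral_add (integrable_const ℓ) hi, integral_indicator_const _ hp]
  simp
  ring

/-! ### Good indices and slopes along a random path -/

section PathGood

open BlockChain HMM

variable {X Y : Type*} [MeasurableSpace X] [MeasurableSpace Y]

/-- Good block indices of a path of observations. -/
def PathGood (M : HMM X Y) {r : ℕ} (K : Set (Fin r → Y)) (C D : Set X) (w : Y → ℝ)
    (β : (Fin r → Y) → ℝ) (ℓ : ℝ) (x₀ : X) (j m : ℕ) (A : ℝ) (y : ℕ → Y) (k : ℕ) : Prop :=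
  GoodAt (M.blockL r y) C D (blockSum w r y) (fun i => β (pathBlock r y i)) ℓ
    (fun i => pathBlock r y i ∈ K) x₀ j m A k

/-- Slopes of a path of observations. -/
noncomputable def pathSlope (M : HMM X Y) {r : ℕ} (K : Set (Fin r → Y)) (C D : Set X) (w : Y → ℝ)
    (β : (Fin r → Y) → ℝ) (ℓ : ℝ) (x₀ : X) (j m : ℕ) (A : ℝ) (y : ℕ → Y) (k : ℕ) : ℝ :=
  slope (blockSum w r y) (fun i => β (pathBlock r y i)) j (PathGood M K C D w β ℓ x₀ j m A y) ℓ k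

variable {M : HMM X Y} {r : ℕ} {K : Set (Fin r → Y)} {C D : Set X} {w : Y → ℝ}
  {β : (Fin r → Y) → ℝ} {ℓ a A : ℝ} {x₀ : X} {j m : ℕ}

theorem pathGood_shiftBy (p : ℕ) (y : ℕ → Y) {k : ℕ} (hk : m + j ≤ k) :
    PathGood M K C D w β ℓ x₀ j m A (shiftBy (p * r) y) k
      ↔ PathGood M K C D w β ℓ x₀ j m A y (p + k) := by
  rw [PathGood, PathGood, ← goodAt_add_iff p hk]
  have h1 : M.blockL r (shiftBy (p * r) y) = fun i k => M.blockL r y (p + i) (p + k) := by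
    funext i k
    exact M.blockL_shiftBy r p y i k
  have h2 : blockSum w r (shiftBy (p * r) y) = fun i => blockSum w r y (p + i) :=
    funext fun i => blockSum_shiftBy w r p y i
  rw [h1, h2]
  simp only [pathBlock_shiftBy]

/-- Hence from index `m + j` on, the slopes are the values of one function along an orbit of
`shiftBy r`, and the ergodic estimates apply to them. -/
theorem pathSlope_shiftBy (p : ℕ) (y : ℕ → Y) {k : ℕ} (hk : m + j ≤ k) :
    pathSlope M K C D w β ℓ x₀ j m A (shiftBy (p * r) y) k
      = pathSlope M K C D w β ℓ x₀ j m A y (p + k) := by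
  have h3 : drift (PathGood M K C D w β ℓ x₀ j m A (shiftBy (p * r) y)) ℓ k
      = drift (PathGood M K C D w β ℓ x₀ j m A y) ℓ (p + k) := by
    by_cases h : PathGood M K C D w β ℓ x₀ j m A y (p + k)
    · rw [drift_pos h, drift_pos ((pathGood_shiftBy p y hk).2 h)]
    · rw [drift_neg h, drift_neg (mt (pathGood_shiftBy p y hk).1 h)]
  rw [pathSlope, pathSlope, BlockChain.slope, BlockChain.slope, blockSum_shiftBy, pathBlock_shiftBy, h3, ← add_assoc]

theorem PathGood.mono {A' : ℝ} (hA : A ≤ A') {y : ℕ → Y} {k : ℕ}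
    (h : PathGood M K C D w β ℓ x₀ j m A y k) : PathGood M K C D w β ℓ x₀ j m A' y k :=
  ⟨h.sel, h.late, (ex_mono (neg_le_neg hA)).trans h.reach,
    fun l hl => (ex_mono (neg_le_neg hA)).trans (h.stay l hl), h.window, h.v_le.trans hA,
    h.b_le.trans hA⟩

theorem measurable_setLIntegral_blockL (hC : MeasurableSet C) {F : (ℕ → Y) × X → ℝ≥0∞}
    (hF : Measurable F) (i k : ℕ) :
    Measurable fun q : (ℕ → Y) × X => ∫⁻ u in C, F (q.1, u) ∂(M.blockL r q.1 i k q.2) := by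
  have h := M.measurable_lintegral_L_record (u := fun i (y : ℕ → Y) => y i)
    (fun i => measurable_pi_apply i) (i * r) (k * r)
    (f := (Prod.snd ⁻¹' C).indicator F) (hF.indicator (measurable_snd hC))
  simp only [← lintegral_indicator hC]
  exact h

theorem measurable_blockL_apply (hD : MeasurableSet D) (i k : ℕ) :
    Measurable fun q : (ℕ → Y) × X => M.blockL r q.1 i k q.2 D :=
  M.measurable_L_record_apply (u := fun i (y : ℕ → Y) => y i) (fun i => measurable_pi_apply i)
    (i * r) (k * r) hD

theorem measurable_drift {S : ℕ → (ℕ → Y) → Prop} (hS : ∀ i, MeasurableSet {y | S i y}) (ℓ : ℝ)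
    (k : ℕ) : Measurable fun y => drift (fun i => S i y) ℓ k := by
  classical
  exact Measurable.ite (hS k) measurable_const measurable_const

theorem measurableSet_pathBlock (hK : MeasurableSet K) (i : ℕ) :
    MeasurableSet {y : ℕ → Y | pathBlock r y i ∈ K} := measurable_pathBlock r i hK

theorem measurableSet_pathGood (hK : MeasurableSet K) (hC : MeasurableSet C) (hD : MeasurableSet D)
    (hw : Measurable w) (hβ : Measurable β) (k : ℕ) :
    MeasurableSet {y : ℕ → Y | PathGood M K C D w β ℓ x₀ j m A y k} := by
  have hb : ∀ i, Measurable fun y : ℕ → Y => β (pathBlock r y i) := fun i =>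
    hβ.comp (measurable_pathBlock r i)
  have hx : Measurable fun y : ℕ → Y => (y, x₀) := measurable_id.prodMk measurable_const
  have h1 : Measurable fun y : ℕ → Y =>
      ∫⁻ u in C, M.blockL r y (k + 1) (k + 1 + j) u D ∂(M.blockL r y k (k + 1) x₀) :=
    (measurable_setLIntegral_blockL hC (measurable_blockL_apply hD (k + 1) (k + 1 + j))
      k (k + 1)).comp hx
  have h2 : ∀ l, Measurable fun y : ℕ → Y =>
      ∫⁻ u in C, ∫⁻ w in C, M.blockL r y k (k + 1) w C ∂(M.blockL r y (l + 1) k u)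
        ∂(M.blockL r y l (l + 1) x₀) := fun l =>
    (measurable_setLIntegral_blockL hC (measurable_setLIntegral_blockL hC
      (measurable_blockL_apply hC k (k + 1)) (l + 1) k) l (l + 1)).comp hx
  have h3 : Measurable fun y : ℕ → Y => ∑ l ∈ Finset.Ico (k - m) k, (blockSum w r y l
      + β (pathBlock r y l) + drift (fun i => pathBlock r y i ∈ K) ℓ l) + ℓ + Real.log 2 :=
    ((Finset.measurable_fun_sum _ fun l _ => ((measurable_blockSum hw r l).add (hb l)).add
      (measurable_drift (measurableSet_pathBlock hK) ℓ l)).add_const _).add_const _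
  have h4 : Measurable fun y : ℕ → Y =>
      ∑ l ∈ Finset.Ico (k - (m + j)) (k + j + 1), blockSum w r y l :=
    Finset.measurable_fun_sum _ fun l _ => measurable_blockSum hw r l
  have h5 : Measurable fun y : ℕ → Y => ∑ l ∈ Finset.Ico (k - m) k, β (pathBlock r y l) :=
    Finset.measurable_fun_sum _ fun l _ => hb l
  have hset : {y : ℕ → Y | PathGood M K C D w β ℓ x₀ j m A y k}
      = {y | pathBlock r y k ∈ K} ∩ ({_y | m + j ≤ k} ∩
        ({y | ex (-A) ≤ ∫⁻ u in C, M.blockL r y (k + 1) (k + 1 + j) u D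
            ∂(M.blockL r y k (k + 1) x₀)} ∩
        ((⋂ l ∈ Finset.Ico (k - m) k, {y | ex (-A) ≤ ∫⁻ u in C, ∫⁻ w in C,
          M.blockL r y k (k + 1) w C ∂(M.blockL r y (l + 1) k u) ∂(M.blockL r y l (l + 1) x₀)}) ∩
        ({y | ∑ l ∈ Finset.Ico (k - m) k, (blockSum w r y l
          + β (pathBlock r y l) + drift (fun i => pathBlock r y i ∈ K) ℓ l) + ℓ + Real.log 2 ≤ 0} ∩
        ({y | ∑ l ∈ Finset.Ico (k - (m + j)) (k + j + 1), blockSum w r y l ≤ A} ∩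
        {y | ∑ l ∈ Finset.Ico (k - m) k, β (pathBlock r y l) ≤ A}))))) := by
    ext y
    simp only [Set.mem_inter_iff, Set.mem_iInter, Set.mem_ofPred_eq]
    exact ⟨fun h => ⟨h.sel, h.late, h.reach, h.stay, h.window, h.v_le, h.b_le⟩,
      fun ⟨a1, a2, a3, a4, a5, a6, a7⟩ => ⟨a1, a2, a3, a4, a5, a6, a7⟩⟩
  rw [hset]
  exact (measurableSet_pathBlock hK k).inter ((MeasurableSet.const _).inter
    ((measurableSet_le measurable_const h1).inter
    ((Finset.measurableSet_biInter _ fun l _ => measurableSet_le measurable_const (h2 l)).inter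
    ((measurableSet_le h3 measurable_const).inter ((measurableSet_le h4 measurable_const).inter
      (measurableSet_le h5 measurable_const))))))

end PathGood

/-! ### Choice of the parameters -/

namespace PathModel

open HMM BlockChain

variable {X Y : Type*} [MeasurableSpace X] [MeasurableSpace Y] {M : HMM X Y}
  {ν : Measure (ℕ → Y)} {r : ℕ} {K : Set (Fin r → Y)} {D : Set X}
  {χ : Measure X} {w : Y → ℝ} {β : (Fin r → Y) → ℝ} {C : Set X} {ℓ a A : ℝ} {x₀ : X} {j m : ℕ}

theorem integral_comp_shiftBy (H : PathModel M ν r K D χ w β) (p : ℕ) {f : (ℕ → Y) → ℝ}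
    (hf : Integrable f ν) :
    Integrable (fun y => f (shiftBy p y)) ν ∧ ∫ y, f (shiftBy p y) ∂ν = ∫ y, f y ∂ν := by
  have hp := measurePreserving_shiftBy H.shift p
  refine ⟨hp.integrable_comp_of_integrable hf, ?_⟩
  conv_rhs => rw [← hp.map_eq]
  rw [integral_map hp.measurable.aemeasurable (hp.map_eq.symm ▸ hf.aestronglyMeasurable)]

theorem integrable_blockSum (H : PathModel M ν r K D χ w β) (i : ℕ) :
    Integrable (fun y => blockSum w r y i) ν ∧
      ∫ y, blockSum w r y i ∂ν = ∫ y, blockSum w r y 0 ∂ν := by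
  have h0 : Integrable (fun y => blockSum w r y 0) ν := by
    refine integrable_finsetSum _ fun l _ => ?_
    simpa [shiftBy] using (H.integral_comp_shiftBy l H.integrable_w).1
  simpa [blockSum_shiftBy] using H.integral_comp_shiftBy (i * r) h0

theorem integrable_pathBlock (H : PathModel M ν r K D χ w β) (i : ℕ) :
    Integrable (fun y => β (pathBlock r y i)) ν ∧
      ∫ y, β (pathBlock r y i) ∂ν = ∫ y, β (pathBlock r y 0) ∂ν := by
  have h0 : Integrable (fun y => β (pathBlock r y 0)) ν := by
    refine H.integrable_β.congr (Filter.Eventually.of_forall fun y => ?_)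
    change (β fun e => y e) = β (pathBlock r y 0)
    congr 1
    funext e
    simp [pathBlock]
  simpa [pathBlock_shiftBy] using H.integral_comp_shiftBy (i * r) h0

theorem measure_pathBlock_mem (H : PathModel M ν r K D χ w β) (i : ℕ) :
    ν {y | pathBlock r y i ∈ K} = ν {y | (fun e : Fin r => y e) ∈ K} := by
  have hp := measurePreserving_shiftBy H.shift (i * r)
  have hm : MeasurableSet {y : ℕ → Y | (fun e : Fin r => y e) ∈ K} :=
    measurable_pi_lambda _ (fun e : Fin r => measurable_pi_apply (e : ℕ)) H.measurableSet_K
  exact hp.measure_preimage hm.nullMeasurableSet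

variable [IsProbabilityMeasure ν]

/-- The drift over a long window is negative with a probability close to `1`. -/
theorem exists_window (H : PathModel M ν r K D χ w β)
    (hℓ : ∫ y, blockSum w r y 0 ∂ν + ∫ y, β (pathBlock r y 0) ∂ν < ℓ / 3) (hℓ0 : 0 < ℓ) :
    ∃ m : ℕ, ν {y | ¬ ∑ l ∈ Finset.Ico 0 m, (blockSum w r y l + β (pathBlock r y l)
      + drift (fun i => pathBlock r y i ∈ K) ℓ l) + ℓ + Real.log 2 ≤ 0} ≤ ENNReal.ofReal (1 / 50) := by
  classical
  set f : (ℕ → Y) → ℝ := fun y => blockSum w r y 0 + β (pathBlock r y 0)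
    + drift (fun i => pathBlock r y i ∈ K) ℓ 0 with hf
  have hd := integrable_ite_neg (ν := ν) (measurableSet_pathBlock H.measurableSet_K 0) ℓ
  have hd' : (fun y => drift (fun i => pathBlock r y i ∈ K) ℓ 0)
      = fun y => if pathBlock r y 0 ∈ K then -ℓ else ℓ := by
    funext y
    rw [drift]
  have hfi : Integrable f ν := by
    refine ((H.integrable_blockSum 0).1.add (H.integrable_pathBlock 0).1).add ?_
    rw [hd']
    exact hd.1
  have hS : 2 / 3 < ν.real {y | pathBlock r y 0 ∈ K} := by
    have := H.prob_K
    rw [← H.measure_pathBlock_mem 0] at this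
    have h2 := (ENNReal.toReal_lt_toReal (by simp [ENNReal.div_eq_top]) (measure_ne_top _ _)).2 this
    simpa [Measure.real] using h2
  -- As `K` has probability above `2 / 3`, the mean drift is below `-ℓ / 3`, which beats the mean of
  -- `v + b`.
  have hinteg : ∫ y, f y ∂ν < 0 := by
    have e : ∫ y, f y ∂ν = ∫ y, blockSum w r y 0 ∂ν + ∫ y, β (pathBlock r y 0) ∂ν
        + ℓ * (1 - 2 * ν.real {y | pathBlock r y 0 ∈ K}) := by
      rw [← hd.2, ← hd', ← integral_add (H.integrable_blockSum 0).1 (H.integrable_pathBlock 0).1]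
      exact integral_add ((H.integrable_blockSum 0).1.add (H.integrable_pathBlock 0).1)
        (hd'.symm ▸ hd.1)
    rw [e]
    nlinarith
  obtain ⟨A, hA, hAn⟩ := exists_measure_backward_sum_le H.ergodic hfi
    (show (0 : ℝ) < 1 / 50 by norm_num) (show 0 < -(∫ y, f y ∂ν) / 2 by linarith)
  obtain ⟨m, hm⟩ := exists_nat_ge ((A + ℓ + Real.log 2) / (-(∫ y, f y ∂ν) / 2))
  rw [div_le_iff₀ (by linarith)] at hm
  refine ⟨m, (measure_mono fun y hy => ?_).trans (hAn m)⟩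
  simp only [Set.mem_ofPred_eq] at hy ⊢
  contrapose! hy
  have h0 := (abs_le.1 (hy 0 (Nat.zero_le m))).2
  have hsum : ∑ l ∈ Finset.Ico 0 m, f ((shiftBy r)^[l] y)
      = ∑ l ∈ Finset.Ico 0 m, (blockSum w r y l + β (pathBlock r y l)
      + drift (fun i => pathBlock r y i ∈ K) ℓ l) := by
    refine Finset.sum_congr rfl fun l _ => ?_
    rw [iterate_shiftBy, hf]
    simp only [blockSum_shiftBy, pathBlock_shiftBy, add_zero]
    congr 1
  rw [hsum] at h0
  simp only [Nat.cast_zero, sub_zero] at h0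
  linarith

/-- For a large constant, good indices have a frequency larger than `3 / 5`. -/
theorem exists_pathGood (H : PathModel M ν r K D χ w β) (hC : M.IsDoeblinSet r K C ℓ a)
    (hx₀ : x₀ ∈ C)
    (hm : ν {y | ¬ ∑ l ∈ Finset.Ico 0 m, (blockSum w r y l + β (pathBlock r y l)
      + drift (fun i => pathBlock r y i ∈ K) ℓ l) + ℓ + Real.log 2 ≤ 0} ≤ ENNReal.ofReal (1 / 50))
    (hj : ∀ (y : ℕ → Y) (k : ℕ),
      0 < ∫⁻ u in C, M.blockL r y (k + 1) (k + 1 + j) u D ∂(M.blockL r y k (k + 1) x₀)) :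
    ∃ A : ℕ, 3 / 5 < ν.real {y | PathGood M K C D w β ℓ x₀ j m A y (m + j)} := by
  set W : Set (ℕ → Y) := {y | ¬ ∑ l ∈ Finset.Ico 0 m, (blockSum w r y l + β (pathBlock r y l)
      + drift (fun i => pathBlock r y i ∈ K) ℓ l) + ℓ + Real.log 2 ≤ 0} with hW
  set G : ℕ → Set (ℕ → Y) := fun A => {y | PathGood M K C D w β ℓ x₀ j m A y (m + j)} with hG
  have hmono : Monotone G := fun A A' hAA' y hy => PathGood.mono (by exact_mod_cast hAA') hy
  -- Once the block is in `K` and the window drift is negative, all remaining conditions bound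
  -- positive masses below or finite sums above, so they hold for large `A`.
  have hsub : {y | pathBlock r y (m + j) ∈ K} ⊆ (⋃ A, G A) ∪ shiftBy (j * r) ⁻¹' W := by
    intro y hy
    by_cases hyW : shiftBy (j * r) y ∈ W
    · exact Or.inr hyW
    left
    have hwin : ∑ l ∈ Finset.Ico (m + j - m) (m + j), (blockSum w r y l + β (pathBlock r y l)
        + drift (fun i => pathBlock r y i ∈ K) ℓ l) + ℓ + Real.log 2 ≤ 0 := by
      simp only [hW, Set.mem_ofPred_eq, not_not, blockSum_shiftBy, pathBlock_shiftBy] at hyW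
      have e : ∑ l ∈ Finset.Ico (m + j - m) (m + j), (blockSum w r y l + β (pathBlock r y l)
          + drift (fun i => pathBlock r y i ∈ K) ℓ l)
          = ∑ l ∈ Finset.Ico 0 m, (blockSum w r y (j + l) + β (pathBlock r y (j + l))
            + drift (fun i => pathBlock r y (j + i) ∈ K) ℓ l) := by
        rw [show m + j - m = j + 0 by omega, add_comm m j, ← sum_Ico_add_left]
        rfl
      rw [e]
      exact hyW
    have h1 := eventually_ex_neg_le (hj y (m + j))
    have h2 : ∀ᶠ N : ℕ in Filter.atTop, ∀ l ∈ Finset.Ico (m + j - m) (m + j), ex (-(N : ℝ)) ≤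
        ∫⁻ u in C, ∫⁻ w in C, M.blockL r y (m + j) (m + j + 1) w C
          ∂(M.blockL r y (l + 1) (m + j) u) ∂(M.blockL r y l (l + 1) x₀) := by
      rw [Filter.eventually_all_finset]
      intro l hl
      exact eventually_ex_neg_le (hC.stay_pos y (Finset.mem_Ico.1 hl).2 hx₀)
    have h3 : ∀ t : ℝ, ∀ᶠ N : ℕ in Filter.atTop, t ≤ N := fun t =>
      tendsto_natCast_atTop_atTop.eventually_ge_atTop t
    obtain ⟨N, n1, n2, n3, n4⟩ := (h1.and (h2.and
      ((h3 (∑ l ∈ Finset.Ico (m + j - (m + j)) (m + j + j + 1), blockSum w r y l)).and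
        (h3 (∑ l ∈ Finset.Ico (m + j - m) (m + j), β (pathBlock r y l)))))).exists
    exact Set.mem_iUnion.2 ⟨N, hy, le_rfl, n1, n2, hwin, n3, n4⟩
  -- `2 / 3 - 1 / 50 > 3 / 5`.
  have hU : 3 / 5 < ν.real (⋃ A, G A) := by
    have hS := H.prob_K
    rw [← H.measure_pathBlock_mem (m + j)] at hS
    have hS' := (ENNReal.toReal_lt_toReal (by simp [ENNReal.div_eq_top]) (measure_ne_top _ _)).2 hS
    have hp := measurePreserving_shiftBy H.shift (j * r)
    have hWm : ν (shiftBy (j * r) ⁻¹' W) ≤ ENNReal.ofReal (1 / 50) := by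
      refine (Measure.le_map_apply hp.measurable.aemeasurable W).trans ?_
      rwa [hp.map_eq]
    have hW' : ν.real (shiftBy (j * r) ⁻¹' W) ≤ 1 / 50 := by
      have := ENNReal.toReal_mono ENNReal.ofReal_ne_top hWm
      rwa [ENNReal.toReal_ofReal (by norm_num)] at this
    have h1 := (measureReal_mono hsub (measure_ne_top ν _)).trans (measureReal_union_le _ _)
    have h2 : (2 : ℝ) / 3 < ν.real {y | pathBlock r y (m + j) ∈ K} := by
      simpa [Measure.real] using hS'
    linarith
  have hlim := (ENNReal.tendsto_toReal (measure_ne_top ν _)).comp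
    (tendsto_measure_iUnion_atTop (μ := ν) hmono)
  obtain ⟨A, hA⟩ := (hlim.eventually_const_lt hU).exists
  exact ⟨A, hA⟩

/-- Parameters of the block decomposition for which the mean slope is negative. -/
theorem exists_parameters (H : PathModel M ν r K D χ w β) :
    ∃ (C : Set X) (ℓ a : ℝ) (x₀ : X) (j m : ℕ) (A : ℝ), 0 < ℓ ∧ 0 < a ∧ 0 ≤ A ∧ x₀ ∈ C ∧
      M.IsDoeblinSet r K C ℓ a ∧
      Integrable (fun y => pathSlope M K C D w β ℓ x₀ j m A y (m + j)) ν ∧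
      ∫ y, pathSlope M K C D w β ℓ x₀ j m A y (m + j) ∂ν < 0 := by
  classical
  set V := ∫ y, blockSum w r y 0 ∂ν + ∫ y, β (pathBlock r y 0) ∂ν with hV
  have hV0 : 0 ≤ V := add_nonneg
    (integral_nonneg fun y => Finset.sum_nonneg fun l _ => H.w_nonneg _)
    (integral_nonneg fun y => H.β_nonneg _)
  have hlog := Real.log_nonneg (show (1 : ℝ) ≤ 2 by norm_num)
  -- With good frequency above `3 / 5` the mean drift is below `-ℓ / 5`, which beats `2 * V + log
  -- 2`; also `V < ℓ / 3`, as the window requires. The window `m` depends on `ℓ` but not on `C`;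
  -- then come `C`, `j` and finally `A`.
  set ℓ : ℝ := 10 * (2 * V + Real.log 2 + 1) with hℓ
  have hℓ0 : 0 < ℓ := by positivity
  obtain ⟨m, hm⟩ := H.exists_window (ℓ := ℓ) (by rw [← hV]; linarith) hℓ0
  obtain ⟨y₁⟩ : Nonempty (ℕ → Y) := by
    by_contra hne
    rw [not_nonempty_iff] at hne
    have := measure_univ (μ := ν)
    rw [Measure.eq_zero_of_isEmpty ν] at this
    simp at this
  obtain ⟨C, a, ha, ⟨x₀, hx₀⟩, hC⟩ := H.exists_isDoeblinSet ℓ (pathBlock r y₁ 0)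
  have hlt : ν {y | ¬ ∑ l ∈ Finset.Ico 0 m, (blockSum w r y l + β (pathBlock r y l)
      + drift (fun i => pathBlock r y i ∈ K) ℓ l) + ℓ + Real.log 2 ≤ 0} < ν Set.univ := by
    refine hm.trans_lt ?_
    rw [measure_univ, ← ENNReal.ofReal_one]
    exact (ENNReal.ofReal_lt_ofReal_iff one_pos).2 (by norm_num)
  have hfreq : ∃ᵐ y ∂ν, ∑ l ∈ Finset.Ico 0 m, (blockSum w r y l + β (pathBlock r y l)
      + drift (fun i => pathBlock r y i ∈ K) ℓ l) + ℓ + Real.log 2 ≤ 0 := by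
    intro hcon
    have h1 : ν {y | ¬ ∑ l ∈ Finset.Ico 0 m, (blockSum w r y l + β (pathBlock r y l)
        + drift (fun i => pathBlock r y i ∈ K) ℓ l) + ℓ + Real.log 2 ≤ 0} = ν Set.univ :=
      measure_congr (by filter_upwards [hcon] with y hy using propext ⟨fun _ => trivial, fun _ => hy⟩)
    exact hlt.ne h1
  -- One path with a negative window suffices to find `j`, because reachability does not depend on
  -- the observations.
  obtain ⟨y, hy1, hy2, hy3⟩ :=
    (hfreq.and_eventually ((H.ae_blockChain hC hℓ0.le).and H.initial)).exists
  obtain ⟨x, hx⟩ : D.Nonempty := by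
    rw [Set.nonempty_iff_ne_empty]
    rintro rfl
    exact hy3 0 H.r_pos (by simp)
  have hchain := hy2 0
  rw [shiftBy_zero] at hchain
  obtain ⟨j, hj⟩ := H.exists_reach_pos hC hx₀ hchain hy1 hx
  obtain ⟨A, hA⟩ := H.exists_pathGood hC hx₀ hm hj
  refine ⟨C, ℓ, a, x₀, j, m, A, hℓ0, ha, Nat.cast_nonneg A, hx₀, hC, ?_⟩
  have hmG := measurableSet_pathGood (M := M) (ℓ := ℓ) (A := A) (x₀ := x₀) (j := j) (m := m)
    H.measurableSet_K hC.measurableSet H.measurableSet_D H.measurable_w H.measurable_β (m + j)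
  have hd := integrable_ite_neg (ν := ν) hmG ℓ
  have hv := H.integrable_blockSum (m + j)
  have hb := H.integrable_pathBlock (m + j + j)
  have e : (fun y => pathSlope M K C D w β ℓ x₀ j m A y (m + j))
      = fun y => 2 * (blockSum w r y (m + j) + β (pathBlock r y (m + j + j))) + Real.log 2
        + if PathGood M K C D w β ℓ x₀ j m A y (m + j) then -ℓ else ℓ := by
    funext y
    rw [pathSlope, BlockChain.slope, drift]
  have h2 : Integrable (fun y => 2 * (blockSum w r y (m + j) + β (pathBlock r y (m + j + j)))) ν :=
    (hv.1.add hb.1).const_mul 2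
  have h3 : Integrable (fun y =>
      2 * (blockSum w r y (m + j) + β (pathBlock r y (m + j + j))) + Real.log 2) ν :=
    h2.add (integrable_const _)
  rw [e]
  refine ⟨h3.add hd.1, ?_⟩
  rw [integral_add h3 hd.1, hd.2, integral_add h2 (integrable_const _), integral_const_mul,
    integral_add hv.1 hb.1, hv.2, hb.2, ← hV]
  simp only [integral_const, probReal_univ, smul_eq_mul, one_mul]
  nlinarith

end PathModel

/-! ### Bounds in probability, uniform in time -/

theorem exists_measure_not_le {Γ : Type*} [MeasurableSpace Γ] {ν : Measure Γ} [IsFiniteMeasure ν]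
    {p : ℕ → Γ → Prop} (hm : ∀ A, MeasurableSet {y | p A y})
    (hmono : ∀ A A' y, A ≤ A' → p A y → p A' y) (hae : ∀ᵐ y ∂ν, ∃ A, p A y) {ε : ℝ≥0∞}
    (hε : 0 < ε) : ∃ A, ν {y | ¬ p A y} ≤ ε := by
  have hlim := tendsto_measure_iInter_atTop (μ := ν) (s := fun A => {y | ¬ p A y})
    (fun A => (hm A).compl.nullMeasurableSet) (fun A A' hAA' y hy hp => hy (hmono A A' y hAA' hp))
    ⟨0, measure_ne_top _ _⟩
  have h0 : ν (⋂ A, {y | ¬ p A y}) = 0 := by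
    refine measure_mono_null (fun y hy => ?_) hae
    rintro ⟨A, hA⟩
    exact Set.mem_iInter.1 hy A hA
  rw [h0] at hlim
  exact (hlim.eventually_le_const hε).exists

theorem eventually_le_ex_mul {f g : ℝ≥0∞} (hf : f ≠ ∞) (hg : g ≠ 0) :
    ∀ᶠ N : ℕ in Filter.atTop, f ≤ ex N * g := by
  filter_upwards [eventually_ex_neg_le (ENNReal.div_pos hg hf)] with N hN
  have h := ENNReal.mul_le_of_le_div hN
  simpa using ex_mul_le_iff.1 h

theorem exists_one_sub_ex_pow_le {a : ℝ} (ha : 0 < a) : ∃ ρ, 0 < ρ ∧ 1 - ex (-a) ^ 4 ≤ ex (-ρ) := by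
  have h1 : Real.exp (-(4 * a)) < 1 := by
    rw [Real.exp_lt_one_iff]
    linarith
  have h2 : ex (-a) ^ 4 = ENNReal.ofReal (Real.exp (-(4 * a))) := by
    rw [ex, ← ENNReal.ofReal_pow (Real.exp_pos _).le, ← Real.exp_nat_mul]
    congr 2
    push_cast
    ring
  refine ⟨-Real.log (1 - Real.exp (-(4 * a))), ?_, ?_⟩
  · have := Real.log_neg (sub_pos.2 h1) (by linarith [Real.exp_pos (-(4 * a))])
    linarith
  · rw [h2, neg_neg, ex, Real.exp_log (sub_pos.2 h1), ENNReal.ofReal_sub _ (Real.exp_pos _).le,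
      ENNReal.ofReal_one]

namespace PathModel

open HMM BlockChain

variable {X Y : Type*} [MeasurableSpace X] [MeasurableSpace Y] {M : HMM X Y}
  {r : ℕ} {K : Set (Fin r → Y)} {D : Set X}
  {χ : Measure X} {w : Y → ℝ} {β : (Fin r → Y) → ℝ} {C : Set X} {ℓ a A : ℝ} {x₀ : X} {j m : ℕ}

theorem blockL_shiftBy_eq (y : ℕ → Y) (s : ℕ) :
    M.blockL r (shiftBy s y) = fun i k => M.L (record y (s + i * r) (s + k * r)) := by
  funext i k
  rw [blockL, record_shiftBy]

theorem isFlow_record (y : ℕ → Y) (s : ℕ) :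
    IsFlow (M.blockL r (shiftBy s y)) fun i => χ.bind (M.L (record y 0 (s + i * r))) := by
  intro i k hik
  rw [blockL_shiftBy_eq]
  exact M.bind_L_record_comp χ y (Nat.zero_le _) (by gcongr)

theorem control {y : ℕ → Y} {s N : ℕ} {c δ A₁ : ℝ}
    (hchain : BlockChain (M.blockL r (shiftBy s y)) C D (blockSum w r (shiftBy s y))
      (fun i => β (pathBlock r (shiftBy s y) i)) ℓ a (fun i => pathBlock r (shiftBy s y) i ∈ K))
    (hx₀ : x₀ ∈ C) (hN : m + j ≤ N) (ha : 0 ≤ a) (hA : 0 ≤ A) (hA₁ : 0 ≤ A₁) (hδ : 0 < δ)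
    (hδc : δ < c)
    (hinit : ∀ i ≤ m + j, χ.bind (M.L (record y 0 (s + i * r))) Set.univ
      ≤ ex A₁ * χ.bind (M.L (record y 0 (s + (i + j) * r))) D)
    (htail : ∑ l ∈ Finset.Ico 0 j, blockSum w r (shiftBy (s + N * r) y) l ≤ A₁)
    (hsums : ∀ i ≤ N - (m + j), |∑ l ∈ Finset.Ico i (N - (m + j)),
      pathSlope M K C D w β ℓ x₀ j m A ((shiftBy r)^[l] (shiftBy s y)) (m + j)
        - (((N - (m + j) : ℕ) : ℝ) - i) * (-c)| ≤ A₁ + δ * (((N - (m + j) : ℕ) : ℝ) - i)) :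
    Control (fun i k => M.L (record y (s + i * r) (s + k * r))) C D (blockSum w r (shiftBy s y))
      (fun i => β (pathBlock r (shiftBy s y) i)) ℓ a (fun i => pathBlock r (shiftBy s y) i ∈ K)
      x₀ j m A (fun i => χ.bind (M.L (record y 0 (s + i * r)))) N c δ A₁ := by
  rw [← blockL_shiftBy_eq]
  refine ⟨hchain, hx₀, isFlow_record y s, hN, ha, hA, hA₁, hδ, hδc, hinit, ?_, fun k hk hkN => ?_⟩
  · rw [← shiftBy_shiftBy] at htail
    simp only [blockSum_shiftBy] at htail
    rwa [sum_Ico_add_left (blockSum w r (shiftBy s y)), add_zero] at htail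
  -- The orbit sums evaluate the slope at index `m + j`, so orbit time `l` corresponds to block `m +
  -- j + l`.
  · have h := hsums (k - (m + j)) (by omega)
    have e : ∑ l ∈ Finset.Ico (k - (m + j)) (N - (m + j)),
        pathSlope M K C D w β ℓ x₀ j m A ((shiftBy r)^[l] (shiftBy s y)) (m + j)
        = ∑ l ∈ Finset.Ico k N, pathSlope M K C D w β ℓ x₀ j m A (shiftBy s y) l := by
      calc _ = ∑ l ∈ Finset.Ico (k - (m + j)) (N - (m + j)),
            pathSlope M K C D w β ℓ x₀ j m A (shiftBy s y) (m + j + l) := by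
            refine Finset.sum_congr rfl fun l _ => ?_
            rw [iterate_shiftBy, pathSlope_shiftBy l _ le_rfl, add_comm]
        _ = _ := by
            rw [sum_Ico_add_left, Nat.add_sub_cancel' hk, Nat.add_sub_cancel' (hk.trans hkN)]
    rw [e, Nat.cast_sub hk, Nat.cast_sub (hk.trans hkN)] at h
    have e2 : (N : ℝ) - (m + j : ℕ) - ((k : ℝ) - (m + j : ℕ)) = N - k := by ring
    rw [e2, show ((N : ℝ) - k) * -c = -(c * (N - k)) by ring, sub_neg_eq_add] at h
    exact h

variable {ν : Measure (ℕ → Y)}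

/-- Each block keeps a positive fraction of the mass of `D`, so positivity at the offset `s`
propagates. -/
theorem bind_L_record_D_ne_zero {y : ℕ → Y} {s : ℕ} {v b : ℕ → ℝ} {S : ℕ → Prop}
    (hchain : BlockChain (M.blockL r (shiftBy s y)) C D v b ℓ a S)
    (hs : χ.bind (M.L (record y 0 s)) D ≠ 0) (i : ℕ) :
    χ.bind (M.L (record y 0 (s + i * r))) D ≠ 0 := by
  intro h0
  have h := hchain.flow_D_ge (isFlow_record (χ := χ) y s) (Nat.zero_le i)
  rw [h0, mul_zero, nonpos_iff_eq_zero, zero_mul, add_zero] at h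
  exact hs h

/-- The initial masses of the predictors are comparable, up to a large probability. -/
theorem exists_init_bound [IsProbabilityMeasure χ] [IsFiniteMeasure ν]
    (H : PathModel M ν r K D χ w β) (hC : M.IsDoeblinSet r K C ℓ a) (hℓ : 0 ≤ ℓ) (j m : ℕ)
    {ε : ℝ≥0∞} (hε : 0 < ε) :
    ∃ A : ℕ, ν {y | ¬ ∀ s ∈ Finset.range r,
      ex (∑ l ∈ Finset.Ico 0 (s + (m + j) * r), w (y l))
        ≤ ex A * χ.bind (M.L (record y 0 (s + (m + j + j) * r))) D ∧
      ∀ i ∈ Finset.range (m + j + 1), χ.bind (M.L (record y 0 (s + i * r))) Set.univ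
        ≤ ex A * χ.bind (M.L (record y 0 (s + (i + j) * r))) D} ≤ ε := by
  have hu : ∀ i, Measurable fun y : ℕ → Y => y i := fun i => measurable_pi_apply i
  refine exists_measure_not_le (fun A => ?_) (fun A A' y hAA' hp s hs => ?_) ?_ hε
  · have h1 : ∀ n, Measurable fun y : ℕ → Y => ex (∑ l ∈ Finset.Ico 0 n, w (y l)) := fun n =>
      (Real.measurable_exp.comp
        (Finset.measurable_fun_sum _ fun l _ => H.measurable_w.comp (hu l))).ennreal_ofReal
    have h2 : ∀ n, Measurable fun y : ℕ → Y => χ.bind (M.L (record y 0 n)) D := fun n =>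
      M.measurable_bind_L_record_apply χ hu 0 n H.measurableSet_D
    have h3 : ∀ n, Measurable fun y : ℕ → Y => χ.bind (M.L (record y 0 n)) Set.univ := fun n =>
      M.measurable_bind_L_record_apply χ hu 0 n MeasurableSet.univ
    simp only [Set.ofPred_forall, Set.ofPred_and]
    exact Finset.measurableSet_biInter _ fun s _ =>
      (measurableSet_le (h1 _) ((h2 _).const_mul _)).inter
        (Finset.measurableSet_biInter _ fun i _ => measurableSet_le (h3 _) ((h2 _).const_mul _))
  · have hA : ex (A : ℝ) ≤ ex (A' : ℝ) := ex_mono (by exact_mod_cast hAA')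
    exact ⟨(hp s hs).1.trans (by gcongr), fun i hi => ((hp s hs).2 i hi).trans (by gcongr)⟩
  · filter_upwards [H.ae_blockChain hC hℓ, H.initial, H.w_bound] with y hy hinit hw
    refine Filter.Eventually.exists (f := Filter.atTop) ?_
    rw [Filter.eventually_all_finset]
    intro s hs
    have hD := bind_L_record_D_ne_zero (hy s) (hinit s (Finset.mem_range.1 hs))
    refine (eventually_le_ex_mul (ex_ne_top _) (hD _)).and ?_
    rw [Filter.eventually_all_finset]
    intro i _
    exact eventually_le_ex_mul
      ((M.bind_L_record_univ_le hw _ _).trans_lt (ex_ne_top _).lt_top).ne (hD _)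

/-- The asymptotic variances are bounded, uniformly in time, up to a large probability. -/
theorem exists_asympVar_le [IsProbabilityMeasure χ] [IsProbabilityMeasure ν]
    (H : PathModel M ν r K D χ w β) {h : X → ℝ} (hh : Measurable h) {B : ℝ} (hB : 0 < B)
    (hhB : ∀ x, |h x| ≤ B) {ε : ℝ≥0∞} (hε : 0 < ε) (hε' : ε ≠ ∞) :
    ∃ q : ℝ, ∀ n, ν {y | ¬ M.asympVar χ h y n ≤ q} ≤ ε := by
  obtain ⟨C, ℓ, a, x₀, j, m, A, hℓ, ha, hA, hx₀, hC, hinteg, hneg⟩ := H.exists_parameters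
  set c := -∫ y, pathSlope M K C D w β ℓ x₀ j m A y (m + j) ∂ν with hc
  have hc0 : 0 < c := by linarith
  obtain ⟨ρ, hρ, haρ⟩ := exists_one_sub_ex_pow_le ha
  -- Requested couplings per remaining block: their cost `ℓ * t` uses half of the mean slope.
  set t := c / (2 * ℓ) with ht
  have ht0 : 0 < t := by positivity
  have hρt : 0 < ρ * t := by positivity
  have hmin : 0 < min c (ρ * t) := lt_min hc0 hρt
  set δ := min c (ρ * t) / 24 with hδ
  have hδ0 : 0 < δ := by positivity
  have hδc : 24 * δ ≤ c := by linarith [min_le_left c (ρ * t)]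
  have hδρ : 24 * δ ≤ ρ * t := by linarith [min_le_right c (ρ * t)]
  have hℓt : ℓ * t ≤ c / 2 := by
    rw [ht]
    apply le_of_eq
    field_simp
  have hε3 : 0 < ε / 3 := ENNReal.div_pos hε.ne' (by norm_num)
  have hε3' : ε / 3 ≠ ∞ := ENNReal.div_ne_top hε' (by norm_num)
  obtain ⟨A₀, hA₀, hsums⟩ := exists_measure_backward_sum_le H.ergodic hinteg
    (ENNReal.toReal_pos hε3.ne' hε3') hδ0
  rw [ENNReal.ofReal_toReal hε3'] at hsums
  obtain ⟨N₂, hN₂⟩ := exists_measure_not_le (ν := ν)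
    (p := fun (N : ℕ) y => ∑ l ∈ Finset.Ico 0 j, blockSum w r y l ≤ N)
    (fun N => measurableSet_le
      (Finset.measurable_fun_sum _ fun l _ => measurable_blockSum H.measurable_w r l)
      measurable_const)
    (fun N N' y hNN' hy => hy.trans (by exact_mod_cast hNN'))
    (Filter.Eventually.of_forall fun y => exists_nat_ge _) hε3
  obtain ⟨N₃, hN₃⟩ := H.exists_init_bound hC hℓ.le j m hε3
  -- Finitely many small `n` are too short for the block decomposition; each of these variances is a
  -- finite random variable.
  obtain ⟨N₄, hN₄⟩ := exists_measure_not_le (ν := ν)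
    (p := fun (N : ℕ) y => ∀ n ∈ Finset.range (r + (m + j) * r), M.asympVar χ h y n ≤ N)
    (fun N => by
      simp only [Set.ofPred_forall]
      exact Finset.measurableSet_biInter _ fun n _ => measurableSet_le
        (M.measurable_asympVar χ (u := fun i (y : ℕ → Y) => y i)
          (fun i => measurable_pi_apply i) hh n) measurable_const)
    (fun N N' y hNN' hy n hn => (hy n hn).trans (by exact_mod_cast hNN'))
    (Filter.Eventually.of_forall fun y => by
      refine Filter.Eventually.exists (f := Filter.atTop) ?_
      rw [Filter.eventually_all_finset]
      intro n _
      exact tendsto_natCast_atTop_atTop.eventually_ge_atTop _) hε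
  set A₁ : ℝ := A₀ + N₂ + N₃ with hA₁
  have hA₁0 : 0 ≤ A₁ := by positivity
  set Q := (2 * B * Real.exp (Control.oscConst ℓ a j m A c δ A₁ ρ + Control.massConst a A c δ A₁
    + 2 * A₁ + 2 * ℓ + 9 * δ + N₃)) ^ 2
    * ((r + (m + j) * r + 1 : ℕ) + (1 - Real.exp (-(12 * δ / r)))⁻¹) with hQ
  refine ⟨max (N₄ : ℝ) Q, fun n => ?_⟩
  have hr := H.r_pos
  by_cases hn : n < r + (m + j) * r
  · refine (measure_mono fun y hy => ?_).trans hN₄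
    exact fun hall => hy ((hall n (Finset.mem_range.2 hn)).trans (le_max_left _ _))
  -- The remainder is placed at the beginning, so that the blocks end exactly at `n`. The offset
  -- takes only `r` values, over which the initial bounds are uniform.
  set s := n % r with hs
  set N := n / r with hNdef
  have hsr : s < r := Nat.mod_lt n hr
  have hnsN : n = s + N * r := (Nat.mod_add_div' n r).symm
  have hN : m + j ≤ N := by
    rw [hNdef, Nat.le_div_iff_mul_le hr]
    omega
  set E₁ : Set (ℕ → Y) := {y | ¬ ∀ i ≤ N - (m + j), |∑ l ∈ Finset.Ico i (N - (m + j)),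
      pathSlope M K C D w β ℓ x₀ j m A ((shiftBy r)^[l] y) (m + j)
        - (((N - (m + j) : ℕ) : ℝ) - i)
          * ∫ y, pathSlope M K C D w β ℓ x₀ j m A y (m + j) ∂ν|
        ≤ A₀ + δ * (((N - (m + j) : ℕ) : ℝ) - i)} with hE₁
  set E₂ : Set (ℕ → Y) := {y | ¬ ∑ l ∈ Finset.Ico 0 j, blockSum w r y l ≤ N₂} with hE₂
  set E₃ : Set (ℕ → Y) := {y | ¬ ∀ s ∈ Finset.range r,
      ex (∑ l ∈ Finset.Ico 0 (s + (m + j) * r), w (y l))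
        ≤ ex N₃ * χ.bind (M.L (record y 0 (s + (m + j + j) * r))) D ∧
      ∀ i ∈ Finset.range (m + j + 1), χ.bind (M.L (record y 0 (s + i * r))) Set.univ
        ≤ ex N₃ * χ.bind (M.L (record y 0 (s + (i + j) * r))) D} with hE₃
  -- By invariance, the exceptional events seen from the offset and from the end of the record have
  -- probabilities bounded independently of `n`.
  have hpre : ∀ p (E : Set (ℕ → Y)), ν (shiftBy p ⁻¹' E) ≤ ν E := by
    intro p E
    have hp := measurePreserving_shiftBy H.shift p
    exact (Measure.le_map_apply hp.measurable.aemeasurable E).trans_eq (by rw [hp.map_eq])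
  have hae : ∀ᵐ y ∂ν, y ∈ {y | ¬ M.asympVar χ h y n ≤ max (N₄ : ℝ) Q} →
      y ∈ shiftBy s ⁻¹' E₁ ∪ (shiftBy (s + N * r) ⁻¹' E₂ ∪ E₃) := by
    filter_upwards [H.ae_blockChain hC hℓ.le, H.initial, H.w_bound] with y hy hinit hw
    contrapose
    intro hmem
    simp only [Set.mem_union, not_or] at hmem
    obtain ⟨h1, h2, h3⟩ := hmem
    have h1' := not_not.1 h1
    have h2' := not_not.1 h2
    have h3' := not_not.1 h3 s (Finset.mem_range.2 hsr)
    have hA₀₁ : A₀ ≤ A₁ := by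
      have : (0 : ℝ) ≤ N₂ + N₃ := by positivity
      linarith
    have hN₂₁ : (N₂ : ℝ) ≤ A₁ := by
      have : (0 : ℝ) ≤ A₀ + N₃ := by positivity
      linarith
    have hN₃₁ : (N₃ : ℝ) ≤ A₁ := by
      have : (0 : ℝ) ≤ A₀ + N₂ := by positivity
      linarith
    have hctl := control (χ := χ) (N := N) (A₁ := A₁) (c := c) (δ := δ) (m := m) (j := j)
      (hy s) hx₀ hN ha.le hA hA₁0 hδ0 (by linarith)
      (fun i hi => (h3'.2 i (Finset.mem_range.2 (by omega))).trans
        (by gcongr; exact ex_mono hN₃₁)) (h2'.trans hN₂₁)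
      (fun i hi => by
        rw [hc, neg_neg]
        exact (h1' i hi).trans (by linarith))
    have hpos : χ.bind (M.L (record y 0 (s + N * r))) Set.univ ≠ 0 := fun h0 =>
      bind_L_record_D_ne_zero (hy s) (hinit s hsr) N
        (measure_mono_null (Set.subset_univ D) h0)
    refine le_trans ?_ (le_max_right (N₄ : ℝ) Q)
    have hle := M.asympVar_le hw hr hctl (fun i => by
      rw [blockSum, ← sum_Ico_add_left]
      rfl) (Nat.cast_nonneg N₃) h3'.1 hpos hρ.le haρ ht0.le hℓt hδc hδρ hh hB hhB
    rw [← hnsN] at hle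
    refine hle.trans ?_
    rw [hQ]
    gcongr
  calc ν {y | ¬ M.asympVar χ h y n ≤ max (N₄ : ℝ) Q}
      ≤ ν (shiftBy s ⁻¹' E₁ ∪ (shiftBy (s + N * r) ⁻¹' E₂ ∪ E₃)) := measure_mono_ae hae
    _ ≤ ν (shiftBy s ⁻¹' E₁) + (ν (shiftBy (s + N * r) ⁻¹' E₂) + ν E₃) :=
        (measure_union_le _ _).trans (add_le_add le_rfl (measure_union_le _ _))
    _ ≤ ε / 3 + (ε / 3 + ε / 3) := add_le_add ((hpre s E₁).trans (hsums _))
        (add_le_add ((hpre _ E₂).trans hN₂) hN₃)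
    _ = ε := by rw [← add_assoc, ENNReal.add_thirds]

end PathModel

end ParticleFilter

/-! ### Tightness -/

theorem mainTheorem1
    {X Y Ω : Type*} [MeasurableSpace X] [MeasurableSpace.CountablyGenerated X]
    [MeasurableSpace Y] [MeasurableSpace Ω]
    (M : ParticleFilter.HMM X Y)
    (P : MeasureTheory.Measure Ω) [MeasureTheory.IsProbabilityMeasure P]
    (U : ℕ → Ω → Y) (hU : ∀ n, Measurable (U n))
    (r : ℕ) (K : Set (Fin r → Y)) (D : Set X)
    (hA1 : M.ObservationCondition P U r K D) (hA2 : M.LikelihoodCondition P U)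
    (χ : MeasureTheory.Measure X) (hχ : χ ∈ M.initialLaws P U D r)
    (h : X → ℝ) (hh : Measurable h) (hb : ∃ B : ℝ, ∀ x, |h x| ≤ B) :
    ParticleFilter.IsTightFamily P
      (fun (n : ℕ+) ω => M.asympVar χ h (fun k => U k ω) n) := by
  have hχ1 := hχ.1
  obtain ⟨B, hB⟩ := hb
  obtain ⟨w, β, H⟩ := M.exists_pathModel hU hA1 hA2 hχ
  have hpath : Measurable fun ω n => U n ω := measurable_pi_lambda _ hU
  have hν := Measure.isProbabilityMeasure_map (μ := P) hpath.aemeasurable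
  have hm : ∀ n : ℕ, Measurable fun ω => M.asympVar χ h (fun k => U k ω) n := fun n =>
    M.measurable_asympVar χ hU hh n
  refine ⟨fun n => (hm n).aemeasurable, ?_⟩
  rw [isTightMeasureSet_iff_exists_isCompact_measure_compl_le]
  intro ε hε
  obtain ⟨q, hq⟩ := H.exists_asympVar_le hh (B := max B 1) (lt_max_of_lt_right one_pos)
    (fun x => (hB x).trans (le_max_left _ _)) (ε := min ε 1) (lt_min hε one_pos)
    (ne_top_of_le_ne_top ENNReal.one_ne_top (min_le_right _ _))
  -- The variance is a sum of integrals of squares, so the upper bound alone gives a compact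
  -- interval.
  refine ⟨Set.Icc 0 q, isCompact_Icc, ?_⟩
  rintro _ ⟨n, rfl⟩
  rw [Measure.map_apply (hm n) measurableSet_Icc.compl]
  refine le_trans ?_ ((hq n).trans (min_le_left _ _))
  refine le_trans (measure_mono fun ω hω => ?_) (Measure.le_map_apply hpath.aemeasurable _)
  refine fun hle => hω ⟨?_, hle⟩
  exact Finset.sum_nonneg fun k _ => integral_nonneg fun x => sq_nonneg _
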